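/- **Setting.** Let $P$ be a simple polygon in the plane with vertices $v_1,\dots,v_n$ in counterclockwise order (interior angle $\pi$ is allowed at a vertex); let $e_i$ be the open edge after $v_i$. A *nonvertex* is a point of $\partial P$ that is not a vertex; its face angle is $\pi$. A *gluing* partitions $\partial P$ by finitely many points into open intervals and glues each of them isometrically (in arc length) to another interval of equal length; corresponding endpoints are glued together, and gluing is extended transitively. It is an *Aleksandrov gluing* if at most $2\pi$ of total face angle is glued together at any point and the complex obtained from the region bounded by $P$ by these identifications is homeomorphic to a sphere. The *gluing tree* $T_G$ of an Aleksandrov gluing has as nodes the classes of boundary points glued together that do not consist of exactly two points or that contain a vertex; two nodes are adjacent if they are joined by an arc of $\partial P$ without node points in its interior; each node is labelled with the set of all vertices and edges of $P$ glued together there. A *fold point* is a point in the interior of an edge that glues only to itself; it is a leaf of $T_G$, labelled by the edge only. Disregarding nodes of degree 2, `+` denotes a tree with a single node of degree 4 and no other node of degree $\ge 3$, and `I` a tree with exactly two nodes of degree 3, joined by an edge, and no other node of degree $\geq 3$. A *belt* is the path in $T_G$ between two distinct fold-point leaves. The *belt folded at* $x$, where $x$ is a boundary point on the belt, is the gluing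 that keeps all identifications off the belt (the trees hanging off the belt stay glued, so that the belt becomes a closed curve) and folds this closed curve flat at $x$ and at the antipodal point with respect to length along the curve. The belt is a *rolling belt* of $T_G$ if, for $e$ the edge that contains one of its two fold points, there is an interval $I\subset e$ of nonzero length, on the belt, such that for every $x\in I$ the belt folded at $x$ is an Aleksandrov gluing whose gluing tree is $T_G$ (up to isomorphism of labelled trees). **Theorem.** Let $T_G$ be the gluing tree of an Aleksandrov gluing of a simple polygon $P$. 1. At every node of $T_G$ of degree $d\neq 2$, at most one nonvertex of $\partial P$ is glued. 2. At most four leaves of $T_G$ are fold points. If exactly four are, then $T_G$ has exactly four leaves, and its structure is `+` or `I`. 3. $T_G$ has at most two rolling belts. 4. If $T_G$ has two rolling belts, then its structure is `I`, and $P$ is a quadrilateral with two opposite edges replaced by complementary polygonal paths, which are glued to each other. Precisely: there are four vertices $u_1,u_2,u_3,u_4$ of $P$, in counterclockwise order and with interior angles $\neq\pi$, such that the parts of $\partial P$ from $u_1$ to $u_2$ and from $u_3$ to $u_4$ are line segments, the part from $u_2$ to $u_3$ and the part from $u_1$ (clockwise) to $u_4$ have equal length and correspond to each other, with arc length preserved,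 under an orientation-preserving rigid motion of the plane, and corresponding points of these two parts are glued together. -/

import Mathlib

open Set

noncomputable section

namespace PolygonFolding

/-- A simple polygon in the plane `ℂ` with vertices `v₀, …, vₙ₋₁` in counterclockwise order.
The half-open edges `[vᵢ, vᵢ₊₁)` are nondegenerate and pairwise disjoint.  Vertices with interior
angle `π` are allowed.  Positivity of the (doubled) signed area says that the labelling is
counterclockwise. -/
structure SimplePolygon (n : ℕ) where
  vertex : ZMod n → ℂ
  three_le : 3 ≤ n
  simple : ∀ (i j : ZMod n) (s t : ℝ), s ∈ Ico (0 : ℝ) 1 → t ∈ Ico (0 : ℝ) 1 →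
    AffineMap.lineMap (vertex i) (vertex (i + 1)) s =
      AffineMap.lineMap (vertex j) (vertex (j + 1)) t → i = j ∧ s = t
  ccw : 0 < ∑ k ∈ Finset.range n,
    ((starRingEnd ℂ) (vertex (k : ZMod n)) * vertex ((k : ZMod n) + 1)).im

namespace SimplePolygon

variable {n : ℕ} (P : SimplePolygon n)

/-- The edge `eᵢ`, an open segment. -/
def edge (i : ZMod n) : Set ℂ := openSegment ℝ (P.vertex i) (P.vertex (i + 1))

/-- The vector from `vₖ` to `vₖ₊₁`. -/
def edgeVec (k : ℕ) : ℂ := P.vertex ((k : ZMod n) + 1) - P.vertex (k : ZMod n)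

/-- The length of the boundary path from `v₀` to `vₖ`. -/
def cumLength (k : ℕ) : ℝ := ∑ j ∈ Finset.range k, ‖P.edgeVec j‖

def perimeter : ℝ := P.cumLength n

/-- The counterclockwise arc-length parametrization of the boundary, with `bdry 0 = v₀`, extended
periodically (with period the perimeter) to the real line.  Each summand is the part of the
`k`-th edge that has been traversed. -/
def bdry (s : ℝ) : ℂ :=
  P.vertex 0 + ∑ k ∈ Finset.range n,
    ((max 0 (min (P.perimeter * Int.fract (s / P.perimeter) - P.cumLength k) ‖P.edgeVec k‖)
      / ‖P.edgeVec k‖ : ℝ) : ℂ) * P.edgeVec k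

/-- The boundary `∂P`. -/
def boundary : Set ℂ := ⋃ i : ZMod n, segment ℝ (P.vertex i) (P.vertex (i + 1))

/-- The closed region bounded by the polygon: the boundary together with the bounded part of its
complement. -/
def region : Set ℂ :=
  {z | z ∈ P.boundary ∨ Bornology.IsBounded (connectedComponentIn P.boundaryᶜ z)}

def IsVertex (z : ℂ) : Prop := ∃ i, P.vertex i = z

/-- The interior angle at `vᵢ`, in `[0, 2π)`: the counterclockwise angle from the direction of
`vᵢ₊₁` to the direction of `vᵢ₋₁`. -/
def interiorAngle (i : ZMod n) : ℝ :=
  toIcoMod Real.two_pi_pos 0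
    (Complex.arg ((P.vertex (i - 1) - P.vertex i) / (P.vertex (i + 1) - P.vertex i)))

open Classical in
/-- The face angle of the polygon at a boundary point: the interior angle at a vertex, and `π` at a
point in the interior of an edge. -/
def angleAt (z : ℂ) : ℝ :=
  if h : P.IsVertex z then P.interiorAngle h.choose else Real.pi

end SimplePolygon

/-- A gluing of the boundary of `P`.  The boundary is cut at the finitely many points with
arc-length parameters `cut 0 < cut 1 < ⋯ < cut m = cut 0 + perimeter`; the `i`-th open interval is
glued isometrically to a different interval `mate i` of equal length, reversing the direction if
`rev i` is true and keeping it otherwise. -/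
structure Gluing {n : ℕ} (P : SimplePolygon n) where
  m : ℕ
  cut : Fin (m + 1) → ℝ
  cut_strictMono : StrictMono cut
  cut_last : cut (Fin.last m) = cut 0 + P.perimeter
  mate : Fin m → Fin m
  mate_mate : ∀ i, mate (mate i) = i
  mate_ne : ∀ i, mate i ≠ i
  length_mate : ∀ i, cut (mate i).succ - cut (mate i).castSucc = cut i.succ - cut i.castSucc
  rev : Fin m → Bool
  rev_mate : ∀ i, rev (mate i) = rev i

namespace Gluing

variable {n : ℕ} {P : SimplePolygon n} (G : Gluing P)

/-- Corresponding points (endpoints included) of two glued intervals. -/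
def Pair (z w : ℂ) : Prop :=
  ∃ i : Fin G.m, ∃ t ∈ Icc (0 : ℝ) (G.cut i.succ - G.cut i.castSucc),
    z = P.bdry (G.cut i.castSucc + t) ∧
    w = P.bdry (if G.rev i then G.cut (G.mate i).succ - t else G.cut (G.mate i).castSucc + t)

/-- The identification of points: the equivalence relation generated by the glued pairs. A point
that is not on the boundary is identified with itself only. -/
def setoid : Setoid ℂ := Relation.EqvGen.setoid G.Pair

def Glued (z w : ℂ) : Prop := G.setoid z w

/-- The set of all points that are glued to `z`. -/
def cls (z : ℂ) : Set ℂ := {w | G.Glued z w}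

/-- The complex that results from the gluing, with the quotient topology. -/
abbrev GluedComplex : Type := Quotient (G.setoid.comap ((↑) : P.region → ℂ))

/-- An Aleksandrov gluing: at most `2π` total face angle is glued together at any point, and
the resulting complex is homeomorphic to a sphere. -/
def IsAleksandrov : Prop :=
  (∀ F : Finset ℂ, (F : Set ℂ) ⊆ P.boundary → (∀ z ∈ F, ∀ w ∈ F, G.Glued z w) →
    ∑ z ∈ F, P.angleAt z ≤ 2 * Real.pi) ∧
  Nonempty (G.GluedComplex ≃ₜ Metric.sphere (0 : EuclideanSpace ℝ (Fin 3)) 1)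

/-- A boundary point belongs to a node of the gluing tree if it is identified with more or less
than one other point, or if a vertex is glued there. -/
def IsNodePoint (z : ℂ) : Prop :=
  z ∈ P.boundary ∧ ((G.cls z).encard ≠ 2 ∨ ∃ w ∈ G.cls z, P.IsVertex w)

/-- The nodes of the gluing tree, as sets of boundary points glued together. -/
def Node : Type := {K : Set ℂ // ∃ z, G.IsNodePoint z ∧ K = G.cls z}

/-- The parameters `s < t` bound an arc of the boundary between consecutive node points. -/
def IsArc (s t : ℝ) : Prop :=
  s < t ∧ t ≤ s + P.perimeter ∧ G.IsNodePoint (P.bdry s) ∧ G.IsNodePoint (P.bdry t) ∧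
    ∀ u ∈ Ioo s t, ¬ G.IsNodePoint (P.bdry u)

/-- The gluing tree: two nodes are adjacent if they are joined by a boundary arc that contains no
node point in its interior. -/
def tree : SimpleGraph G.Node where
  Adj a b := a ≠ b ∧ ∃ s t, G.IsArc s t ∧
    ((P.bdry s ∈ a.1 ∧ P.bdry t ∈ b.1) ∨ (P.bdry s ∈ b.1 ∧ P.bdry t ∈ a.1))
  symm := ⟨fun _ _ ⟨h, s, t, hst, h'⟩ => ⟨h.symm, s, t, hst, h'.symm⟩⟩
  loopless := ⟨fun _ h => h.1 rfl⟩

/-- The label of a node: all the vertices (`Sum.inl`) and edges (`Sum.inr`) of the polygon that are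
glued together there. -/
def label (a : G.Node) : Set (ZMod n ⊕ ZMod n) :=
  {l | (∃ i, l = Sum.inl i ∧ P.vertex i ∈ a.1) ∨
    (∃ i, l = Sum.inr i ∧ (a.1 ∩ P.edge i).Nonempty)}

/-- Two gluings of a polygon have the same combinatorial gluing tree: their trees are isomorphic
as labelled trees. -/
def SameTree (G G' : Gluing P) : Prop :=
  ∃ φ : G.tree ≃g G'.tree, ∀ a, G'.label (φ a) = G.label a

end Gluing

/-- The degree of a node of a graph. -/
def deg {V : Type*} (T : SimpleGraph V) (a : V) : ℕ∞ := (T.neighborSet a).encard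

/-- The combinatorial structure `+` (nodes of degree 2 are disregarded): a tree with a single node
of degree 4 and no other node of degree greater than 2. -/
def IsPlus {V : Type*} (T : SimpleGraph V) : Prop :=
  T.IsTree ∧ ∃ a, deg T a = 4 ∧ ∀ b, b ≠ a → deg T b ≤ 2

/-- The combinatorial structure `I` (nodes of degree 2 are disregarded): a tree with exactly two
nodes of degree 3 and no other node of degree greater than 2.  In such a tree the two nodes of
degree 3 are joined by a path through nodes of degree 2, that is, by one edge once the nodes of
degree 2 are suppressed. -/
def IsI {V : Type*} (T : SimpleGraph V) : Prop :=
  T.IsTree ∧ ∃ a b, a ≠ b ∧ deg T a = 3 ∧ deg T b = 3 ∧ ∀ c, c ≠ a → c ≠ b → deg T c ≤ 2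

namespace Gluing

variable {n : ℕ} {P : SimplePolygon n} (G : Gluing P)

def IsLeaf (a : G.Node) : Prop := deg G.tree a = 1

/-- A leaf that is a fold point: a point in the interior of an edge that glues only to itself. -/
def IsFoldLeaf (a : G.Node) : Prop := G.IsLeaf a ∧ ∃ z i, z ∈ P.edge i ∧ a.1 = {z}

/-- The boundary points that lie, after gluing, on a given path of the gluing tree: the points of
the nodes of the path and the points of the arcs of the path. -/
def pathPoints {a b : G.Node} (W : G.tree.Walk a b) : Set ℂ :=
  {z | (∃ c ∈ W.support, z ∈ c.1) ∨
    ∃ s t u, G.IsArc s t ∧ u ∈ Ioo s t ∧ z = P.bdry u ∧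
      ∃ c d : G.Node, s(c, d) ∈ W.edges ∧ P.bdry s ∈ c.1 ∧ P.bdry t ∈ d.1}

/-- The gluing `G'` arises from `G` by folding the belt with point set `B` at `bdry r`. Off the belt
nothing changes.  Two points of the belt are glued together if the length of belt met on the way from
`bdry r` counterclockwise to the one equals the length of belt met on the way from
`bdry r` clockwise to the other. (So once the trees that hang off the belt are glued shut, the belt is a
closed curve, and it is folded flat at `bdry r` and at the antipodal point.) -/
def IsBeltFoldedAt (B : Set ℂ) (r : ℝ) (G' : Gluing P) : Prop :=
  G'.setoid = Relation.EqvGen.setoid fun z w =>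
    (z ∉ B ∧ w ∉ B ∧ G.Glued z w) ∨
    (z ∈ B ∧ w ∈ B ∧ ∃ s ∈ Icc 0 P.perimeter, ∃ t ∈ Icc 0 P.perimeter,
      z = P.bdry (r + s) ∧ w = P.bdry (r - t) ∧
      MeasureTheory.volume {u | u ∈ Icc 0 s ∧ P.bdry (r + u) ∈ B} =
        MeasureTheory.volume {u | u ∈ Icc 0 t ∧ P.bdry (r - u) ∈ B})

/-- The path of the gluing tree between the leaves `a` and `b` is a rolling belt: `a` and `b` are
distinct fold points, and there is an interval of positive length on the belt, inside the edge `e`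
of the fold point `a`, such that for each of its points `x` the belt folded at `x` is an Aleksandrov
gluing with the given (combinatorial) gluing tree. -/
def IsRollingBelt (a b : G.Node) : Prop :=
  a ≠ b ∧ G.IsFoldLeaf a ∧ G.IsFoldLeaf b ∧
  ∃ W : G.tree.Walk a b, W.IsPath ∧
  ∃ i, a.1 ⊆ P.edge i ∧ ∃ α β : ℝ, α < β ∧ ∀ r ∈ Ioo α β,
    P.bdry r ∈ P.edge i ∧ P.bdry r ∈ G.pathPoints W ∧
    ∃ G' : Gluing P, G.IsBeltFoldedAt (G.pathPoints W) r G' ∧ G'.IsAleksandrov ∧ SameTree G G'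

/-- The rolling belts of a gluing tree, each given by its unordered pair of end leaves. -/
def rollingBelts : Set (Sym2 G.Node) := {p | ∃ a b, p = s(a, b) ∧ G.IsRollingBelt a b}

/-- The gluing folds a quadrilateral with two opposite edges replaced by complementary polygonal
paths.  There are four corners, with parameters `s₁ < s₂ < s₃ < s₄`, in counterclockwise order on
the boundary; the sides from `s₁` to `s₂` and from `s₃` to `s₄` are straight; the paths
from `s₂` to `s₃` and from `s₁` (backwards) to `s₄` have equal length, correspond to each other under
an orientation-preserving rigid motion of the plane, and are glued to each other accordingly. -/
def IsFromComplementaryQuadrilateral : Prop :=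
  ∃ s₁ s₂ s₃ s₄ : ℝ, s₁ < s₂ ∧ s₂ < s₃ ∧ s₃ < s₄ ∧ s₄ < s₁ + P.perimeter ∧
    (∀ s ∈ ({s₁, s₂, s₃, s₄} : Set ℝ), P.IsVertex (P.bdry s) ∧ P.angleAt (P.bdry s) ≠ Real.pi) ∧
    P.bdry '' Icc s₁ s₂ = segment ℝ (P.bdry s₁) (P.bdry s₂) ∧
    P.bdry '' Icc s₃ s₄ = segment ℝ (P.bdry s₃) (P.bdry s₄) ∧
    s₃ - s₂ = s₁ + P.perimeter - s₄ ∧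
    ∃ ω c : ℂ, ‖ω‖ = 1 ∧ ∀ t ∈ Icc 0 (s₃ - s₂),
      P.bdry (s₂ + t) = ω * P.bdry (s₁ - t) + c ∧ G.Glued (P.bdry (s₂ + t)) (P.bdry (s₁ - t))

end Gluing

end PolygonFolding

end

noncomputable section

namespace PolygonFolding

/-! ### Arguments of complex numbers in a half-plane -/

/-! The engine is a curvature count. Let `V` be the number of nodes and `N` the number of boundary
points at nodes. The curvature of a node is `2π` minus the angle glued there; it is nonnegative by
the angle condition and equals `π` at a fold point. Hopf's argument (`sum_turning_le_of_extreme`)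
bounds the angle sum of the polygon from below by `(n - 2)π`, so the total curvature is at most `(2V
- N + 2)π` (`sum_curv_le`). Conversely the boundary walk shows that the graph is connected, and each
neighbour of a node uses up at least two of the boundary directions there, so the handshake formula
gives `2V ≤ N + 2` (`card_le`). Together these allow at most four fold points. Arcs between node
points are glued in pairs, so `N` is even, and three fold points already force `2V = N + 2`: the
graph is a tree whose degrees count the points at the nodes (`TreeLike`). Four fold points leave no
curvature elsewhere; then every leaf is a fold point and the handshake formula leaves only `+` and
`I`. The claim on nonvertices is the angle condition alone: two nonvertices at a node exhaust `2π`,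
so nothing else is glued there, and then the class is not a node.

For rolling belts, fold the belt at a generic point. Two belt points can then be glued only if they
have the same place on the closed belt, since the mirror condition holds for only countably many
fold points. Labels do not change, so vertices glued together at a belt node are at the same place
(`alignedVertices_of_rolling`). Hence at an interior node of the belt one of its two sides passes
through a single nonvertex (`turn_of_aligned`). A node has only one nonvertex, so a belt is
determined by any of its directed edges, and distinct belts are disjoint
(`IsBelt.eq_of_mem_support`). Three belts would have too many fold points.

Two belts have four fold points, so all other nodes are flat. Each belt has a branching node, which
gives the structure `I`. Flatness makes each belt the folding of a straight side between two corners
whose angles add up to `π` (`IsBelt.exists_isFoldedSide`). Between the two sides the boundary paths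
are glued point to point, with angles adding up to `2π`, so they run in opposite directions
throughout and are translates of each other (`isFromComplementaryQuadrilateral_of_sides`). -/

lemma arg_div_of_arg_sub_mem {z w : ℂ} (hz : z ≠ 0) (hw : w ≠ 0)
    (h : w.arg - z.arg ∈ Ioc (-Real.pi) Real.pi) : (w / z).arg = w.arg - z.arg := by
  have h1 : ((w / z).arg : Real.Angle) = ((w.arg - z.arg : ℝ) : Real.Angle) := by
    rw [Complex.arg_div_coe_angle hw hz, Real.Angle.coe_sub]
  have h2 := congrArg Real.Angle.toReal h1
  rwa [Complex.arg_coe_angle_toReal_eq_arg, Real.Angle.toReal_coe_eq_self_iff.2 h] at h2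

/-- Multiplication by the conjugate of `c` turns the half-plane around `c` into the right
half-plane, where arguments lie in `(-π/2, π/2)` and their differences do not wrap around. -/
lemma arg_div_of_re_pos {c z w : ℂ} (hz : 0 < (starRingEnd ℂ c * z).re)
    (hw : 0 < (starRingEnd ℂ c * w).re) :
    (w / z).arg = (starRingEnd ℂ c * w).arg - (starRingEnd ℂ c * z).arg := by
  have hz0 : starRingEnd ℂ c * z ≠ 0 := by rintro h; simp [h] at hz
  have hw0 : starRingEnd ℂ c * w ≠ 0 := by rintro h; simp [h] at hw
  rw [← mul_div_mul_left w z (left_ne_zero_of_mul hz0)]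
  refine arg_div_of_arg_sub_mem hz0 hw0 ?_
  have h1 := abs_lt.1 (Complex.abs_arg_lt_pi_div_two_iff.2 (Or.inl hz))
  have h2 := abs_lt.1 (Complex.abs_arg_lt_pi_div_two_iff.2 (Or.inl hw))
  constructor <;> linarith

lemma arg_div_add_arg_div {c x y z : ℂ} (hx : 0 < (starRingEnd ℂ c * x).re)
    (hy : 0 < (starRingEnd ℂ c * y).re) (hz : 0 < (starRingEnd ℂ c * z).re) :
    (y / x).arg + (z / y).arg = (z / x).arg := by
  rw [arg_div_of_re_pos hx hy, arg_div_of_re_pos hy hz, arg_div_of_re_pos hx hz]; ring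

lemma exists_halfplane {S : Set ℂ} (hc : Convex ℝ S) (hS : IsClosed S) (h0 : (0 : ℂ) ∉ S) :
    ∃ c : ℂ, ∀ z ∈ S, 0 < (starRingEnd ℂ c * z).re := by
  obtain ⟨f, u, h1, h2⟩ := geometric_hahn_banach_point_closed hc hS h0
  -- Every real functional on `ℂ` is a real inner product; this is the vector that represents `f`.
  refine ⟨⟨f 1, f Complex.I⟩, fun z hz => ?_⟩
  have : f z = (starRingEnd ℂ ⟨f 1, f Complex.I⟩ * z).re := by
    conv_lhs => rw [← Complex.re_add_im z]
    have e1 : ((z.re : ℝ) : ℂ) = z.re • (1 : ℂ) := by simp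
    have e2 : ((z.im : ℝ) : ℂ) * Complex.I = z.im • Complex.I := by simp
    rw [e1, e2, map_add, map_smul, map_smul]
    simp [Complex.mul_re]; ring
  rw [← this]
  rw [map_zero] at h1
  exact h1.trans (h2 z hz)

/-- The segment misses the origin, so `x`, `y` and their sum lie in one open half-plane, where
signed angles add. It splits an exterior angle at the secant across the vertex. -/
lemma arg_div_triangle {x y : ℂ} (h : (0 : ℂ) ∉ segment ℝ x y) :
    ((x + y) / x).arg + (y / (x + y)).arg = (y / x).arg := by
  obtain ⟨c, hc⟩ := exists_halfplane (convex_segment x y)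
    (by rw [segment_eq_image]; exact (isCompact_Icc.image (by fun_prop)).isClosed) h
  have hx := hc x (left_mem_segment ℝ x y)
  have hy := hc y (right_mem_segment ℝ x y)
  refine arg_div_add_arg_div hx ?_ hy
  rw [mul_add, Complex.add_re]; exact add_pos hx hy

open scoped Pointwise in
-- The secant directions from one segment to the other form a compact convex set without the origin,
-- hence lie in a half-plane. So the order in which the two ends of a secant are moved does not
-- matter.
lemma arg_div_parallelogram {a b c d : ℂ} (h : Disjoint (segment ℝ a b) (segment ℝ c d)) :
    ((d - a) / (c - a)).arg + ((d - b) / (d - a)).arg =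
      ((c - b) / (c - a)).arg + ((d - b) / (c - b)).arg := by
  obtain ⟨u, hu⟩ := exists_halfplane (S := segment ℝ c d - segment ℝ a b)
    ((convex_segment c d).sub (convex_segment a b))
    (by
      have hk : ∀ x y : ℂ, IsCompact (segment ℝ x y) := fun x y => by
        rw [segment_eq_image]; exact isCompact_Icc.image (by fun_prop)
      rw [sub_eq_add_neg]
      exact ((hk c d).add (hk a b).neg).isClosed)
    (by
      rintro ⟨x, hx, y, hy, hxy⟩
      rw [sub_eq_zero.1 hxy] at hx
      exact Set.disjoint_left.1 h hy hx)
  have m : ∀ x ∈ segment ℝ c d, ∀ y ∈ segment ℝ a b, 0 < (starRingEnd ℂ u * (x - y)).re :=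
    fun x hx y hy => hu _ (Set.sub_mem_sub hx hy)
  have la := left_mem_segment ℝ a b
  have lb := right_mem_segment ℝ a b
  have lc := left_mem_segment ℝ c d
  have ld := right_mem_segment ℝ c d
  rw [arg_div_add_arg_div (m c lc a la) (m d ld a la) (m d ld b lb),
    arg_div_add_arg_div (m c lc a la) (m c lc b lb) (m d ld b lb)]

/-! ### The turning number of a simple closed polygonal path -/

/-- Adds up the cells of one column of the grid of secants; the turns across inner sides cancel. -/
lemma add_sum_Ico_telescope {H V V' : ℕ → ℝ} {a m : ℕ} (ham : a ≤ m)
    (h : ∀ i, a ≤ i → i < m → H i + V' i = V i + H (i + 1)) :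
    H a + ∑ i ∈ Finset.Ico a m, V' i = ∑ i ∈ Finset.Ico a m, V i + H m := by
  induction m, ham using Nat.le_induction with
  | base => simp
  | succ m ham ih =>
    rw [Finset.sum_Ico_succ_top ham, Finset.sum_Ico_succ_top ham, ← add_assoc,
      ih fun i h1 h2 => h i h1 (by omega)]
    linarith [h m ham (by omega)]

/-- Hopf's argument for the turning number: the secant directions of a simple closed polygonal
path that starts at an extreme vertex. -/
lemma sum_turning_le_of_extreme {n : ℕ} (hn : 3 ≤ n) (v : ℕ → ℂ) (hv : v n = v 0)
    (hv1 : v (n + 1) = v 1)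
    (hadj : ∀ i < n, (0 : ℂ) ∉ segment ℝ (v (i + 1) - v i) (v (i + 2) - v (i + 1)))
    (hdis : ∀ i j, i + 1 < j → j + 1 ≤ n → ¬ (i = 0 ∧ j + 1 = n) →
      Disjoint (segment ℝ (v i) (v (i + 1))) (segment ℝ (v j) (v (j + 1))))
    (hext : ∀ k, 1 ≤ k → k < n → v k - v 0 ≠ 0 ∧ (v k - v 0).arg ∈ Ico 0 Real.pi) :
    ∑ i ∈ Finset.range n, ((v (i + 2) - v (i + 1)) / (v (i + 1) - v i)).arg ≤ 2 * Real.pi := by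
  obtain ⟨n, rfl⟩ : ∃ k, n = k + 2 := ⟨n - 2, by omega⟩
  -- `D` is the secant, `H` its turn when the far end moves on by one vertex, `V` its turn when the
  -- near end does, and `ext` the exterior angle.
  set D : ℕ → ℕ → ℂ := fun i j => v j - v i with hD
  set H : ℕ → ℕ → ℝ := fun i j => (D i (j + 1) / D i j).arg with hH
  set V : ℕ → ℕ → ℝ := fun i j => (D (i + 1) j / D i j).arg with hV
  set ext : ℕ → ℝ := fun i => ((v (i + 2) - v (i + 1)) / (v (i + 1) - v i)).arg with hextdef
  have cell : ∀ i j, i + 1 < j → j + 1 ≤ n + 2 → ¬ (i = 0 ∧ j + 1 = n + 2) →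
      H i j + V i (j + 1) = V i j + H (i + 1) j := fun i j h1 h2 h3 =>
    arg_div_parallelogram (hdis i j h1 h2 h3)
  have diag : ∀ i < n + 2, ext i = H i (i + 1) + V i (i + 2) := by
    intro i hi
    have := arg_div_triangle (hadj i hi)
    simp only [hextdef, hH, hV, hD]
    rw [← this]
    congr 3 <;> ring
  -- The tangent's path along the diagonal is deformed across the cells: first the far end runs from
  -- `1` to `j + 1` with the near end at `0`, then the near end follows.
  have path : ∀ j, j ≤ n → ∑ i ∈ Finset.range j, ext i =
      ∑ k ∈ Finset.range j, H 0 (k + 1) + ∑ i ∈ Finset.Ico 0 j, V i (j + 1) := by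
    intro j
    induction j with
    | zero => simp
    | succ j ih =>
      intro hj
      rw [Finset.sum_range_succ, ih (by omega), Finset.sum_range_succ, diag j (by omega),
        Finset.sum_Ico_succ_top (Nat.zero_le j)]
      have := add_sum_Ico_telescope (H := fun i => H i (j + 1)) (V := fun i => V i (j + 1))
        (V' := fun i => V i (j + 2)) (Nat.zero_le j)
        fun i _ h2 => cell i (j + 1) (by omega) (by omega) (by omega)
      beta_reduce at this
      have e : j + 1 + 1 = j + 2 := rfl
      rw [e]; linarith
  have hn0 : 0 < n := by omega
  -- The first and the last edge share the start vertex, so their cell is not available; a triangle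
  -- with all directions reversed replaces it.
  have last : ext (n + 1) = V 0 (n + 1) + H 1 (n + 1) := by
    have := arg_div_triangle (hadj (n + 1) (by omega))
    have e1 : v (n + 1 + 1) = v 0 := hv
    have e2 : v (n + 1 + 2) = v 1 := hv1
    simp only [hextdef, hH, hV, hD, e1, e2] at this ⊢
    rw [← this, zero_add]
    congr 2
    · rw [← neg_div_neg_eq]; congr 1 <;> ring
    · rw [← neg_div_neg_eq]; congr 1 <;> ring
  have tele := add_sum_Ico_telescope (H := fun i => H i (n + 1)) (V := fun i => V i (n + 1))
        (V' := fun i => V i (n + 2)) (a := 1) (m := n) (by omega)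
        fun i h1 h2 => cell i (n + 1) (by omega) (by omega) (by omega)
  beta_reduce at tele
  have p := path n le_rfl
  rw [Finset.sum_eq_sum_Ico_succ_bot hn0 fun i => V i (n + 1)] at p
  -- Secants to the end vertex are reversed secants from the start vertex, so the second leg repeats
  -- the turns of the first.
  have hVn : ∀ i, V i (n + 2) = H 0 i := by
    intro i
    simp only [hV, hH, hD, hv]
    rw [← neg_div_neg_eq]; congr 2 <;> ring
  have hA : ∀ j, j ≤ n → ∑ k ∈ Finset.range j, H 0 (k + 1) = (D 0 (j + 1)).arg - (D 0 1).arg := by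
    intro j
    induction j with
    | zero => simp
    | succ j ih =>
      intro hj
      rw [Finset.sum_range_succ, ih (by omega)]
      obtain ⟨h1, h2, h3⟩ := hext (j + 1) (by omega) (by omega)
      obtain ⟨h4, h5, h6⟩ := hext (j + 1 + 1) (by omega) (by omega)
      have : H 0 (j + 1) = _ := arg_div_of_arg_sub_mem h1 h4 ⟨by linarith, by linarith⟩
      rw [this]; ring
  have hB : ∑ i ∈ Finset.Ico 1 n, V i (n + 2) + V n (n + 2) = ∑ k ∈ Finset.range n, H 0 (k + 1) := by
    rw [← Finset.sum_Ico_succ_top (by omega), Finset.sum_Ico_eq_sum_range]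
    exact Finset.sum_congr rfl fun i _ => by rw [hVn, add_comm]
  have tot : ∑ i ∈ Finset.range (n + 2), ext i =
      2 * ((D 0 (n + 1)).arg - (D 0 1).arg + ext (n + 1)) := by
    rw [Finset.sum_range_succ, Finset.sum_range_succ, diag n (by omega)]
    rw [← hA n le_rfl]
    have e : n + 0 + 1 = n + 1 := rfl
    simp only [Finset.sum_Ico_eq_sum_range, zero_add] at *
    linarith
  rw [tot]
  obtain ⟨a0, a1, a2⟩ := hext 1 le_rfl (by omega)
  obtain ⟨b0, b1, b2⟩ := hext (n + 1) (by omega) (by omega)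
  have hx : ext (n + 1) ≤ Real.pi := Complex.arg_le_pi _
  have e1 : v (n + 1 + 1) = v 0 := hv
  have e2 : v (n + 1 + 2) = v 1 := hv1
  -- Half of the total turning is `π` modulo `2π`. It is also less than `2π`, since the two
  -- arguments lie in `[0, π)` and the last exterior angle is at most `π`; so it is at most `π`.
  have hmod : (((D 0 (n + 1)).arg - (D 0 1).arg + ext (n + 1) : ℝ) : Real.Angle) = Real.pi := by
    simp only [hextdef, e1, e2]
    have hne : v 0 - v (n + 1) ≠ 0 := by
      intro h; apply b0; rw [← neg_sub, h, neg_zero]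
    rw [Real.Angle.coe_add, Real.Angle.coe_sub, Complex.arg_div_coe_angle a0 hne]
    have : v 0 - v (n + 1) = -(v (n + 1) - v 0) := by ring
    rw [this, Complex.arg_neg_coe_angle b0]
    simp only [hD]
    rw [add_comm (((v (n + 1) - v 0).arg : ℝ) : Real.Angle), ← sub_sub]
    have e3 : ∀ x y z : Real.Angle, x - y + (y - z - x) = -z := fun x y z => by abel
    rw [e3, Real.Angle.neg_coe_pi]
  rw [Real.Angle.angle_eq_iff_two_pi_dvd_sub] at hmod
  obtain ⟨k, hk⟩ := hmod
  have hk1 : (k : ℝ) < 1 := by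
    by_contra hcon
    push Not at hcon
    have hpi := Real.pi_pos
    simp only [hD] at *
    nlinarith
  have hk0 : (k : ℝ) ≤ 0 := by exact_mod_cast Int.lt_add_one_iff.1 (by exact_mod_cast hk1)
  nlinarith [Real.pi_pos]

lemma sum_range_zmod {M : Type*} [AddCommMonoid M] {n : ℕ} [NeZero n] (f : ZMod n → M) :
    ∑ k ∈ Finset.range n, f (k : ZMod n) = ∑ i, f i := by
  refine Finset.sum_nbij' (fun k => (k : ZMod n)) ZMod.val (by simp)
    (fun i _ => Finset.mem_range.2 (ZMod.val_lt i)) ?_ (by simp) (by simp)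
  intro k hk
  exact ZMod.val_cast_of_lt (Finset.mem_range.1 hk)

/-! ### Edges, exterior angles and the angle sum of a simple polygon -/

namespace SimplePolygon

variable {n : ℕ} (P : SimplePolygon n)

lemma neZero (P : SimplePolygon n) : NeZero n := ⟨by have := P.three_le; omega⟩

lemma natCast_inj_of_lt {j k : ℕ} (hj : j < n) (hk : k < n)
    (h : (j : ZMod n) = (k : ZMod n)) : j = k := by
  have := congrArg ZMod.val h
  rwa [ZMod.val_cast_of_lt hj, ZMod.val_cast_of_lt hk] at this

lemma vertex_injective : Function.Injective P.vertex := by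
  intro i j h
  exact (P.simple i j 0 0 (by simp) (by simp) (by simpa using h)).1

lemma succ_ne (P : SimplePolygon n) (i : ZMod n) : i + 1 ≠ i := by
  intro h
  have h1 : ((1 : ℕ) : ZMod n) = ((0 : ℕ) : ZMod n) := by simpa using h
  have := P.three_le
  exact absurd (natCast_inj_of_lt (by omega) (by omega) h1) one_ne_zero

/-- The vector of the edge after `vᵢ`. -/
def dir (i : ZMod n) : ℂ := P.vertex (i + 1) - P.vertex i

lemma dir_ne_zero (i : ZMod n) : P.dir i ≠ 0 := by
  intro h
  exact P.succ_ne i (P.vertex_injective (sub_eq_zero.1 h))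

/-- Consecutive edges of opposite directions would overlap near their common vertex. -/
lemma zero_notMem_segment_dir (i : ZMod n) :
    (0 : ℂ) ∉ segment ℝ (P.dir i) (P.dir (i + 1)) := by
  rintro ⟨a, b, ha, hb, hab, h⟩
  have ha0 : 0 < a := by
    rcases ha.lt_or_eq with h' | h'
    · exact h'
    · subst h'
      have : b = 1 := by linarith
      subst this
      exact absurd (by simpa using h) (P.dir_ne_zero (i + 1))
  have hb0 : 0 < b := by
    rcases hb.lt_or_eq with h' | h'
    · exact h'
    · subst h'
      have : a = 1 := by linarith
      subst this
      exact absurd (by simpa using h) (P.dir_ne_zero i)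
  -- A common point of both edges close to the shared vertex; halving the weights keeps both
  -- parameters in `[0, 1)`.
  have key : AffineMap.lineMap (P.vertex i) (P.vertex (i + 1)) (1 - a / 2) =
      AffineMap.lineMap (P.vertex (i + 1)) (P.vertex (i + 1 + 1)) (b / 2) := by
    simp only [dir, Complex.real_smul] at h
    simp only [AffineMap.lineMap_apply, vsub_eq_sub, vadd_eq_add, Complex.real_smul]
    push_cast
    linear_combination (-1 / 2 : ℂ) * h
  have := (P.simple i (i + 1) _ _ ⟨by linarith, by linarith⟩ ⟨by linarith, by linarith⟩ key).1
  exact P.succ_ne i this.symm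

lemma disjoint_segment {i j : ZMod n} (h1 : i ≠ j) (h2 : i ≠ j + 1) (h3 : i + 1 ≠ j) :
    Disjoint (segment ℝ (P.vertex i) (P.vertex (i + 1)))
      (segment ℝ (P.vertex j) (P.vertex (j + 1))) := by
  -- A closed edge is a half-open edge together with the start of the next one, so the simplicity
  -- condition applies.
  have red : ∀ (i : ZMod n) (z : ℂ), z ∈ segment ℝ (P.vertex i) (P.vertex (i + 1)) →
      ∃ k s, (k = i ∨ k = i + 1) ∧ s ∈ Ico (0 : ℝ) 1 ∧
        z = AffineMap.lineMap (P.vertex k) (P.vertex (k + 1)) s := by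
    intro i z hz
    rw [segment_eq_image_lineMap] at hz
    obtain ⟨t, ⟨h0, h1⟩, rfl⟩ := hz
    rcases h1.lt_or_eq with h | rfl
    · exact ⟨i, t, Or.inl rfl, ⟨h0, h⟩, rfl⟩
    · exact ⟨i + 1, 0, Or.inr rfl, by simp, by simp⟩
  rw [Set.disjoint_left]
  intro z hz hz'
  obtain ⟨k, s, hk, hs, e⟩ := red i z hz
  obtain ⟨l, t, hl, ht, e'⟩ := red j z hz'
  have := (P.simple k l s t hs ht (e.symm.trans e')).1
  subst this
  rcases hk with rfl | rfl <;> rcases hl with h | h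
  · exact h1 h
  · exact h2 h
  · exact h3 h
  · exact h1 (add_right_cancel h)

/-- The lowest vertex, and the leftmost one among several: the tie-break excludes the argument `π`.
-/
lemma exists_extreme : ∃ i, ∀ j, j ≠ i →
    P.vertex j - P.vertex i ≠ 0 ∧ (P.vertex j - P.vertex i).arg ∈ Ico 0 Real.pi := by
  have := P.neZero
  obtain ⟨i, hi⟩ := Finite.exists_min fun i => toLex ((P.vertex i).im, (P.vertex i).re)
  refine ⟨i, fun j hj => ?_⟩
  have hne : P.vertex j - P.vertex i ≠ 0 := sub_ne_zero.2 fun h => hj (P.vertex_injective h)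
  refine ⟨hne, ?_⟩
  have := hi j
  rw [Prod.Lex.toLex_le_toLex] at this
  simp only at this
  rcases this with h | ⟨h, h'⟩
  · exact ⟨Complex.arg_nonneg_iff.2 (by simpa using h.le),
      Complex.arg_lt_pi_iff.2 (Or.inr (by simpa [sub_eq_zero] using h.ne'))⟩
  · exact ⟨Complex.arg_nonneg_iff.2 (by simpa using h.le),
      Complex.arg_lt_pi_iff.2 (Or.inl (by simpa using h'))⟩

/-- The exterior angle at `vᵢ₊₁`. -/
def turn (i : ZMod n) : ℝ := (P.dir (i + 1) / P.dir i).arg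

lemma turn_lt_pi (i : ZMod n) : P.turn i < Real.pi := by
  refine lt_of_le_of_ne (Complex.arg_le_pi _) fun h => ?_
  rw [turn, Complex.arg_eq_pi_iff] at h
  obtain ⟨h1, h2⟩ := h
  set w := P.dir (i + 1) / P.dir i with hw
  have hw' : P.dir (i + 1) = (w.re : ℂ) * P.dir i := by
    have : w = (w.re : ℂ) := Complex.ext (by simp) (by simpa using h2)
    rw [← this, hw, div_mul_cancel₀ _ (P.dir_ne_zero i)]
  apply P.zero_notMem_segment_dir i
  have h3 : 0 < 1 - w.re := by linarith
  refine ⟨-w.re / (1 - w.re), 1 / (1 - w.re), div_nonneg (by linarith) h3.le,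
    div_nonneg zero_le_one h3.le, ?_, ?_⟩
  · field_simp; ring
  · rw [hw', Complex.real_smul, Complex.real_smul]
    push_cast
    ring

/-- Both sides agree modulo `2π`. There is no backtracking, so the exterior angle lies strictly
between `-π` and `π` and the right side is in the range of the interior angle. -/
lemma interiorAngle_succ (i : ZMod n) : P.interiorAngle (i + 1) = Real.pi - P.turn i := by
  rw [interiorAngle, toIcoMod_eq_iff]
  have h1 := P.turn_lt_pi i
  have h2 : -Real.pi < P.turn i := Complex.neg_pi_lt_arg _
  refine ⟨⟨by linarith, by linarith⟩, ?_⟩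
  have e : (P.vertex (i + 1 - 1) - P.vertex (i + 1)) / (P.vertex (i + 1 + 1) - P.vertex (i + 1)) =
      -P.dir i / P.dir (i + 1) := by
    rw [add_sub_cancel_right]; congr 1; simp [dir]
  rw [e]
  have : (((-P.dir i / P.dir (i + 1)).arg : ℝ) : Real.Angle) = ((Real.pi - P.turn i : ℝ) : _) := by
    rw [Complex.arg_div_coe_angle (neg_ne_zero.2 (P.dir_ne_zero i)) (P.dir_ne_zero _),
      Complex.arg_neg_coe_angle (P.dir_ne_zero i), Real.Angle.coe_sub, turn,
      Complex.arg_div_coe_angle (P.dir_ne_zero _) (P.dir_ne_zero i)]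
    abel
  rw [Real.Angle.angle_eq_iff_two_pi_dvd_sub] at this
  obtain ⟨k, hk⟩ := this
  exact ⟨k, by rw [zsmul_eq_mul]; linarith⟩

lemma interiorAngle_pos (i : ZMod n) : 0 < P.interiorAngle i := by
  have := P.interiorAngle_succ (i - 1)
  rw [sub_add_cancel] at this
  rw [this]; linarith [P.turn_lt_pi (i - 1)]

lemma interiorAngle_lt (i : ZMod n) : P.interiorAngle i < 2 * Real.pi := by
  have := toIcoMod_lt_right Real.two_pi_pos 0
    (Complex.arg ((P.vertex (i - 1) - P.vertex i) / (P.vertex (i + 1) - P.vertex i)))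
  rwa [zero_add] at this

lemma sum_turn_le [NeZero n] : ∑ i, P.turn i ≤ 2 * Real.pi := by
  obtain ⟨i₀, h₀⟩ := P.exists_extreme
  have hn := P.three_le
  have hc : ((n : ℕ) : ZMod n) = 0 := ZMod.natCast_self n
  have key := sum_turning_le_of_extreme hn (fun k => P.vertex (i₀ + (k : ZMod n)))
    (by simp) (by simp) ?_ ?_ ?_
  · have e : ∑ i, P.turn i = ∑ i, P.turn (i₀ + i) :=
      (Equiv.sum_comp (Equiv.addLeft i₀) P.turn).symm
    rw [e, ← sum_range_zmod]
    refine le_trans (le_of_eq (Finset.sum_congr rfl fun k _ => ?_)) key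
    simp only [turn, dir]
    push_cast
    ring_nf
  · intro i _
    have := P.zero_notMem_segment_dir (i₀ + i)
    simp only [dir] at this
    push_cast
    convert this using 3 <;> ring_nf
  · intro i j h1 h2 h3
    have hi : i < n := by omega
    have := P.disjoint_segment (i := i₀ + i) (j := i₀ + j) ?_ ?_ ?_
    · push_cast
      convert this using 2 <;> ring_nf
    · intro h
      have := natCast_inj_of_lt hi (by omega) (add_left_cancel h)
      omega
    · intro h
      rw [add_assoc] at h
      have h' := add_left_cancel h
      rcases h2.lt_or_eq with h2 | h2
      · have := natCast_inj_of_lt hi h2 (by push_cast; exact h')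
        omega
      · have h4 : ((j + 1 : ℕ) : ZMod n) = 0 := by rw [h2, hc]
        push_cast at h4
        rw [h4] at h'
        have := natCast_inj_of_lt hi (by omega : 0 < n) (by simpa using h')
        omega
    · intro h
      rw [add_assoc] at h
      have h' := add_left_cancel h
      have := natCast_inj_of_lt (n := n) (j := i + 1) (k := j) (by omega) (by omega) (by push_cast; exact h')
      omega
  · intro k h1 h2
    have := h₀ (i₀ + k) fun h => by
      have := natCast_inj_of_lt h2 (by omega : 0 < n) (by simpa using h)
      omega
    simpa using this

/-- The interior angles of a simple polygon add up to at least `(n - 2)π`. -/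
lemma le_sum_interiorAngle [NeZero n] : (n - 2 : ℝ) * Real.pi ≤ ∑ i, P.interiorAngle i := by
  have e : ∑ i, P.interiorAngle i = ∑ i, P.interiorAngle (i + 1) :=
    (Equiv.sum_comp (Equiv.addRight (1 : ZMod n)) P.interiorAngle).symm
  rw [e, Finset.sum_congr rfl fun i _ => P.interiorAngle_succ i, Finset.sum_sub_distrib]
  simp only [Finset.sum_const, Finset.card_univ, ZMod.card, nsmul_eq_mul]
  linarith [P.sum_turn_le]

lemma angleAt_vertex (i : ZMod n) : P.angleAt (P.vertex i) = P.interiorAngle i := by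
  have h : P.IsVertex (P.vertex i) := ⟨i, rfl⟩
  rw [angleAt, dif_pos h, P.vertex_injective h.choose_spec]

lemma angleAt_of_not_isVertex {z : ℂ} (h : ¬ P.IsVertex z) : P.angleAt z = Real.pi := by
  rw [angleAt, dif_neg h]

lemma angleAt_pos (z : ℂ) : 0 < P.angleAt z := by
  by_cases h : P.IsVertex z
  · obtain ⟨i, rfl⟩ := h
    rw [angleAt_vertex]; exact P.interiorAngle_pos i
  · rw [P.angleAt_of_not_isVertex h]; exact Real.pi_pos

lemma angleAt_lt (z : ℂ) : P.angleAt z < 2 * Real.pi := by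
  by_cases h : P.IsVertex z
  · obtain ⟨i, rfl⟩ := h
    rw [angleAt_vertex]; exact P.interiorAngle_lt i
  · rw [P.angleAt_of_not_isVertex h]; linarith [Real.pi_pos]

end SimplePolygon

/-! ### The arc-length parametrization of the boundary -/

namespace SimplePolygon

variable {n : ℕ} (P : SimplePolygon n)

lemma norm_dir_pos (i : ZMod n) : 0 < ‖P.dir i‖ := norm_pos_iff.2 (P.dir_ne_zero i)

lemma cumLength_zero : P.cumLength 0 = 0 := by simp [cumLength]

lemma cumLength_succ (k : ℕ) : P.cumLength (k + 1) = P.cumLength k + ‖P.dir (k : ZMod n)‖ := by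
  rw [cumLength, Finset.sum_range_succ]; rfl

lemma cumLength_strictMono : StrictMono P.cumLength := by
  refine strictMono_nat_of_lt_succ fun k => ?_
  rw [cumLength_succ]; linarith [P.norm_dir_pos (k : ZMod n)]

lemma perimeter_pos : 0 < P.perimeter := by
  rw [← P.cumLength_zero, perimeter]
  exact P.cumLength_strictMono (by have := P.three_le; omega)

lemma vertex_natCast (j : ℕ) :
    P.vertex (j : ZMod n) = P.vertex 0 + ∑ k ∈ Finset.range j, P.dir (k : ZMod n) := by
  induction j with
  | zero => simp
  | succ j ih =>
    rw [Finset.sum_range_succ, ← add_assoc, ← ih, dir]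
    push_cast
    ring

/-- Edges before the `j`-th are traversed fully and later ones not at all, so the clamped sum
telescopes. -/
lemma sum_traversed {j : ℕ} (hj : j < n) {x : ℝ} (hx : x ∈ Icc 0 ‖P.dir (j : ZMod n)‖) :
    P.vertex 0 + ∑ k ∈ Finset.range n,
      ((max 0 (min (P.cumLength j + x - P.cumLength k) ‖P.edgeVec k‖) / ‖P.edgeVec k‖ : ℝ) : ℂ) *
        P.edgeVec k = P.vertex j + ((x / ‖P.dir (j : ZMod n)‖ : ℝ) : ℂ) * P.dir j := by
  rw [vertex_natCast, add_assoc]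
  congr 1
  rw [← Finset.sum_range_add_sum_Ico _ hj.le, Finset.sum_eq_sum_Ico_succ_bot hj]
  have e1 : ∑ k ∈ Finset.range j,
      ((max 0 (min (P.cumLength j + x - P.cumLength k) ‖P.edgeVec k‖) / ‖P.edgeVec k‖ : ℝ) : ℂ) *
        P.edgeVec k = ∑ k ∈ Finset.range j, P.dir k := by
    refine Finset.sum_congr rfl fun k hk => ?_
    have h1 : P.cumLength (k + 1) ≤ P.cumLength j :=
      P.cumLength_strictMono.monotone (Finset.mem_range.1 hk)
    rw [cumLength_succ] at h1
    change ((max 0 (min _ ‖P.dir k‖) / ‖P.dir k‖ : ℝ) : ℂ) * P.dir k = P.dir k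
    have h2 := P.norm_dir_pos (k : ZMod n)
    rw [min_eq_right (by linarith [hx.1]), max_eq_right h2.le, div_self h2.ne']
    simp
  have e2 : ∑ k ∈ Finset.Ico (j + 1) n,
      ((max 0 (min (P.cumLength j + x - P.cumLength k) ‖P.edgeVec k‖) / ‖P.edgeVec k‖ : ℝ) : ℂ) *
        P.edgeVec k = 0 := by
    refine Finset.sum_eq_zero fun k hk => ?_
    have h1 : P.cumLength (j + 1) ≤ P.cumLength k :=
      P.cumLength_strictMono.monotone (Finset.mem_Ico.1 hk).1
    rw [cumLength_succ] at h1
    rw [max_eq_left ((min_le_left _ _).trans (by linarith [hx.2]))]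
    simp
  rw [e1, e2, add_zero]
  congr 1
  change ((max 0 (min _ ‖P.dir j‖) / ‖P.dir j‖ : ℝ) : ℂ) * P.dir j = _
  rw [add_sub_cancel_left, min_eq_left hx.2, max_eq_right hx.1]

lemma bdry_add_perimeter (s : ℝ) : P.bdry (s + P.perimeter) = P.bdry s := by
  unfold bdry
  rw [add_div, div_self P.perimeter_pos.ne', Int.fract_add_one]

lemma bdry_add_int_mul (s : ℝ) (k : ℤ) : P.bdry (s + k * P.perimeter) = P.bdry s := by
  unfold bdry
  rw [add_div, mul_div_cancel_right₀ _ P.perimeter_pos.ne', Int.fract_add_intCast]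

/-- The boundary parametrization on the `j`-th edge. -/
lemma bdry_cumLength_add {j : ℕ} (hj : j < n) {x : ℝ} (hx : x ∈ Icc 0 ‖P.dir (j : ZMod n)‖) :
    P.bdry (P.cumLength j + x) =
      P.vertex j + ((x / ‖P.dir (j : ZMod n)‖ : ℝ) : ℂ) * P.dir j := by
  have hL := P.perimeter_pos
  have h0 : 0 ≤ P.cumLength j := by
    rw [← P.cumLength_zero]; exact P.cumLength_strictMono.monotone (Nat.zero_le j)
  have h1 : P.cumLength (j + 1) ≤ P.perimeter := P.cumLength_strictMono.monotone hj
  have h2 := h1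
  rw [cumLength_succ] at h2
  rcases (show P.cumLength j + x ≤ P.perimeter by linarith [hx.2]).lt_or_eq with h | h
  · rw [← P.sum_traversed hj hx]
    unfold bdry
    have : P.perimeter * Int.fract ((P.cumLength j + x) / P.perimeter) = P.cumLength j + x := by
      rw [Int.fract_eq_self.2 ⟨div_nonneg (by linarith [hx.1]) hL.le, (div_lt_one hL).2 h⟩,
        mul_div_cancel₀ _ hL.ne']
    rw [this]
  -- At the end of the last edge the fractional part jumps back to `0`; the value there is the start
  -- vertex again.
  · have hxe : x = ‖P.dir (j : ZMod n)‖ := le_antisymm hx.2 (by linarith)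
    have hj1 : j + 1 = n := by
      refine P.cumLength_strictMono.injective ?_
      rw [cumLength_succ, ← hxe]; exact h
    have e0 : P.bdry 0 = P.vertex 0 := by
      have h3 := P.sum_traversed (j := 0) (x := 0) (by omega)
        ⟨le_rfl, (P.norm_dir_pos _).le⟩
      unfold bdry
      rw [cumLength_zero] at h3
      simpa using h3
    rw [h, ← zero_add P.perimeter, bdry_add_perimeter, e0, hxe,
      div_self (P.norm_dir_pos _).ne']
    have e1 : ((j : ℕ) : ZMod n) + 1 = 0 := by
      have : ((j + 1 : ℕ) : ZMod n) = 0 := by rw [hj1]; exact ZMod.natCast_self n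
      simpa using this
    simp [dir, e1]

lemma bdry_cumLength (j : ℕ) (hj : j ≤ n) : P.bdry (P.cumLength j) = P.vertex j := by
  rcases hj.lt_or_eq with h | rfl
  · simpa using P.bdry_cumLength_add h (x := 0) ⟨le_rfl, (P.norm_dir_pos _).le⟩
  · have h0 : 0 < j := by have := P.three_le; omega
    have := P.bdry_cumLength_add h0 (x := 0) ⟨le_rfl, (P.norm_dir_pos _).le⟩
    rw [cumLength_zero] at this
    rw [← perimeter, ← zero_add P.perimeter, bdry_add_perimeter, ZMod.natCast_self]
    simpa using this

lemma exists_edge_param (u : ℝ) : ∃ k : ℤ, ∃ j < n, ∃ x ∈ Ico 0 ‖P.dir (j : ZMod n)‖,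
    u = P.cumLength j + x + k * P.perimeter := by
  have hL := P.perimeter_pos
  set s := u - ⌊u / P.perimeter⌋ * P.perimeter with hs
  have hs0 : 0 ≤ s := by
    have := Int.floor_le (u / P.perimeter)
    rw [le_div_iff₀ hL] at this
    linarith
  have hs1 : s < P.cumLength n := by
    have := Int.lt_floor_add_one (u / P.perimeter)
    rw [div_lt_iff₀ hL] at this
    change s < P.perimeter
    linarith
  have hex : ∃ m, s < P.cumLength m := ⟨n, hs1⟩
  classical
  obtain ⟨j, hj⟩ : ∃ j, Nat.find hex = j + 1 := by
    refine Nat.exists_eq_succ_of_ne_zero fun h => ?_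
    have := Nat.find_spec hex
    rw [h, cumLength_zero] at this
    linarith
  have h1 := Nat.find_spec hex
  rw [hj, cumLength_succ] at h1
  have h2 := Nat.find_min hex (m := j) (by omega)
  have h3 : Nat.find hex ≤ n := Nat.find_min' hex hs1
  refine ⟨⌊u / P.perimeter⌋, j, by omega, s - P.cumLength j, ⟨by linarith, by linarith⟩, ?_⟩
  rw [hs]; ring

lemma bdry_eq_lineMap {j : ℕ} (hj : j < n) {x : ℝ} (hx : x ∈ Icc 0 ‖P.dir (j : ZMod n)‖) (k : ℤ) :
    P.bdry (P.cumLength j + x + k * P.perimeter) =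
      AffineMap.lineMap (P.vertex (j : ZMod n)) (P.vertex (j + 1))
        (x / ‖P.dir (j : ZMod n)‖) := by
  rw [bdry_add_int_mul, P.bdry_cumLength_add hj hx, AffineMap.lineMap_apply]
  simp [dir]; ring

/-- Simplicity of the polygon becomes injectivity of the parametrization modulo the perimeter. -/
lemma bdry_eq_bdry_iff {s t : ℝ} :
    P.bdry s = P.bdry t ↔ ∃ k : ℤ, s = t + k * P.perimeter := by
  constructor
  · intro h
    obtain ⟨k, j, hj, x, hx, rfl⟩ := P.exists_edge_param s
    obtain ⟨k', j', hj', x', hx', rfl⟩ := P.exists_edge_param t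
    rw [P.bdry_eq_lineMap hj ⟨hx.1, hx.2.le⟩, P.bdry_eq_lineMap hj' ⟨hx'.1, hx'.2.le⟩] at h
    have hp := P.norm_dir_pos (j : ZMod n)
    have hp' := P.norm_dir_pos (j' : ZMod n)
    obtain ⟨h1, h2⟩ := P.simple _ _ _ _ ⟨div_nonneg hx.1 hp.le, (div_lt_one hp).2 hx.2⟩
      ⟨div_nonneg hx'.1 hp'.le, (div_lt_one hp').2 hx'.2⟩ h
    have := natCast_inj_of_lt hj hj' h1
    subst this
    rw [div_left_inj' hp.ne'] at h2
    subst h2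
    exact ⟨k - k', by push_cast; ring⟩
  · rintro ⟨k, rfl⟩
    exact P.bdry_add_int_mul t k

lemma range_bdry : range P.bdry = P.boundary := by
  have := P.neZero
  ext z
  constructor
  · rintro ⟨u, rfl⟩
    obtain ⟨k, j, hj, x, hx, rfl⟩ := P.exists_edge_param u
    rw [P.bdry_eq_lineMap hj ⟨hx.1, hx.2.le⟩]
    refine mem_iUnion.2 ⟨j, ?_⟩
    rw [segment_eq_image_lineMap]
    exact ⟨_, ⟨div_nonneg hx.1 (norm_nonneg _),
      (div_le_one (P.norm_dir_pos (j : ZMod n))).2 hx.2.le⟩, rfl⟩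
  · intro hz
    obtain ⟨i, hi⟩ := mem_iUnion.1 hz
    rw [segment_eq_image_lineMap] at hi
    obtain ⟨t, ht, rfl⟩ := hi
    have hp := P.norm_dir_pos i
    refine ⟨P.cumLength i.val + t * ‖P.dir i‖ + (0 : ℤ) * P.perimeter, ?_⟩
    rw [P.bdry_eq_lineMap (ZMod.val_lt i)]
    · rw [ZMod.natCast_zmod_val, mul_div_cancel_right₀ _ hp.ne']
    · rw [ZMod.natCast_zmod_val]
      exact ⟨mul_nonneg ht.1 hp.le, by nlinarith [ht.2]⟩

lemma bdry_mem_boundary (u : ℝ) : P.bdry u ∈ P.boundary := P.range_bdry ▸ mem_range_self u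

lemma exists_bdry_eq {z : ℂ} (hz : z ∈ P.boundary) : ∃ u, P.bdry u = z := by
  rwa [← P.range_bdry] at hz

lemma isVertex_bdry_iff {j : ℕ} (hj : j < n) {x : ℝ} (hx : x ∈ Ico 0 ‖P.dir (j : ZMod n)‖)
    (k : ℤ) : P.IsVertex (P.bdry (P.cumLength j + x + k * P.perimeter)) ↔ x = 0 := by
  have hp := P.norm_dir_pos (j : ZMod n)
  rw [P.bdry_eq_lineMap hj ⟨hx.1, hx.2.le⟩]
  constructor
  · rintro ⟨i, hi⟩
    have := (P.simple i j 0 (x / ‖P.dir (j : ZMod n)‖) (by simp)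
      ⟨div_nonneg hx.1 hp.le, (div_lt_one hp).2 hx.2⟩ (by simpa using hi)).2
    exact (div_eq_zero_iff.1 this.symm).resolve_right hp.ne'
  · rintro rfl
    exact ⟨j, by simp⟩

lemma vertex_mem_boundary (i : ZMod n) : P.vertex i ∈ P.boundary :=
  mem_iUnion.2 ⟨i, left_mem_segment ℝ _ _⟩

lemma not_isVertex_of_mem_edge {z : ℂ} {i : ZMod n} (hz : z ∈ P.edge i) : ¬ P.IsVertex z := by
  rintro ⟨j, rfl⟩
  rw [edge, openSegment_eq_image_lineMap] at hz
  obtain ⟨t, ht, h⟩ := hz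
  have := (P.simple i j t 0 ⟨ht.1.le, ht.2⟩ (by simp) (by simpa using h)).2
  exact ht.1.ne' this

lemma finite_setOf_isVertex : {z | P.IsVertex z}.Finite := by
  have := P.neZero
  exact Set.finite_range P.vertex

/-! ### Tangent directions of the boundary -/

/-- The boundary leaves `bdry s` counterclockwise in the direction `τ`. -/
def HasOutDir (s : ℝ) (τ : ℂ) : Prop :=
  ∃ ε > 0, ∀ x ∈ Icc (0 : ℝ) ε, P.bdry (s + x) = P.bdry s + x * τ

/-- The boundary arrives at `bdry s` counterclockwise in the direction `τ`. -/
def HasInDir (s : ℝ) (τ : ℂ) : Prop :=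
  ∃ ε > 0, ∀ x ∈ Icc (0 : ℝ) ε, P.bdry (s - x) = P.bdry s - x * τ

variable {P} in
lemma HasOutDir.unique {s : ℝ} {τ τ' : ℂ} (h : P.HasOutDir s τ) (h' : P.HasOutDir s τ') :
    τ = τ' := by
  obtain ⟨ε, h0, h⟩ := h
  obtain ⟨ε', h0', h'⟩ := h'
  have hm : 0 < min ε ε' := lt_min h0 h0'
  have e := (h (min ε ε') ⟨hm.le, min_le_left _ _⟩).symm.trans
    (h' (min ε ε') ⟨hm.le, min_le_right _ _⟩)
  exact mul_left_cancel₀ (Complex.ofReal_ne_zero.2 hm.ne') (add_left_cancel e)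

variable {P} in
lemma HasInDir.unique {s : ℝ} {τ τ' : ℂ} (h : P.HasInDir s τ) (h' : P.HasInDir s τ') :
    τ = τ' := by
  obtain ⟨ε, h0, h⟩ := h
  obtain ⟨ε', h0', h'⟩ := h'
  have hm : 0 < min ε ε' := lt_min h0 h0'
  have e := (h (min ε ε') ⟨hm.le, min_le_left _ _⟩).symm.trans
    (h' (min ε ε') ⟨hm.le, min_le_right _ _⟩)
  exact mul_left_cancel₀ (Complex.ofReal_ne_zero.2 hm.ne') (sub_right_inj.1 e)

lemma hasOutDir_edge {j : ℕ} (hj : j < n) {x : ℝ} (hx : x ∈ Ico 0 ‖P.dir (j : ZMod n)‖) (k : ℤ) :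
    P.HasOutDir (P.cumLength j + x + k * P.perimeter) (P.dir j / ‖P.dir (j : ZMod n)‖) := by
  refine ⟨‖P.dir (j : ZMod n)‖ - x, by linarith [hx.2], fun y hy => ?_⟩
  have e : P.cumLength j + x + k * P.perimeter + y = P.cumLength j + (x + y) + k * P.perimeter := by
    ring
  rw [e, bdry_add_int_mul, bdry_add_int_mul, P.bdry_cumLength_add hj ⟨hx.1, hx.2.le⟩,
    P.bdry_cumLength_add hj ⟨by linarith [hx.1, hy.1], by linarith [hy.2]⟩]
  push_cast
  ring

lemma hasInDir_edge {j : ℕ} (hj : j < n) {x : ℝ} (hx : x ∈ Ioc 0 ‖P.dir (j : ZMod n)‖) (k : ℤ) :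
    P.HasInDir (P.cumLength j + x + k * P.perimeter) (P.dir j / ‖P.dir (j : ZMod n)‖) := by
  refine ⟨x, hx.1, fun y hy => ?_⟩
  have e : P.cumLength j + x + k * P.perimeter - y = P.cumLength j + (x - y) + k * P.perimeter := by
    ring
  rw [e, bdry_add_int_mul, bdry_add_int_mul, P.bdry_cumLength_add hj ⟨hx.1.le, hx.2⟩,
    P.bdry_cumLength_add hj ⟨by linarith [hy.2], by linarith [hy.1, hx.2]⟩]
  push_cast
  ring

lemma exp_turn (i : ZMod n) :
    P.dir (i + 1) / ‖P.dir (i + 1)‖ =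
      P.dir i / ‖P.dir i‖ * Complex.exp ((Real.pi - P.interiorAngle (i + 1) : ℝ) * Complex.I) := by
  have e : Real.pi - P.interiorAngle (i + 1) = P.turn i := by rw [P.interiorAngle_succ]; ring
  rw [e, turn]
  have h := Complex.norm_mul_exp_arg_mul_I (P.dir (i + 1) / P.dir i)
  have h1 : (‖P.dir i‖ : ℂ) ≠ 0 := Complex.ofReal_ne_zero.2 (P.norm_dir_pos i).ne'
  have h2 : (‖P.dir (i + 1)‖ : ℂ) ≠ 0 := Complex.ofReal_ne_zero.2 (P.norm_dir_pos (i + 1)).ne'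
  have h3 := P.dir_ne_zero i
  rw [norm_div] at h
  push_cast at h
  rw [eq_div_iff h3] at h
  rw [div_eq_iff h2]
  conv_lhs => rw [← h]
  field_simp

/-- The boundary has one-sided directions at every point, and they differ by a rotation by the
exterior angle. -/
lemma exists_inDir_outDir (s : ℝ) : ∃ σ τ : ℂ, P.HasInDir s σ ∧ P.HasOutDir s τ ∧
    τ = σ * Complex.exp ((Real.pi - P.angleAt (P.bdry s) : ℝ) * Complex.I) := by
  obtain ⟨k, j, hj, x, hx, rfl⟩ := P.exists_edge_param s
  rcases hx.1.lt_or_eq with h0 | h0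
  · refine ⟨_, _, P.hasInDir_edge hj ⟨h0, hx.2.le⟩ k, P.hasOutDir_edge hj hx k, ?_⟩
    rw [P.angleAt_of_not_isVertex fun h => h0.ne' ((P.isVertex_bdry_iff hj hx k).1 h)]
    simp
  · subst h0
    have hb : P.bdry (P.cumLength j + 0 + k * P.perimeter) = P.vertex j := by
      rw [bdry_add_int_mul, add_zero, P.bdry_cumLength j hj.le]
    -- The edge that ends at this vertex. Before edge `0` comes edge `n - 1`, one period earlier.
    obtain ⟨i, hi, k', h, hz⟩ : ∃ i, i < n ∧ ∃ k' : ℤ, P.cumLength j + 0 + k * P.perimeter =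
        P.cumLength i + ‖P.dir (i : ZMod n)‖ + k' * P.perimeter ∧
        ((i : ℕ) : ZMod n) + 1 = (j : ZMod n) := by
      rcases Nat.eq_zero_or_pos j with rfl | h0
      · refine ⟨n - 1, by omega, k - 1, ?_, ?_⟩
        · rw [← P.cumLength_succ, show n - 1 + 1 = n by omega, P.cumLength_zero]
          change _ = P.perimeter + _
          push_cast; ring
        · rw [← Nat.cast_succ, Nat.succ_eq_add_one, show n - 1 + 1 = n by omega]; simp
      · refine ⟨j - 1, by omega, k, ?_, ?_⟩
        · rw [← P.cumLength_succ, show j - 1 + 1 = j by omega, add_zero]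
        · rw [← Nat.cast_succ, Nat.succ_eq_add_one, show j - 1 + 1 = j by omega]
    refine ⟨P.dir i / ‖P.dir (i : ZMod n)‖, P.dir j / ‖P.dir (j : ZMod n)‖, ?_,
      P.hasOutDir_edge hj hx k, ?_⟩
    · rw [h]; exact P.hasInDir_edge hi ⟨P.norm_dir_pos _, le_rfl⟩ k'
    · rw [hb, P.angleAt_vertex, ← hz, P.exp_turn]

lemma exists_outDir (s : ℝ) : ∃ τ, P.HasOutDir s τ :=
  let ⟨_, τ, _, h, _⟩ := P.exists_inDir_outDir s
  ⟨τ, h⟩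

variable {P} in
lemma HasInDir.outDir_eq {s : ℝ} {σ τ : ℂ} (h : P.HasInDir s σ) (h' : P.HasOutDir s τ) :
    τ = σ * Complex.exp ((Real.pi - P.angleAt (P.bdry s) : ℝ) * Complex.I) := by
  obtain ⟨σ', τ', h1, h2, h3⟩ := P.exists_inDir_outDir s
  rwa [h.unique h1, h'.unique h2]

lemma continuous_bdry : Continuous P.bdry := by
  rw [continuous_iff_continuousAt]
  intro s
  obtain ⟨σ, τ, ⟨ε, h0, h⟩, ⟨δ, h0', h'⟩, -⟩ := P.exists_inDir_outDir s
  refine continuousAt_iff_continuous_left_right.2 ⟨?_, ?_⟩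
  · have : ContinuousWithinAt (fun u : ℝ => P.bdry s - ((s - u : ℝ) : ℂ) * σ) (Iic s) s := by
      apply Continuous.continuousWithinAt; fun_prop
    refine this.congr_of_eventuallyEq ?_ (by simp)
    filter_upwards [Icc_mem_nhdsLE (show s - ε < s by linarith)] with u hu
    have := h (s - u) ⟨by linarith [hu.2], by linarith [hu.1]⟩
    rwa [sub_sub_cancel] at this
  · have : ContinuousWithinAt (fun u : ℝ => P.bdry s + ((u - s : ℝ) : ℂ) * τ) (Ici s) s := by
      apply Continuous.continuousWithinAt; fun_prop
    refine this.congr_of_eventuallyEq ?_ (by simp)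
    filter_upwards [Icc_mem_nhdsGE (show s < s + δ by linarith)] with u hu
    have := h' (u - s) ⟨by linarith [hu.1], by linarith [hu.2]⟩
    rwa [add_sub_cancel] at this

/-- A part of the boundary without proper corners is straight. -/
lemma bdry_add_eq_of_angle_eq_pi {s t : ℝ}
    (hπ : ∀ u ∈ Ioo s t, P.angleAt (P.bdry u) = Real.pi) {τ : ℂ} (hτ : P.HasOutDir s τ) :
    ∀ x ∈ Icc 0 (t - s), P.bdry (s + x) = P.bdry s + x * τ := by
  -- Continuous induction: the lengths up to which the boundary is straight form a closed set, and
  -- at an angle `π` the outgoing direction equals the incoming one, so the straight part can be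
  -- prolonged.
  set S : Set ℝ := {x | ∀ y ∈ Icc 0 x, P.bdry (s + y) = P.bdry s + y * τ} with hS
  have hc1 : Continuous fun y : ℝ => P.bdry (s + y) := P.continuous_bdry.comp (by fun_prop)
  have hc2 : Continuous fun y : ℝ => P.bdry s + y * τ := by fun_prop
  have hcl : IsClosed (S ∩ Icc 0 (t - s)) := by
    have : S ∩ Icc 0 (t - s) = {x | x ∈ Icc 0 (t - s) ∧
        ∀ y ∈ Icc 0 (t - s), P.bdry (s + min x y) = P.bdry s + (min x y : ℝ) * τ} := by
      ext x
      constructor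
      · rintro ⟨h1, h2⟩
        exact ⟨h2, fun y hy => h1 _ ⟨le_min h2.1 hy.1, min_le_left _ _⟩⟩
      · rintro ⟨h1, h2⟩
        refine ⟨fun y hy => ?_, h1⟩
        have := h2 y ⟨hy.1, hy.2.trans h1.2⟩
        rwa [min_eq_right hy.2] at this
    rw [this, ofPred_and]
    refine isClosed_Icc.inter ?_
    simp only [ofPred_forall]
    refine isClosed_biInter fun y _ => ?_
    exact isClosed_eq (hc1.comp (continuous_id.min continuous_const))
      (hc2.comp (continuous_id.min continuous_const))
  have hsub := hcl.Icc_subset_of_forall_exists_gt (show (0 : ℝ) ∈ S by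
      intro y hy
      have : y = 0 := le_antisymm hy.2 hy.1
      simp [this]) (by
    rintro x ⟨hx, hx1⟩ y hy
    have hout : P.HasOutDir (s + x) τ := by
      rcases hx1.1.lt_or_eq with h0 | h0
      · have hin : P.HasInDir (s + x) τ := by
          refine ⟨x, h0, fun z hz => ?_⟩
          have e1 := hx (x - z) ⟨by linarith [hz.2], by linarith [hz.1]⟩
          have e2 := hx x ⟨h0.le, le_rfl⟩
          rw [e2, show s + x - z = s + (x - z) by ring, e1]
          push_cast; ring
        obtain ⟨τ', h'⟩ := P.exists_outDir (s + x)
        have e := hin.outDir_eq h'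
        rw [hπ _ ⟨by linarith, by linarith [hx1.2]⟩] at e
        have : τ' = τ := by simpa using e
        rwa [← this]
      · rw [← h0, add_zero]; exact hτ
    obtain ⟨ε, hε, h⟩ := hout
    have hy' : x < y := hy
    refine ⟨min y (x + ε), fun z hz => ?_, lt_min hy' (by linarith), min_le_left _ _⟩
    rcases le_total z x with hzx | hzx
    · exact hx z ⟨hz.1, hzx⟩
    · have e1 := h (z - x) ⟨by linarith, by linarith [hz.2.trans (min_le_right _ _)]⟩
      have e2 := hx x ⟨hx1.1, le_rfl⟩
      rw [show s + x + (z - x) = s + z by ring, e2] at e1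
      rw [e1]; push_cast; ring)
  intro x hx
  exact hsub hx x ⟨hx.1, le_rfl⟩

end SimplePolygon

/-! ### Periods of the parametrization and affine changes of parameter -/

namespace SimplePolygon

variable {n : ℕ} (P : SimplePolygon n)

variable {P} in
lemma bdry_add_congr {u v : ℝ} (h : P.bdry u = P.bdry v) (x : ℝ) :
    P.bdry (u + x) = P.bdry (v + x) := by
  obtain ⟨k, rfl⟩ := P.bdry_eq_bdry_iff.1 h
  rw [P.bdry_eq_bdry_iff]
  exact ⟨k, by ring⟩

lemma bdry_ne_of_lt {u v : ℝ} (h1 : u < v) (h2 : v < u + P.perimeter) : P.bdry u ≠ P.bdry v := by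
  intro h
  obtain ⟨k, hk⟩ := P.bdry_eq_bdry_iff.1 h
  have hL := P.perimeter_pos
  have h3 : (k : ℝ) < 0 := by nlinarith
  have h4 : (-1 : ℝ) < k := by nlinarith
  have h5 : k < 0 := by exact_mod_cast h3
  have h6 : -1 < k := by exact_mod_cast h4
  omega

/-- Affine maps of slopes `±1` that agree up to periods on an interval agree up to periods. -/
lemma bdry_affine_eq {w w' σ σ' a b : ℝ} (hab : a < b) (hσ : σ = 1 ∨ σ = -1)
    (hσ' : σ' = 1 ∨ σ' = -1) (h : ∀ y ∈ Ioo a b, P.bdry (w + σ * y) = P.bdry (w' + σ' * y)) :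
    σ = σ' ∧ ∀ y, P.bdry (w + σ * y) = P.bdry (w' + σ' * y) := by
  have hL := P.perimeter_pos
  have key : σ = σ' := by
    by_contra hne
    -- Different slopes differ by `2`, so moving by `d` changes the difference of the maps by `2d`.
    -- That would be a multiple of the perimeter, but it is positive and less than half of it.
    obtain ⟨d, hd, hd'⟩ : ∃ d, 0 < d ∧ d < min ((b - a) / 2) (P.perimeter / 4) :=
      exists_between (lt_min (by linarith) (by linarith))
    have h2 := hd'.trans_le (min_le_right _ _)
    obtain ⟨k, hk⟩ := P.bdry_eq_bdry_iff.1 (h ((a + b) / 2) ⟨by linarith, by linarith⟩)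
    have h1' := hd'.trans_le (min_le_left _ _)
    obtain ⟨l, hl⟩ := P.bdry_eq_bdry_iff.1 (h ((a + b) / 2 + d) ⟨by linarith, by linarith⟩)
    have e : (σ - σ') * d = (l - k : ℤ) * P.perimeter := by push_cast; linarith
    have hs : |σ - σ'| = 2 := by
      rcases hσ with rfl | rfl <;> rcases hσ' with rfl | rfl <;> first | exact absurd rfl hne | norm_num
    have e2 := congrArg abs e
    rw [abs_mul, abs_mul, hs, abs_of_pos hd, abs_of_pos hL] at e2
    rcases eq_or_ne (l - k) 0 with h0 | h0
    · rw [h0] at e2; simp at e2; linarith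
    · have : (1 : ℝ) ≤ |((l - k : ℤ) : ℝ)| := by exact_mod_cast Int.one_le_abs h0
      nlinarith
  subst key
  refine ⟨rfl, fun y => ?_⟩
  have h0 := h ((a + b) / 2) ⟨by linarith, by linarith⟩
  have := bdry_add_congr h0 (σ * (y - (a + b) / 2))
  convert this using 2 <;> ring

lemma finite_bdry_preimage {S : Set ℂ} (hS : S.Finite) (a b : ℝ) :
    {u | u ∈ Icc a b ∧ P.bdry u ∈ S}.Finite := by
  have hL := P.perimeter_pos
  have : {u | u ∈ Icc a b ∧ P.bdry u ∈ S} ⊆ ⋃ z ∈ S, {u | u ∈ Icc a b ∧ P.bdry u = z} := by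
    intro u hu
    exact mem_biUnion hu.2 ⟨hu.1, rfl⟩
  refine (hS.biUnion fun z _ => ?_).subset this
  rcases eq_empty_or_nonempty {u | u ∈ Icc a b ∧ P.bdry u = z} with h | ⟨v, -, rfl⟩
  · rw [h]; exact finite_empty
  · refine ((finite_Icc ⌊(a - v) / P.perimeter⌋ ⌈(b - v) / P.perimeter⌉).image
      fun k : ℤ => v + k * P.perimeter).subset ?_
    rintro u ⟨hu, h⟩
    obtain ⟨k, rfl⟩ := P.bdry_eq_bdry_iff.1 h
    refine ⟨k, ⟨?_, ?_⟩, rfl⟩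
    · refine Int.cast_le.1 ((Int.floor_le _).trans ?_)
      rw [div_le_iff₀ hL]; linarith [hu.1]
    · refine Int.cast_le.1 (le_trans ?_ (Int.le_ceil _))
      rw [le_div_iff₀ hL]; linarith [hu.2]

end SimplePolygon

namespace Gluing

variable {n : ℕ} {P : SimplePolygon n} (G : Gluing P)

/-! ### The intervals of a gluing -/

lemma cut_lt (i : Fin G.m) : G.cut i.castSucc < G.cut i.succ :=
  G.cut_strictMono Fin.castSucc_lt_succ

lemma cut_zero_le (i : Fin (G.m + 1)) : G.cut 0 ≤ G.cut i :=
  G.cut_strictMono.monotone (Fin.zero_le i)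

lemma cut_le (i : Fin (G.m + 1)) : G.cut i ≤ G.cut 0 + P.perimeter := by
  rw [← G.cut_last]; exact G.cut_strictMono.monotone (Fin.le_last i)

/-- The parameter to which the point at distance `x` from the start of the `i`-th interval is
glued. -/
def partner (i : Fin G.m) (x : ℝ) : ℝ :=
  if G.rev i then G.cut (G.mate i).succ - x else G.cut (G.mate i).castSucc + x

lemma pair_iff {z w : ℂ} : G.Pair z w ↔ ∃ i : Fin G.m, ∃ t ∈ Icc (0 : ℝ)
    (G.cut i.succ - G.cut i.castSucc), z = P.bdry (G.cut i.castSucc + t) ∧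
      w = P.bdry (G.partner i t) := Iff.rfl

/-- The position of the partner in its interval. -/
lemma partner_eq (i : Fin G.m) (x : ℝ) : G.partner i x = G.cut (G.mate i).castSucc +
    (if G.rev i then (G.cut i.succ - G.cut i.castSucc) - x else x) := by
  unfold partner
  split_ifs
  · rw [← G.length_mate i]; ring
  · rfl

lemma pair_symm {z w : ℂ} (h : G.Pair z w) : G.Pair w z := by
  obtain ⟨i, t, ht, rfl, rfl⟩ := G.pair_iff.1 h
  refine G.pair_iff.2 ⟨G.mate i, if G.rev i then (G.cut i.succ - G.cut i.castSucc) - t else t,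
    ?_, by rw [partner_eq], ?_⟩
  · rw [G.length_mate]
    split_ifs
    · exact ⟨by linarith [ht.2], by linarith [ht.1]⟩
    · exact ht
  · rw [partner_eq, G.mate_mate, G.rev_mate, G.length_mate]
    split_ifs <;> simp

lemma glued_of_pair {z w : ℂ} (h : G.Pair z w) : G.Glued z w := Relation.EqvGen.rel _ _ h

lemma glued_refl (z : ℂ) : G.Glued z z := G.setoid.refl z

variable {G} in
lemma Glued.symm {z w : ℂ} (h : G.Glued z w) : G.Glued w z := G.setoid.symm h

variable {G} in
lemma Glued.trans {x y z : ℂ} (h : G.Glued x y) (h' : G.Glued y z) : G.Glued x z :=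
  G.setoid.trans h h'

lemma mem_cls_self (z : ℂ) : z ∈ G.cls z := G.glued_refl z

variable {G} in
lemma Glued.cls_eq {z w : ℂ} (h : G.Glued z w) : G.cls z = G.cls w := by
  ext x
  exact ⟨fun hx => h.symm.trans hx, fun hx => h.trans hx⟩

/-- Pairing is symmetric, so a set closed under it in one direction is a union of classes. -/
lemma cls_subset {S : Set ℂ} (hS : ∀ z ∈ S, ∀ w, G.Pair z w → w ∈ S) {z : ℂ} (hz : z ∈ S) :
    G.cls z ⊆ S := by
  have key : ∀ x y, Relation.EqvGen G.Pair x y → (x ∈ S ↔ y ∈ S) := by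
    intro x y h
    induction h with
    | rel x y h => exact ⟨fun hx => hS x hx y h, fun hy => hS y hy x (G.pair_symm h)⟩
    | refl x => rfl
    | symm x y _ ih => exact ih.symm
    | trans x y z _ _ ih1 ih2 => exact ih1.trans ih2
  intro w hw
  exact (key z w hw).1 hz

variable {G} in
lemma Glued.mem_boundary {z w : ℂ} (h : G.Glued z w) (hz : z ∈ P.boundary) : w ∈ P.boundary := by
  refine G.cls_subset (S := P.boundary) ?_ hz h
  intro x _ y hxy
  obtain ⟨i, t, _, _, rfl⟩ := G.pair_iff.1 hxy
  exact P.bdry_mem_boundary _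

lemma eq_of_bdry_eq {i j : Fin G.m} {x y : ℝ} (hx : x ∈ Ioo 0 (G.cut i.succ - G.cut i.castSucc))
    (hy : y ∈ Icc 0 (G.cut j.succ - G.cut j.castSucc))
    (h : P.bdry (G.cut i.castSucc + x) = P.bdry (G.cut j.castSucc + y)) : i = j ∧ x = y := by
  have hL := P.perimeter_pos
  obtain ⟨k, hk⟩ := P.bdry_eq_bdry_iff.1 h
  have h1 := G.cut_zero_le i.castSucc
  have h2 := G.cut_le i.succ
  have h3 := G.cut_zero_le j.castSucc
  have h4 := G.cut_le j.succ
  obtain ⟨hx1, hx2⟩ := hx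
  obtain ⟨hy1, hy2⟩ := hy
  have hk1 : (k : ℝ) < 1 := by nlinarith
  have hk2 : (-1 : ℝ) < k := by nlinarith
  have hk3 : k < 1 := by exact_mod_cast hk1
  have hk4 : -1 < k := by exact_mod_cast hk2
  obtain rfl : k = 0 := by omega
  rw [Int.cast_zero, zero_mul, add_zero] at hk
  have hij : i = j := by
    rcases lt_trichotomy i j with hij | hij | hij
    · have := G.cut_strictMono.monotone (Fin.succ_le_castSucc_iff.2 hij)
      linarith
    · exact hij
    · have := G.cut_strictMono.monotone (Fin.succ_le_castSucc_iff.2 hij)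
      linarith
  subst hij
  exact ⟨rfl, by linarith⟩

lemma eq_of_bdry_cut_eq {i j : Fin G.m}
    (h : P.bdry (G.cut i.castSucc) = P.bdry (G.cut j.castSucc)) : i = j := by
  by_contra hne
  have : ∀ i j : Fin G.m, i < j → P.bdry (G.cut i.castSucc) ≠ P.bdry (G.cut j.castSucc) := by
    intro i j hij
    refine P.bdry_ne_of_lt (G.cut_strictMono (by simpa using hij)) ?_
    have := G.cut_le j.succ
    have := G.cut_zero_le i.castSucc
    have := G.cut_lt j
    linarith
  rcases lt_or_gt_of_ne hne with hij | hij
  · exact this i j hij h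
  · exact this j i hij h.symm

lemma eq_of_bdry_cut_succ_eq {i j : Fin G.m}
    (h : P.bdry (G.cut i.succ) = P.bdry (G.cut j.succ)) : i = j := by
  by_contra hne
  have : ∀ i j : Fin G.m, i < j → P.bdry (G.cut i.succ) ≠ P.bdry (G.cut j.succ) := by
    intro i j hij
    refine P.bdry_ne_of_lt (G.cut_strictMono (by simpa using hij)) ?_
    have := G.cut_le j.succ
    have := G.cut_zero_le i.castSucc
    have := G.cut_lt i
    linarith
  rcases lt_or_gt_of_ne hne with hij | hij
  · exact this i j hij h
  · exact this j i hij h.symm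

lemma exists_interval (u : ℝ) : ∃ i : Fin G.m, ∃ x ∈ Ico 0 (G.cut i.succ - G.cut i.castSucc),
    P.bdry u = P.bdry (G.cut i.castSucc + x) := by
  have hL := P.perimeter_pos
  set s := toIcoMod hL (G.cut 0) u with hs
  have hsm : s ∈ Ico (G.cut 0) (G.cut 0 + P.perimeter) := toIcoMod_mem_Ico hL (G.cut 0) u
  have hb : P.bdry u = P.bdry s := by
    rw [P.bdry_eq_bdry_iff]
    exact ⟨toIcoDiv hL (G.cut 0) u, by
      have := toIcoMod_add_toIcoDiv_zsmul hL (G.cut 0) u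
      rw [zsmul_eq_mul] at this; exact this.symm⟩
  rw [hb]
  have key : ∀ k : Fin (G.m + 1), s < G.cut k → ∃ i : Fin G.m, ∃ x ∈
      Ico 0 (G.cut i.succ - G.cut i.castSucc), P.bdry s = P.bdry (G.cut i.castSucc + x) := by
    intro k
    induction k using Fin.induction with
    | zero => intro h; exact absurd h (not_lt.2 hsm.1)
    | succ i ih =>
      intro h
      rcases lt_or_ge s (G.cut i.castSucc) with h' | h'
      · exact ih h'
      · exact ⟨i, s - G.cut i.castSucc, ⟨by linarith, by linarith⟩, by congr 1; ring⟩
  exact key (Fin.last _) (by rw [G.cut_last]; exact hsm.2)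

lemma exists_interval_left (u : ℝ) : ∃ i : Fin G.m,
    ∃ x ∈ Ioc 0 (G.cut i.succ - G.cut i.castSucc),
    P.bdry u = P.bdry (G.cut i.castSucc + x) := by
  have hL := P.perimeter_pos
  set s := toIocMod hL (G.cut 0) u with hs
  have hsm : s ∈ Ioc (G.cut 0) (G.cut 0 + P.perimeter) := toIocMod_mem_Ioc hL (G.cut 0) u
  have hb : P.bdry u = P.bdry s := by
    rw [P.bdry_eq_bdry_iff]
    exact ⟨toIocDiv hL (G.cut 0) u, by
      have := toIocMod_add_toIocDiv_zsmul hL (G.cut 0) u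
      rw [zsmul_eq_mul] at this; exact this.symm⟩
  rw [hb]
  have key : ∀ k : Fin (G.m + 1), s ≤ G.cut k → ∃ i : Fin G.m, ∃ x ∈
      Ioc 0 (G.cut i.succ - G.cut i.castSucc), P.bdry s = P.bdry (G.cut i.castSucc + x) := by
    intro k
    induction k using Fin.induction with
    | zero => intro h; exact absurd h (not_le.2 hsm.1)
    | succ i ih =>
      intro h
      rcases le_or_gt s (G.cut i.castSucc) with h' | h'
      · exact ih h'
      · exact ⟨i, s - G.cut i.castSucc, ⟨by linarith, by linarith⟩, by congr 1; ring⟩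
  exact key (Fin.last _) (by rw [G.cut_last]; exact hsm.2)

/-- The classes of points in the interior of an interval. -/
lemma cls_interior {i : Fin G.m} {x : ℝ} (hx : x ∈ Ioo 0 (G.cut i.succ - G.cut i.castSucc)) :
    P.bdry (G.cut i.castSucc + x) ≠ P.bdry (G.partner i x) ∧
    G.cls (P.bdry (G.cut i.castSucc + x)) =
      {P.bdry (G.cut i.castSucc + x), P.bdry (G.partner i x)} := by
  have hx' : x ∈ Icc 0 (G.cut i.succ - G.cut i.castSucc) := ⟨hx.1.le, hx.2.le⟩
  have hp := G.partner_eq i x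
  set y := if G.rev i then (G.cut i.succ - G.cut i.castSucc) - x else x with hy
  have hym : y ∈ Ioo 0 (G.cut (G.mate i).succ - G.cut (G.mate i).castSucc) := by
    rw [G.length_mate, hy]
    split_ifs
    · exact ⟨by linarith [hx.2], by linarith [hx.1]⟩
    · exact hx
  have hback : G.partner (G.mate i) y = G.cut i.castSucc + x := by
    rw [partner_eq, G.mate_mate, G.rev_mate, G.length_mate, hy]
    split_ifs <;> simp
  refine ⟨fun h => ?_, Subset.antisymm (G.cls_subset ?_ (by simp)) ?_⟩
  · rw [hp] at h
    exact G.mate_ne i (G.eq_of_bdry_eq hx ⟨hym.1.le, hym.2.le⟩ h).1.symm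
  · rintro z (rfl | rfl) w hw
    · obtain ⟨j, t, ht, h1, rfl⟩ := G.pair_iff.1 hw
      obtain ⟨rfl, rfl⟩ := G.eq_of_bdry_eq hx ht h1
      simp
    · obtain ⟨j, t, ht, h1, rfl⟩ := G.pair_iff.1 hw
      rw [hp] at h1
      obtain ⟨rfl, rfl⟩ := G.eq_of_bdry_eq hym ht h1
      rw [hback]; simp
  · rintro z (rfl | rfl)
    · exact G.mem_cls_self _
    · exact G.glued_of_pair (G.pair_iff.2 ⟨i, x, hx', rfl, rfl⟩)

lemma finite_cuts : (range fun i : Fin (G.m + 1) => P.bdry (G.cut i)).Finite := finite_range _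

lemma exists_interior_of_not_cut {z : ℂ} (hz : z ∈ P.boundary)
    (h : z ∉ range fun i : Fin (G.m + 1) => P.bdry (G.cut i)) :
    ∃ i : Fin G.m, ∃ x ∈ Ioo 0 (G.cut i.succ - G.cut i.castSucc),
      z = P.bdry (G.cut i.castSucc + x) := by
  obtain ⟨u, rfl⟩ := P.exists_bdry_eq hz
  obtain ⟨i, x, hx, he⟩ := G.exists_interval u
  rcases hx.1.lt_or_eq with h0 | rfl
  · exact ⟨i, x, ⟨h0, hx.2⟩, he⟩
  · exact absurd ⟨i.castSucc, by simp [he]⟩ h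

lemma finite_cls {z : ℂ} (hz : z ∈ P.boundary) : (G.cls z).Finite := by
  by_cases h : G.cls z ⊆ range fun i : Fin (G.m + 1) => P.bdry (G.cut i)
  · exact G.finite_cuts.subset h
  · obtain ⟨w, hw, hwc⟩ := Set.not_subset.1 h
    obtain ⟨i, x, hx, rfl⟩ := G.exists_interior_of_not_cut (Glued.mem_boundary hw hz) hwc
    rw [Glued.cls_eq hw, (G.cls_interior hx).2]
    exact Set.toFinite _

/-- A point inside an interval has exactly one partner. So a node point is a cut point or is glued
to a vertex, and classes are finite. -/
lemma finite_isNodePoint : {z | G.IsNodePoint z}.Finite := by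
  have hsub : {z | G.IsNodePoint z} ⊆ (range fun i : Fin (G.m + 1) => P.bdry (G.cut i)) ∪
      ⋃ v ∈ {v | P.IsVertex v}, G.cls v := by
    rintro z ⟨hz, h⟩
    by_cases hc : z ∈ range fun i : Fin (G.m + 1) => P.bdry (G.cut i)
    · exact Or.inl hc
    · right
      obtain ⟨i, x, hx, rfl⟩ := G.exists_interior_of_not_cut hz hc
      rcases h with h | ⟨w, hw, hv⟩
      · exfalso
        apply h
        rw [(G.cls_interior hx).2]
        exact Set.encard_pair (G.cls_interior hx).1
      · exact mem_biUnion hv (Glued.symm hw)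
  refine (G.finite_cuts.union (P.finite_setOf_isVertex.biUnion ?_)).subset hsub
  rintro v ⟨i, rfl⟩
  exact G.finite_cls (P.vertex_mem_boundary i)

lemma finite_nodeParams (a b : ℝ) : {u | u ∈ Icc a b ∧ G.IsNodePoint (P.bdry u)}.Finite :=
  P.finite_bdry_preimage G.finite_isNodePoint a b

lemma isNodePoint_vertex (i : ZMod n) : G.IsNodePoint (P.vertex i) :=
  ⟨P.vertex_mem_boundary i, Or.inr ⟨_, G.mem_cls_self _, i, rfl⟩⟩

variable {G} in
lemma Glued.isNodePoint {z w : ℂ} (h : G.Glued z w) (hz : G.IsNodePoint z) : G.IsNodePoint w :=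
  ⟨h.mem_boundary hz.1, by rw [← h.cls_eq]; exact hz.2⟩

variable {G} in
/-- A boundary point that is not a node is glued to exactly one other point. -/
lemma eq_of_not_isNodePoint {z x y : ℂ} (hz : z ∈ P.boundary) (h : ¬ G.IsNodePoint z)
    (hx : G.Glued z x) (hy : G.Glued z y) (hxz : z ≠ x) (hyz : z ≠ y) : x = y := by
  have h2 : (G.cls z).encard = 2 := by
    by_contra h2
    exact h ⟨hz, Or.inl h2⟩
  obtain ⟨a, b, -, hab⟩ := Set.encard_eq_two.1 h2
  have m1 : z ∈ G.cls z := G.mem_cls_self z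
  have m2 : x ∈ G.cls z := hx
  have m3 : y ∈ G.cls z := hy
  rw [hab] at m1 m2 m3
  simp only [mem_insert_iff, mem_singleton_iff] at m1 m2 m3
  grind

end Gluing

namespace Gluing

variable {n : ℕ} {P : SimplePolygon n} (G : Gluing P)

/-! ### The gluing of arcs between node points -/

/-- The slope of the gluing map on an interval. -/
def slope (i : Fin G.m) : ℝ := if G.rev i then -1 else 1

lemma slope_eq (i : Fin G.m) : G.slope i = 1 ∨ G.slope i = -1 := by
  unfold slope; split_ifs <;> simp

lemma partner_add (i : Fin G.m) (x d : ℝ) :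
    G.partner i (x + d) = G.partner i x + G.slope i * d := by
  unfold partner slope; split_ifs <;> ring

lemma glued_partner {i : Fin G.m} {x : ℝ} (hx : x ∈ Icc 0 (G.cut i.succ - G.cut i.castSucc)) :
    G.Glued (P.bdry (G.cut i.castSucc + x)) (P.bdry (G.partner i x)) :=
  G.glued_of_pair (G.pair_iff.2 ⟨i, x, hx, rfl, rfl⟩)

lemma glued_near {u x y : ℝ} {i : Fin G.m} (h : P.bdry u = P.bdry (G.cut i.castSucc + x))
    (hy : x + (y - u) ∈ Icc 0 (G.cut i.succ - G.cut i.castSucc)) :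
    G.Glued (P.bdry y) (P.bdry (G.partner i x - G.slope i * u + G.slope i * y)) ∧
    (x + (y - u) ∈ Ioo 0 (G.cut i.succ - G.cut i.castSucc) →
      P.bdry y ≠ P.bdry (G.partner i x - G.slope i * u + G.slope i * y)) := by
  have e1 : P.bdry y = P.bdry (G.cut i.castSucc + (x + (y - u))) := by
    have := SimplePolygon.bdry_add_congr h (y - u)
    rw [← add_assoc, ← this]; congr 1; ring
  have e2 : G.partner i x - G.slope i * u + G.slope i * y = G.partner i (x + (y - u)) := by
    rw [partner_add]; ring
  rw [e1, e2]
  exact ⟨G.glued_partner hy, fun h => (G.cls_interior h).1⟩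

/-- Near a boundary point that is not a node point, each point is glued to exactly one other point,
and the gluing is isometric. -/
lemma exists_germ {u : ℝ} (hu : ¬ G.IsNodePoint (P.bdry u)) :
    ∃ w σ : ℝ, (σ = 1 ∨ σ = -1) ∧ ∃ ε > 0, ∀ y ∈ Ioo (u - ε) (u + ε),
      G.Glued (P.bdry y) (P.bdry (w + σ * y)) ∧ P.bdry y ≠ P.bdry (w + σ * y) := by
  obtain ⟨j, x, hx, hj⟩ := G.exists_interval u
  rcases hx.1.lt_or_eq with h0 | rfl
  · refine ⟨G.partner j x - G.slope j * u, G.slope j, G.slope_eq j, min x (G.cut j.succ - G.cut j.castSucc - x),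
      lt_min h0 (by linarith [hx.2]), fun y hy => ?_⟩
    have h1 := min_le_left x (G.cut j.succ - G.cut j.castSucc - x)
    have h2 := min_le_right x (G.cut j.succ - G.cut j.castSucc - x)
    have hm : x + (y - u) ∈ Ioo 0 (G.cut j.succ - G.cut j.castSucc) :=
      ⟨by linarith [hy.1], by linarith [hy.2]⟩
    have := G.glued_near hj ⟨hm.1.le, hm.2.le⟩
    exact ⟨this.1, this.2 hm⟩
  -- Here `u` is a cut point, between interval `i` on its left and interval `j` on its right; the
  -- germs from both sides must be shown to agree.
  · obtain ⟨i, x, hxi, hi⟩ := G.exists_interval_left u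
    have hxe : x = G.cut i.succ - G.cut i.castSucc := by
      rcases hxi.2.lt_or_eq with h | h
      · have := (G.eq_of_bdry_eq ⟨hxi.1, h⟩ ⟨le_rfl, (sub_pos.2 (G.cut_lt j)).le⟩
          (hi.symm.trans hj)).2
        exact absurd this hxi.1.ne'
      · exact h
    have hj' : P.bdry u = P.bdry (G.cut j.castSucc) := by rw [hj, add_zero]
    have hi' : P.bdry u = P.bdry (G.cut i.succ) := by rw [hi, hxe]; congr 1; ring
    have hpair : ∀ w, G.Pair (P.bdry u) w → w = P.bdry (G.partner j 0) ∨
        w = P.bdry (G.partner i x) := by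
      intro w hw
      obtain ⟨k, t, ht, h1, rfl⟩ := G.pair_iff.1 hw
      rcases ht.1.lt_or_eq with h0 | rfl
      · rcases ht.2.lt_or_eq with h2 | h2
        · have := (G.eq_of_bdry_eq ⟨h0, h2⟩ ⟨le_rfl, (sub_pos.2 (G.cut_lt j)).le⟩
            (h1.symm.trans hj)).2
          exact absurd this h0.ne'
        · right
          have : k = i := by
            apply G.eq_of_bdry_cut_succ_eq
            rw [← hi', h1, h2]; congr 1; ring
          subst this
          rw [h2, hxe]
      · left
        have : k = j := by
          apply G.eq_of_bdry_cut_eq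
          rw [← hj', h1, add_zero]
        rw [this]
    have hgj : G.Glued (P.bdry u) (P.bdry (G.partner j 0)) := by
      rw [hj]; exact G.glued_partner ⟨le_rfl, (sub_pos.2 (G.cut_lt j)).le⟩
    have hgi : G.Glued (P.bdry u) (P.bdry (G.partner i x)) := by
      rw [hi]; exact G.glued_partner ⟨hxi.1.le, hxi.2⟩
    have pj : G.partner j 0 =
        if G.rev j then G.cut (G.mate j).succ else G.cut (G.mate j).castSucc := by
      simp [partner]
    have pi : G.partner i x =
        if G.rev i then G.cut (G.mate i).castSucc else G.cut (G.mate i).succ := by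
      rw [partner_eq, hxe, ← G.length_mate i]; split_ifs <;> ring
    -- If one side glues `u` to itself, the two intervals are mates folded at `u`, so the other side
    -- does too. Then the class would be a single point and `u` a node point.
    have hji : P.bdry u = P.bdry (G.partner j 0) → P.bdry u = P.bdry (G.partner i x) := by
      intro h
      rw [pj] at h
      rw [pi]
      split_ifs at h with hr
      · have hm : i = G.mate j := G.eq_of_bdry_cut_succ_eq (hi'.symm.trans h)
        subst hm
        rw [G.rev_mate, if_pos hr, G.mate_mate, hj']
      · exact absurd (G.eq_of_bdry_cut_eq (hj'.symm.trans h)).symm (G.mate_ne j)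
    have hij : P.bdry u = P.bdry (G.partner i x) → P.bdry u = P.bdry (G.partner j 0) := by
      intro h
      rw [pi] at h
      rw [pj]
      split_ifs at h with hr
      · have hm : j = G.mate i := G.eq_of_bdry_cut_eq (hj'.symm.trans h)
        subst hm
        rw [G.rev_mate, if_pos hr, G.mate_mate, hi']
      · exact absurd (G.eq_of_bdry_cut_succ_eq (hi'.symm.trans h)).symm (G.mate_ne i)
    have hne : P.bdry u ≠ P.bdry (G.partner j 0) := by
      intro h
      have hsub : G.cls (P.bdry u) ⊆ {P.bdry u} := by
        refine G.cls_subset ?_ rfl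
        rintro z rfl w hw
        rcases hpair w hw with rfl | rfl
        · exact h.symm
        · exact (hji h).symm
      refine hu ⟨P.bdry_mem_boundary u, Or.inl fun h2 => ?_⟩
      have := Set.encard_le_encard hsub
      rw [h2, Set.encard_singleton] at this
      exact absurd this (by norm_num)
    have heq : P.bdry (G.partner j 0) = P.bdry (G.partner i x) :=
      eq_of_not_isNodePoint (P.bdry_mem_boundary u) hu hgj hgi hne fun h => hne (hij h)
    -- With different orientations the common partner would be an endpoint of the same kind of both
    -- mates, so the mates, and then `i` and `j`, would coincide.
    have hrev : G.rev i = G.rev j := by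
      have hmm : ∀ i j, G.mate i = G.mate j → i = j := fun i j h => by
        rw [← G.mate_mate i, h, G.mate_mate]
      rw [pi, pj] at heq
      cases h1 : G.rev i <;> cases h2 : G.rev j
      · rfl
      · rw [h1, h2] at heq
        have := hmm _ _ (G.eq_of_bdry_cut_succ_eq (by simpa using heq))
        rw [this, h1] at h2; exact absurd h2 (by simp)
      · rw [h1, h2] at heq
        have := hmm _ _ (G.eq_of_bdry_cut_eq (by simpa using heq))
        rw [this, h1] at h2; exact absurd h2 (by simp)
      · rfl
    have hsl : G.slope i = G.slope j := by simp only [slope, hrev]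
    have haff : ∀ y, P.bdry (G.partner i x - G.slope i * u + G.slope i * y) =
        P.bdry (G.partner j 0 - G.slope j * u + G.slope j * y) := by
      intro y
      rw [hsl]
      have := SimplePolygon.bdry_add_congr heq (G.slope j * (y - u))
      rw [show G.partner i x - G.slope j * u + G.slope j * y =
        G.partner i x + G.slope j * (y - u) by ring, ← this]
      congr 1; ring
    have hc1 := G.cut_lt i
    have hc2 := G.cut_lt j
    refine ⟨G.partner j 0 - G.slope j * u, G.slope j, G.slope_eq j,
      min (G.cut i.succ - G.cut i.castSucc) (G.cut j.succ - G.cut j.castSucc),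
      lt_min (by linarith) (by linarith), fun y hy => ?_⟩
    have h1 := min_le_left (G.cut i.succ - G.cut i.castSucc) (G.cut j.succ - G.cut j.castSucc)
    have h2 := min_le_right (G.cut i.succ - G.cut i.castSucc) (G.cut j.succ - G.cut j.castSucc)
    rcases lt_trichotomy y u with h | rfl | h
    · have hm : x + (y - u) ∈ Ioo 0 (G.cut i.succ - G.cut i.castSucc) := by
        rw [hxe]; exact ⟨by linarith [hy.1], by linarith⟩
      have := G.glued_near hi ⟨hm.1.le, hm.2.le⟩
      rw [haff] at this
      exact ⟨this.1, this.2 hm⟩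
    · rw [sub_add_cancel]
      exact ⟨hgj, hne⟩
    · have hm : 0 + (y - u) ∈ Ioo 0 (G.cut j.succ - G.cut j.castSucc) :=
        ⟨by linarith, by linarith [hy.2]⟩
      have := G.glued_near hj ⟨hm.1.le, hm.2.le⟩
      exact ⟨this.1, this.2 hm⟩

/-- A point that is not a node point has only one partner, so overlapping germs agree. Points near
which one fixed affine formula holds form a set that is open and relatively closed in the interval,
which is connected. -/
lemma exists_affine_partner {s t : ℝ} (hst : s < t)
    (h : ∀ u ∈ Ioo s t, ¬ G.IsNodePoint (P.bdry u)) :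
    ∃ w σ : ℝ, (σ = 1 ∨ σ = -1) ∧ ∀ y ∈ Ioo s t,
      G.Glued (P.bdry y) (P.bdry (w + σ * y)) ∧ P.bdry y ≠ P.bdry (w + σ * y) := by
  obtain ⟨w, σ, hσ, ε, hε, hg⟩ := G.exists_germ (h ((s + t) / 2) ⟨by linarith, by linarith⟩)
  refine ⟨w, σ, hσ, ?_⟩
  set p : ℝ → Prop := fun y =>
    G.Glued (P.bdry y) (P.bdry (w + σ * y)) ∧ P.bdry y ≠ P.bdry (w + σ * y) with hp
  set U : Set ℝ := {x | ∀ᶠ y in nhds x, p y} with hU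
  have hUo : IsOpen U := isOpen_setOfPred_eventually_nhds
  have hVo : IsOpen {x | ∀ᶠ y in nhds x, y ∉ U} := isOpen_setOfPred_eventually_nhds
  have hsub := isPreconnected_Ioo.subset_left_of_subset_union hUo hVo
    (Set.disjoint_left.2 fun x hx hx' => Filter.Eventually.self_of_nhds hx' hx)
    (s := Ioo s t) ?_ ⟨(s + t) / 2, ⟨by linarith, by linarith⟩, ?_⟩
  · intro y hy
    exact (hsub hy).self_of_nhds
  · intro x hx
    rw [Set.mem_union]
    by_contra hcon
    push Not at hcon
    obtain ⟨hx1, hx2⟩ := hcon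
    obtain ⟨w', σ', hσ', ε', hε', hg'⟩ := G.exists_germ (h x hx)
    have hmem : Ioo (x - ε') (x + ε') ∩ Ioo s t ∈ nhds x :=
      Filter.inter_mem (Ioo_mem_nhds (by linarith) (by linarith)) (Ioo_mem_nhds hx.1 hx.2)
    have hx2' : ∃ᶠ y in nhds x, y ∈ U := by
      intro h'; exact hx2 h'
    obtain ⟨y, hyU, hy⟩ := (hx2'.and_eventually hmem).exists
    have hyU' : ∀ᶠ z in nhds y, p z := hyU
    have hmem' : ∀ᶠ z in nhds y, z ∈ Ioo (x - ε') (x + ε') ∩ Ioo s t :=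
      (isOpen_Ioo.inter isOpen_Ioo).mem_nhds hy
    obtain ⟨a, b, hab, hsub⟩ := mem_nhds_iff_exists_Ioo_subset.1 (hyU'.and hmem')
    have := P.bdry_affine_eq (hab.1.trans hab.2) hσ hσ' fun z hz => by
      obtain ⟨⟨h1, h2⟩, h3, h4⟩ := hsub hz
      obtain ⟨h5, h6⟩ := hg' z h3
      exact eq_of_not_isNodePoint (P.bdry_mem_boundary z) (h z h4) h1 h5 h2 h6
    apply hx1
    change ∀ᶠ y in nhds x, p y
    filter_upwards [hmem] with z hz
    have := this.2 z
    simp only [hp]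
    rw [this]
    exact hg' z hz.1
  · change ∀ᶠ y in nhds _, p y
    filter_upwards [Ioo_mem_nhds (show (s + t) / 2 - ε < (s + t) / 2 by linarith)
      (show (s + t) / 2 < (s + t) / 2 + ε by linarith)] with z hz
    exact hg z hz

/-- The affine partner map of an arc extends to the end points. -/
lemma glued_endpoints {s t w σ : ℝ} (hst : s < t) (hσ : σ = 1 ∨ σ = -1)
    (hn : ∀ u ∈ Ioo s t, ¬ G.IsNodePoint (P.bdry u))
    (h : ∀ y ∈ Ioo s t, G.Glued (P.bdry y) (P.bdry (w + σ * y)) ∧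
      P.bdry y ≠ P.bdry (w + σ * y)) :
    ∀ y ∈ Icc s t, G.Glued (P.bdry y) (P.bdry (w + σ * y)) := by
  have key : ∀ (i : Fin G.m) (x u : ℝ), P.bdry u = P.bdry (G.cut i.castSucc + x) →
      x ∈ Icc 0 (G.cut i.succ - G.cut i.castSucc) →
      (∃ a b, a < b ∧ a ∈ Icc s t ∧ b ∈ Icc s t ∧
        ∀ y ∈ Ioo a b, x + (y - u) ∈ Ioo 0 (G.cut i.succ - G.cut i.castSucc)) →
      G.Glued (P.bdry u) (P.bdry (w + σ * u)) := by
    rintro i x u hu hx ⟨a, b, hab, ha, hb, hI⟩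
    have := P.bdry_affine_eq hab hσ (G.slope_eq i) (w' := G.partner i x - G.slope i * u)
      fun z hz => by
        have hz' : z ∈ Ioo s t := ⟨ha.1.trans_lt hz.1, hz.2.trans_le hb.2⟩
        have h1 := G.glued_near (y := z) hu ⟨(hI z hz).1.le, (hI z hz).2.le⟩
        exact eq_of_not_isNodePoint (P.bdry_mem_boundary z) (hn z hz')
          (h z hz').1 h1.1 (h z hz').2 (h1.2 (hI z hz))
    rw [this.2 u]
    exact (G.glued_near hu (by simpa using hx)).1
  intro y hy
  rcases hy.1.lt_or_eq with h1 | rfl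
  · rcases hy.2.lt_or_eq with h2 | rfl
    · exact (h y ⟨h1, h2⟩).1
    · obtain ⟨i, x, hx, hu⟩ := G.exists_interval_left y
      refine key i x y hu ⟨hx.1.le, hx.2⟩ ⟨max s (y - x), y, max_lt hst (by linarith [hx.1]),
        ⟨le_max_left _ _, max_le hst.le (by linarith [hx.1])⟩, hy, fun z hz => ?_⟩
      have := (le_max_right _ _).trans_lt hz.1
      exact ⟨by linarith, by linarith [hz.2, hx.2]⟩
  · obtain ⟨i, x, hx, hu⟩ := G.exists_interval s
    refine key i x s hu ⟨hx.1, hx.2.le⟩ ⟨s, min t (s + (G.cut i.succ - G.cut i.castSucc - x)),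
      lt_min hst (by linarith [hx.2]), hy,
      ⟨le_min hst.le (by linarith [hx.2]), min_le_left _ _⟩, fun z hz => ?_⟩
    have := hz.2.trans_le (min_le_right _ _)
    exact ⟨by linarith [hz.1, hx.1], by linarith⟩

variable {G} in
/-- Each arc between consecutive node points is glued to another arc. -/
theorem IsArc.exists_mate {s t : ℝ} (h : G.IsArc s t) : ∃ s' t', G.IsArc s' t' ∧
    t' - s' = t - s ∧ P.bdry s' ≠ P.bdry s ∧
    ((∀ x ∈ Icc 0 (t - s), G.Glued (P.bdry (s + x)) (P.bdry (t' - x))) ∨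
      (∀ x ∈ Icc 0 (t - s), G.Glued (P.bdry (s + x)) (P.bdry (s' + x)))) := by
  obtain ⟨hst, hL, hs, ht, hn⟩ := h
  obtain ⟨w, σ, hσ, hg⟩ := G.exists_affine_partner hst hn
  have hc := G.glued_endpoints hst hσ hn hg
  have hN : ∀ y ∈ Ioo s t, ¬ G.IsNodePoint (P.bdry (w + σ * y)) := fun y hy h' =>
    hn y hy ((hg y hy).1.symm.isNodePoint h')
  have hs' := (hc s ⟨le_rfl, hst.le⟩).isNodePoint hs
  have ht' := (hc t ⟨hst.le, le_rfl⟩).isNodePoint ht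
  rcases hσ with rfl | rfl
  · refine ⟨w + 1 * s, w + 1 * t, ⟨by linarith, by linarith, hs', ht', fun u hu => ?_⟩, by ring,
      fun h => ?_, Or.inr fun x hx => ?_⟩
    · have := hN (u - w) ⟨by linarith [hu.1], by linarith [hu.2]⟩
      rwa [one_mul, add_sub_cancel] at this
    -- If both arcs started at the same boundary point, the midpoint of the arc would be its own
    -- partner; likewise in the reversed case.
    · have := SimplePolygon.bdry_add_congr h ((t - s) / 2)
      apply (hg ((s + t) / 2) ⟨by linarith, by linarith⟩).2
      convert this.symm using 2 <;> ring
    · have := hc (s + x) ⟨by linarith [hx.1], by linarith [hx.2]⟩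
      convert this using 2; ring
  · refine ⟨w + -1 * t, w + -1 * s, ⟨by linarith, by linarith, ht', hs', fun u hu => ?_⟩, by ring,
      fun h => ?_, Or.inl fun x hx => ?_⟩
    · have := hN (w - u) ⟨by linarith [hu.2], by linarith [hu.1]⟩
      convert this using 3; ring
    · have := SimplePolygon.bdry_add_congr h ((t - s) / 2)
      apply (hg ((s + t) / 2) ⟨by linarith, by linarith⟩).2
      convert this.symm using 2 <;> ring
    · have := hc (s + x) ⟨by linarith [hx.1], by linarith [hx.2]⟩
      convert this using 2; ring

end Gluing

namespace Gluing

variable {n : ℕ} {P : SimplePolygon n} (G : Gluing P)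

/-! ### Nodes -/

/-- The node at a node point. -/
def nodeAt (z : ℂ) (hz : G.IsNodePoint z) : G.Node := ⟨G.cls z, z, hz, rfl⟩

lemma mem_nodeAt {z : ℂ} (hz : G.IsNodePoint z) : z ∈ (G.nodeAt z hz).1 := G.mem_cls_self z

variable {G}

lemma Node.eq_cls (a : G.Node) {z : ℂ} (hz : z ∈ a.1) : a.1 = G.cls z := by
  obtain ⟨w, _, h⟩ := a.2
  rw [h] at hz ⊢
  exact Glued.cls_eq hz

lemma Node.isNodePoint (a : G.Node) {z : ℂ} (hz : z ∈ a.1) : G.IsNodePoint z := by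
  obtain ⟨w, hw, h⟩ := a.2
  rw [h] at hz
  exact Glued.isNodePoint hz hw

lemma Node.eq_of_mem {a c : G.Node} {z : ℂ} (ha : z ∈ a.1) (hc : z ∈ c.1) : a = c :=
  Subtype.ext ((a.eq_cls ha).trans (c.eq_cls hc).symm)

lemma Node.glued (a : G.Node) {z w : ℂ} (hz : z ∈ a.1) (hw : w ∈ a.1) : G.Glued z w := by
  rw [a.eq_cls hz] at hw; exact hw

lemma Node.mem_of_glued (a : G.Node) {z w : ℂ} (hz : z ∈ a.1) (h : G.Glued z w) : w ∈ a.1 := by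
  rw [a.eq_cls hz]; exact h

lemma Node.mem_boundary (a : G.Node) {z : ℂ} (hz : z ∈ a.1) : z ∈ P.boundary :=
  (a.isNodePoint hz).1

lemma Node.exists_mem (a : G.Node) : ∃ z, z ∈ a.1 := by
  obtain ⟨z, _, h⟩ := a.2
  exact ⟨z, h ▸ G.mem_cls_self z⟩

lemma Node.exists_param (a : G.Node) : ∃ s, P.bdry s ∈ a.1 := by
  obtain ⟨z, hz⟩ := a.exists_mem
  obtain ⟨s, rfl⟩ := P.exists_bdry_eq (a.mem_boundary hz)
  exact ⟨s, hz⟩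

lemma nodeAt_eq {a : G.Node} {z : ℂ} (hz : z ∈ a.1) : G.nodeAt z (a.isNodePoint hz) = a :=
  Node.eq_of_mem (G.mem_nodeAt _) hz

lemma Node.finite (a : G.Node) : a.1.Finite := by
  obtain ⟨z, hz, h⟩ := a.2
  rw [h]; exact G.finite_cls hz.1

/-- The boundary points of a node. -/
def Node.pts (a : G.Node) : Finset ℂ := a.finite.toFinset

lemma Node.mem_pts {a : G.Node} {z : ℂ} : z ∈ a.pts ↔ z ∈ a.1 := a.finite.mem_toFinset

lemma Node.pts_pos (a : G.Node) : 0 < a.pts.card := by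
  obtain ⟨z, hz⟩ := a.exists_mem
  exact Finset.card_pos.2 ⟨z, Node.mem_pts.2 hz⟩

variable (G) in
/-- All node points. -/
def nodePoints : Finset ℂ := G.finite_isNodePoint.toFinset

lemma mem_nodePoints {z : ℂ} : z ∈ G.nodePoints ↔ G.IsNodePoint z :=
  G.finite_isNodePoint.mem_toFinset

instance : Finite G.Node := by
  have : Finite {z // G.IsNodePoint z} := G.finite_isNodePoint
  refine Finite.of_surjective (fun z : {z // G.IsNodePoint z} => G.nodeAt z.1 z.2) fun a => ?_
  obtain ⟨z, hz⟩ := a.exists_mem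
  exact ⟨⟨z, a.isNodePoint hz⟩, nodeAt_eq hz⟩

lemma sum_nodePoints [Fintype G.Node] {M : Type*} [AddCommMonoid M] (f : ℂ → M) :
    ∑ z ∈ G.nodePoints, f z = ∑ a : G.Node, ∑ z ∈ a.pts, f z := by
  classical
  rw [← Finset.sum_biUnion]
  · refine Finset.sum_congr ?_ fun _ _ => rfl
    ext z
    simp only [Finset.mem_biUnion, Finset.mem_univ, true_and, Node.mem_pts, mem_nodePoints]
    exact ⟨fun hz => ⟨G.nodeAt z hz, G.mem_nodeAt hz⟩, fun ⟨a, ha⟩ => a.isNodePoint ha⟩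
  · intro a _ c _ hac
    exact Finset.disjoint_left.2 fun z ha hc =>
      hac (Node.eq_of_mem (Node.mem_pts.1 ha) (Node.mem_pts.1 hc))

/-! ### Arcs -/

lemma exists_isNodePoint_mem_Ioc (u : ℝ) : ∃ t ∈ Ioc u (u + P.perimeter),
    G.IsNodePoint (P.bdry t) := by
  obtain ⟨v, hv⟩ := P.exists_bdry_eq (P.vertex_mem_boundary 0)
  have hL := P.perimeter_pos
  refine ⟨toIocMod hL u v, toIocMod_mem_Ioc hL u v, ?_⟩
  have : P.bdry (toIocMod hL u v) = P.bdry v := by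
    rw [P.bdry_eq_bdry_iff]
    exact ⟨-toIocDiv hL u v, by
      have := toIocMod_add_toIocDiv_zsmul hL u v
      rw [zsmul_eq_mul] at this; push_cast; linarith⟩
  rw [this, hv]
  exact G.isNodePoint_vertex 0

lemma exists_next (u : ℝ) : ∃ t ∈ Ioc u (u + P.perimeter), G.IsNodePoint (P.bdry t) ∧
    ∀ v ∈ Ioo u t, ¬ G.IsNodePoint (P.bdry v) := by
  obtain ⟨t₀, ht₀, hn₀⟩ := exists_isNodePoint_mem_Ioc (G := G) u
  obtain ⟨t, ⟨ht, htn⟩, hmin⟩ := Set.exists_min_image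
    {v | v ∈ Ioc u (u + P.perimeter) ∧ G.IsNodePoint (P.bdry v)} id
    ((G.finite_nodeParams u (u + P.perimeter)).subset fun v hv => ⟨⟨hv.1.1.le, hv.1.2⟩, hv.2⟩)
    ⟨t₀, ht₀, hn₀⟩
  refine ⟨t, ht, htn, fun v hv hvn => ?_⟩
  have := hmin v ⟨⟨hv.1, hv.2.le.trans ht.2⟩, hvn⟩
  exact absurd hv.2 (not_lt.2 this)

lemma exists_prev (u : ℝ) : ∃ t ∈ Ico (u - P.perimeter) u, G.IsNodePoint (P.bdry t) ∧
    ∀ v ∈ Ioo t u, ¬ G.IsNodePoint (P.bdry v) := by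
  obtain ⟨t₀, ht₀, hn₀⟩ := exists_isNodePoint_mem_Ioc (G := G) (u - P.perimeter)
  obtain ⟨t₁, ht₁, hn₁⟩ : ∃ t ∈ Ico (u - P.perimeter) u, G.IsNodePoint (P.bdry t) := by
    rcases ht₀.2.lt_or_eq with h | h
    · exact ⟨t₀, ⟨ht₀.1.le, by linarith⟩, hn₀⟩
    · refine ⟨u - P.perimeter, ⟨le_rfl, by linarith [P.perimeter_pos]⟩, ?_⟩
      rw [← P.bdry_add_perimeter, ← h]; exact hn₀
  obtain ⟨t, ⟨ht, htn⟩, hmax⟩ := Set.exists_max_image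
    {v | v ∈ Ico (u - P.perimeter) u ∧ G.IsNodePoint (P.bdry v)} id
    ((G.finite_nodeParams (u - P.perimeter) u).subset fun v hv => ⟨⟨hv.1.1, hv.1.2.le⟩, hv.2⟩)
    ⟨t₁, ht₁, hn₁⟩
  refine ⟨t, ht, htn, fun v hv hvn => ?_⟩
  have := hmax v ⟨⟨ht.1.trans hv.1.le, hv.2⟩, hvn⟩
  exact absurd hv.1 (not_lt.2 this)

lemma exists_arc_right {s : ℝ} (hs : G.IsNodePoint (P.bdry s)) : ∃ t, G.IsArc s t := by
  obtain ⟨t, ht, hn, h⟩ := exists_next (G := G) s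
  exact ⟨t, ht.1, ht.2, hs, hn, h⟩

lemma exists_arc_left {t : ℝ} (ht : G.IsNodePoint (P.bdry t)) : ∃ s, G.IsArc s t := by
  obtain ⟨s, hs, hn, h⟩ := exists_prev (G := G) t
  exact ⟨s, hs.2, by linarith [hs.1], hn, ht, h⟩

lemma IsArc.shift {s t : ℝ} (h : G.IsArc s t) (k : ℤ) :
    G.IsArc (s + k * P.perimeter) (t + k * P.perimeter) := by
  obtain ⟨h1, h2, h3, h4, h5⟩ := h
  refine ⟨by linarith, by linarith, by rwa [P.bdry_add_int_mul], by rwa [P.bdry_add_int_mul],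
    fun u hu => ?_⟩
  have := h5 (u - k * P.perimeter) ⟨by linarith [hu.1], by linarith [hu.2]⟩
  rwa [← P.bdry_add_int_mul _ k, sub_add_cancel] at this

lemma IsArc.eq_of_mem {s t s' t' : ℝ} (h : G.IsArc s t) (h' : G.IsArc s' t') {x : ℝ}
    (hx : x ∈ Ioo s t) (hx' : x ∈ Ioo s' t') : s = s' ∧ t = t' := by
  have key : ∀ {s t s' t' : ℝ}, G.IsArc s t → G.IsArc s' t' → x ∈ Ioo s t → x ∈ Ioo s' t' →
      s ≤ s' ∧ t' ≤ t := by
    intro s t s' t' h h' hx hx'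
    constructor
    · by_contra hcon
      push Not at hcon
      exact h'.2.2.2.2 s ⟨hcon, hx.1.trans hx'.2⟩ h.2.2.1
    · by_contra hcon
      push Not at hcon
      exact h'.2.2.2.2 t ⟨hx'.1.trans hx.2, hcon⟩ h.2.2.2.1
  obtain ⟨a1, a2⟩ := key h h' hx hx'
  obtain ⟨b1, b2⟩ := key h' h hx' hx
  exact ⟨le_antisymm a1 b1, le_antisymm b2 a2⟩

/-- Two arcs with a common interior boundary point have the same end points. -/
lemma IsArc.eq_of_bdry_eq {s t s' t' x x' : ℝ} (h : G.IsArc s t) (h' : G.IsArc s' t')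
    (hx : x ∈ Ioo s t) (hx' : x' ∈ Ioo s' t') (hb : P.bdry x = P.bdry x') :
    P.bdry s = P.bdry s' ∧ P.bdry t = P.bdry t' := by
  obtain ⟨k, rfl⟩ := P.bdry_eq_bdry_iff.1 hb
  obtain ⟨rfl, rfl⟩ := h.eq_of_mem (h'.shift k) hx ⟨by linarith [hx'.1], by linarith [hx'.2]⟩
  exact ⟨P.bdry_add_int_mul _ _, P.bdry_add_int_mul _ _⟩

lemma IsArc.right_unique {s t t' : ℝ} (h : G.IsArc s t) (h' : G.IsArc s t') : t = t' := by
  have hm : s < min t t' := lt_min h.1 h'.1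
  obtain ⟨x, hx, hx'⟩ := exists_between hm
  exact (h.eq_of_mem h' ⟨hx, hx'.trans_le (min_le_left _ _)⟩
    ⟨hx, hx'.trans_le (min_le_right _ _)⟩).2

lemma IsArc.left_unique {s s' t : ℝ} (h : G.IsArc s t) (h' : G.IsArc s' t) : s = s' := by
  have hm : max s s' < t := max_lt h.1 h'.1
  obtain ⟨x, hx, hx'⟩ := exists_between hm
  exact (h.eq_of_mem h' ⟨(le_max_left _ _).trans_lt hx, hx'⟩
    ⟨(le_max_right _ _).trans_lt hx, hx'⟩).1

lemma IsArc.bdry_right_unique {s t s' t' : ℝ} (h : G.IsArc s t) (h' : G.IsArc s' t')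
    (hb : P.bdry s = P.bdry s') : P.bdry t = P.bdry t' := by
  obtain ⟨k, rfl⟩ := P.bdry_eq_bdry_iff.1 hb
  rw [h.right_unique (h'.shift k), P.bdry_add_int_mul]

lemma IsArc.bdry_left_unique {s t s' t' : ℝ} (h : G.IsArc s t) (h' : G.IsArc s' t')
    (hb : P.bdry t = P.bdry t') : P.bdry s = P.bdry s' := by
  obtain ⟨k, rfl⟩ := P.bdry_eq_bdry_iff.1 hb
  rw [h.left_unique (h'.shift k), P.bdry_add_int_mul]

/-- Induction along the boundary, from node point to node point. -/
theorem arc_induction {s T : ℝ} (p : ℝ → Prop) (hs : G.IsNodePoint (P.bdry s)) (h0 : p s)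
    (hstep : ∀ u v, s ≤ u → v ≤ T → G.IsArc u v → p u → p v) {t : ℝ} (hst : s ≤ t) (htT : t ≤ T)
    (ht : G.IsNodePoint (P.bdry t)) : p t := by
  by_contra hcon
  obtain ⟨v, ⟨⟨hv1, hv2⟩, hvn, hvp⟩, hmin⟩ := Set.exists_min_image
    {v | v ∈ Icc s T ∧ G.IsNodePoint (P.bdry v) ∧ ¬ p v} id
    ((G.finite_nodeParams s T).subset fun v hv => ⟨hv.1, hv.2.1⟩)
    ⟨t, ⟨hst, htT⟩, ht, hcon⟩
  rcases hv1.lt_or_eq with h1 | rfl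
  · obtain ⟨u, hu⟩ := exists_arc_left hvn
    have hsu : s ≤ u := by
      by_contra h
      exact hu.2.2.2.2 s ⟨not_le.1 h, h1⟩ hs
    have hpu : p u := by
      by_contra h
      have := hmin u ⟨⟨hsu, hu.1.le.trans hv2⟩, hu.2.2.1, h⟩
      exact absurd hu.1 (not_lt.2 this)
    exact hvp (hstep u v hsu hv2 hu hpu)
  · exact hvp h0

end Gluing

namespace Gluing

variable {n : ℕ} {P : SimplePolygon n} {G : Gluing P}

/-! ### Degrees -/

/-- Makes the next node a function of the boundary point and a direction: parameters of the same
point differ by periods, so the choice of arc does not matter. -/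
lemma exists_nbrNode (d : Bool) (z : ℂ) : ∃ a : G.Node, ∀ s t, G.IsArc s t →
    (d = true → P.bdry s = z → P.bdry t ∈ a.1) ∧ (d = false → P.bdry t = z → P.bdry s ∈ a.1) := by
  by_cases h : ∃ s t, G.IsArc s t ∧ ((d = true ∧ P.bdry s = z) ∨ (d = false ∧ P.bdry t = z))
  · obtain ⟨s, t, h, ⟨rfl, rfl⟩ | ⟨rfl, rfl⟩⟩ := h
    · refine ⟨G.nodeAt _ h.2.2.2.1, fun s' t' h' => ⟨fun _ hb => ?_, by simp⟩⟩
      rw [h'.bdry_right_unique h hb]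
      exact G.mem_nodeAt _
    · refine ⟨G.nodeAt _ h.2.2.1, fun s' t' h' => ⟨by simp, fun _ hb => ?_⟩⟩
      rw [h'.bdry_left_unique h hb]
      exact G.mem_nodeAt _
  -- A default value for points where no arc begins or ends; node points are not among them.
  · refine ⟨G.nodeAt _ (G.isNodePoint_vertex 0), fun s t hst => ⟨fun h1 h2 => ?_, fun h1 h2 => ?_⟩⟩
    · exact absurd ⟨s, t, hst, Or.inl ⟨h1, h2⟩⟩ h
    · exact absurd ⟨s, t, hst, Or.inr ⟨h1, h2⟩⟩ h

variable (G) in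
/-- The node that follows (for `true`) or precedes (for `false`) a node point on the boundary. -/
def nbrNode (p : ℂ × Bool) : G.Node := (exists_nbrNode (G := G) p.2 p.1).choose

lemma IsArc.nbrNode_true {s t : ℝ} (h : G.IsArc s t) {c : G.Node} (hc : P.bdry t ∈ c.1) :
    G.nbrNode (P.bdry s, true) = c :=
  Node.eq_of_mem (((exists_nbrNode (G := G) true (P.bdry s)).choose_spec s t h).1 rfl rfl) hc

lemma IsArc.nbrNode_false {s t : ℝ} (h : G.IsArc s t) {c : G.Node} (hc : P.bdry s ∈ c.1) :
    G.nbrNode (P.bdry t, false) = c :=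
  Node.eq_of_mem (((exists_nbrNode (G := G) false (P.bdry t)).choose_spec s t h).2 rfl rfl) hc

/-- The boundary directions at the points of a node. -/
def Node.dirs (a : G.Node) : Finset (ℂ × Bool) := a.pts ×ˢ Finset.univ

lemma Node.mem_dirs {a : G.Node} {p : ℂ × Bool} : p ∈ a.dirs ↔ p.1 ∈ a.1 := by
  simp [Node.dirs, Node.mem_pts]

lemma Node.card_dirs (a : G.Node) : a.dirs.card = 2 * a.pts.card := by
  simp [Node.dirs, mul_comm]

-- An edge comes from an arc and also from the arc glued to it. The two leave the node in distinct
-- directions, because they have different orientations or different end points there.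
open Classical in
lemma two_le_card_fiber {a c : G.Node} (h : G.tree.Adj a c) :
    2 ≤ (a.dirs.filter fun p => G.nbrNode p = c).card := by
  obtain ⟨-, s, t, hst, hends⟩ := h
  obtain ⟨s', t', hst', hlen, hne, hglue⟩ := hst.exists_mate
  have h0 : (0 : ℝ) ∈ Icc 0 (t - s) := ⟨le_rfl, by linarith [hst.1]⟩
  have h1 : t - s ∈ Icc 0 (t - s) := ⟨by linarith [hst.1], le_rfl⟩
  have hne' : P.bdry t' ≠ P.bdry t := fun h => hne (hst'.bdry_left_unique hst h)
  have key : ∀ p q : ℂ × Bool, p ≠ q → p.1 ∈ a.1 → q.1 ∈ a.1 → G.nbrNode p = c →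
      G.nbrNode q = c → 2 ≤ (a.dirs.filter fun p => G.nbrNode p = c).card := by
    intro p q hpq hp hq hpc hqc
    refine Finset.one_lt_card.2 ⟨p, ?_, q, ?_, hpq⟩ <;>
      simp [Node.mem_dirs, *]
  rcases hglue with hg | hg
  · have g0 := hg 0 h0
    have g1 := hg _ h1
    rw [add_zero, sub_zero] at g0
    rw [add_sub_cancel, ← hlen, sub_sub_cancel] at g1
    rcases hends with ⟨hs, ht⟩ | ⟨hs, ht⟩
    · exact key (P.bdry s, true) (P.bdry t', false) (by simp) hs (a.mem_of_glued hs g0)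
        (hst.nbrNode_true ht) (hst'.nbrNode_false (c.mem_of_glued ht g1))
    · exact key (P.bdry t, false) (P.bdry s', true) (by simp) ht (a.mem_of_glued ht g1)
        (hst.nbrNode_false hs) (hst'.nbrNode_true (c.mem_of_glued hs g0))
  · have g0 := hg 0 h0
    have g1 := hg _ h1
    rw [add_zero, add_zero] at g0
    rw [add_sub_cancel, ← hlen, add_sub_cancel] at g1
    rcases hends with ⟨hs, ht⟩ | ⟨hs, ht⟩
    · exact key (P.bdry s, true) (P.bdry s', true) (by simpa using hne.symm) hs
        (a.mem_of_glued hs g0) (hst.nbrNode_true ht) (hst'.nbrNode_true (c.mem_of_glued ht g1))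
    · exact key (P.bdry t, false) (P.bdry t', false) (by simpa using hne'.symm) ht
        (a.mem_of_glued ht g1) (hst.nbrNode_false hs) (hst'.nbrNode_false (c.mem_of_glued hs g0))

open Classical in
lemma sum_card_fiber [Fintype G.Node] (a : G.Node) :
    ∑ c, (a.dirs.filter fun p => G.nbrNode p = c).card = 2 * a.pts.card := by
  rw [← a.card_dirs]
  exact (Finset.card_eq_sum_card_fiberwise fun p _ => by simp).symm

/-- Each point contributes two boundary directions, and each neighbour takes at least two of them.
-/
lemma ncard_neighborSet_le (a : G.Node) : (G.tree.neighborSet a).ncard ≤ a.pts.card := by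
  classical
  have := Fintype.ofFinite G.Node
  rw [Set.ncard_eq_toFinset_card']
  have h1 := sum_card_fiber a
  have h2 := Finset.sum_le_sum_of_subset (f := fun c =>
    (a.dirs.filter fun p => G.nbrNode p = c).card) (Finset.subset_univ (G.tree.neighborSet a).toFinset)
  have h3 := Finset.card_nsmul_le_sum (G.tree.neighborSet a).toFinset (fun c =>
    (a.dirs.filter fun p => G.nbrNode p = c).card) 2 fun c hc => two_le_card_fiber (by simpa using hc)
  rw [smul_eq_mul] at h3
  omega

/-- If the degree of a node is the number of its points, all arcs from the node lead to other nodes,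
and exactly two lead to each neighbour. -/
lemma fiber_of_ncard_eq (a : G.Node) (h : (G.tree.neighborSet a).ncard = a.pts.card) :
    (∀ p : ℂ × Bool, p.1 ∈ a.1 → G.tree.Adj a (G.nbrNode p)) ∧
    ∀ c, ∀ p q r : ℂ × Bool, p.1 ∈ a.1 → q.1 ∈ a.1 → r.1 ∈ a.1 → G.nbrNode p = c →
      G.nbrNode q = c → G.nbrNode r = c → p = q ∨ p = r ∨ q = r := by
  classical
  have := Fintype.ofFinite G.Node
  rw [Set.ncard_eq_toFinset_card'] at h
  set F : G.Node → ℕ := fun c => (a.dirs.filter fun p => G.nbrNode p = c).card with hF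
  have h1 : ∑ c, F c = 2 * a.pts.card := sum_card_fiber a
  have h2 : ∀ c, (if G.tree.Adj a c then 2 else 0) ≤ F c := by
    intro c
    split_ifs with hc
    · exact two_le_card_fiber hc
    · exact Nat.zero_le _
  have h3 : ∑ c, (if G.tree.Adj a c then 2 else 0) = 2 * a.pts.card := by
    rw [← h, Finset.sum_ite, Finset.sum_const_zero, add_zero, Finset.sum_const, smul_eq_mul, mul_comm]
    congr 2
    ext c; simp
  have h4 := (Finset.sum_eq_sum_iff_of_le fun c _ => h2 c).1 (h3.trans h1.symm)
  have h5 : ∀ p : ℂ × Bool, p.1 ∈ a.1 → G.tree.Adj a (G.nbrNode p) := by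
    intro p hp
    by_contra hcon
    have := h4 (G.nbrNode p) (Finset.mem_univ _)
    rw [if_neg hcon] at this
    have h6 := Finset.card_eq_zero.1 this.symm
    have : p ∈ (∅ : Finset (ℂ × Bool)) := by
      rw [← h6]; simp [Node.mem_dirs, hp]
    simp at this
  refine ⟨h5, ?_⟩
  intro c p q r hp hq hr hpc hqc hrc
  have h6 := h4 c (Finset.mem_univ _)
  rw [if_pos (hpc ▸ h5 p hp)] at h6
  by_contra hcon
  push Not at hcon
  have h7 : 2 < F c := Finset.two_lt_card.2 ⟨p, by simp [Node.mem_dirs, *], q,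
    by simp [Node.mem_dirs, *], r, by simp [Node.mem_dirs, *], hcon.1, hcon.2.1, hcon.2.2⟩
  omega

/-! ### Connectedness and parity -/

lemma IsArc.adj_or_eq {s t : ℝ} (h : G.IsArc s t) {a c : G.Node} (ha : P.bdry s ∈ a.1)
    (hc : P.bdry t ∈ c.1) : a = c ∨ G.tree.Adj a c := by
  by_cases hac : a = c
  · exact Or.inl hac
  · exact Or.inr ⟨hac, s, t, h, Or.inl ⟨ha, hc⟩⟩

-- The closed boundary walk visits every node, and each of its arcs stays at a node or follows an
-- edge.
variable (G) in
lemma tree_connected : G.tree.Connected := by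
  have : Nonempty G.Node := ⟨G.nodeAt _ (G.isNodePoint_vertex 0)⟩
  refine ⟨fun a c => ?_⟩
  obtain ⟨s, hs⟩ := a.exists_param
  obtain ⟨t, ht⟩ := c.exists_param
  have hL := P.perimeter_pos
  obtain ⟨k, hk⟩ := exists_nat_ge ((s - t) / P.perimeter)
  rw [div_le_iff₀ hL] at hk
  have ht' : P.bdry (t + (k : ℤ) * P.perimeter) ∈ c.1 := by rwa [P.bdry_add_int_mul]
  have hst : s ≤ t + (k : ℤ) * P.perimeter := by push_cast; linarith
  refine arc_induction (fun u => ∀ c : G.Node, P.bdry u ∈ c.1 → G.tree.Reachable a c)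
    (a.isNodePoint hs) ?_ ?_ hst le_rfl (c.isNodePoint ht') c ht'
  · intro c hc
    rw [Node.eq_of_mem hs hc]
  · intro u v _ _ huv ih c hc
    have h1 := ih _ (G.mem_nodeAt huv.2.2.1)
    rcases huv.adj_or_eq (G.mem_nodeAt huv.2.2.1) hc with h | h
    · rwa [← h]
    · exact h1.trans h.reachable

variable (G) in
/-- The arcs that start at two node points are glued to each other. -/
def ArcMate (z w : ℂ) : Prop := z ≠ w ∧ ∃ s t s' t', G.IsArc s t ∧ G.IsArc s' t' ∧ P.bdry s = z ∧
  P.bdry s' = w ∧ G.Glued (P.bdry ((s + t) / 2)) (P.bdry ((s' + t') / 2))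

lemma ArcMate.symm {z w : ℂ} (h : G.ArcMate z w) : G.ArcMate w z := by
  obtain ⟨hne, s, t, s', t', h, h', rfl, rfl, hg⟩ := h
  exact ⟨hne.symm, s', t', s, t, h', h, rfl, rfl, hg.symm⟩

/-- The midpoint of an arc is not a node point, so it has only one partner, and that partner lies
inside only one arc. -/
lemma ArcMate.unique {z w w' : ℂ} (h : G.ArcMate z w) (h' : G.ArcMate z w') : w = w' := by
  obtain ⟨hne, s, t, s₁, t₁, h, h₁, rfl, rfl, hg⟩ := h
  obtain ⟨hne', s', t', s₂, t₂, h', h₂, hz, rfl, hg'⟩ := h'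
  have mid : ∀ {s t}, G.IsArc s t → (s + t) / 2 ∈ Ioo s t := fun h =>
    ⟨by linarith [h.1], by linarith [h.1]⟩
  have e : P.bdry ((s' + t') / 2) = P.bdry ((s + t) / 2) := by
    obtain ⟨k, rfl⟩ := P.bdry_eq_bdry_iff.1 hz
    rw [h'.right_unique (h.shift k), P.bdry_eq_bdry_iff]
    exact ⟨k, by ring⟩
  rw [e] at hg'
  have := eq_of_not_isNodePoint (P.bdry_mem_boundary _) (h.2.2.2.2 _ (mid h)) hg hg'
    (fun h3 => hne (h.eq_of_bdry_eq h₁ (mid h) (mid h₁) h3).1)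
    (fun h3 => hne' (h.eq_of_bdry_eq h₂ (mid h) (mid h₂) h3).1)
  exact (h₁.eq_of_bdry_eq h₂ (mid h₁) (mid h₂) this).1

lemma exists_arcMate {z : ℂ} (hz : G.IsNodePoint z) : ∃ w, G.IsNodePoint w ∧ G.ArcMate z w := by
  obtain ⟨s, rfl⟩ := P.exists_bdry_eq hz.1
  obtain ⟨t, hst⟩ := exists_arc_right hz
  obtain ⟨s', t', hst', hlen, hne, hglue⟩ := hst.exists_mate
  refine ⟨P.bdry s', hst'.2.2.1, hne.symm, s, t, s', t', hst, hst', rfl, rfl, ?_⟩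
  have hm : (t - s) / 2 ∈ Icc 0 (t - s) := ⟨by linarith [hst.1], by linarith [hst.1]⟩
  rcases hglue with hg | hg
  · have := hg _ hm
    rw [show s + (t - s) / 2 = (s + t) / 2 by ring,
      show t' - (t - s) / 2 = (s' + t') / 2 by rw [← hlen]; ring] at this
    exact this
  · have := hg _ hm
    rw [show s + (t - s) / 2 = (s + t) / 2 by ring,
      show s' + (t - s) / 2 = (s' + t') / 2 by rw [← hlen]; ring] at this
    exact this

-- Each node point starts one arc, and passing to the glued arc is an involution without fixed
-- points.
variable (G) in
lemma even_card_nodePoints : Even G.nodePoints.card := by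
  classical
  choose! f hf1 hf2 using fun z (hz : G.IsNodePoint z) => exists_arcMate hz
  let g : Function.End G.nodePoints := fun z =>
    ⟨f z.1, mem_nodePoints.2 (hf1 z.1 (mem_nodePoints.1 z.2))⟩
  have hg : g ^ 2 ^ 1 = 1 := by
    rw [pow_one, pow_two]
    funext z
    have hz := mem_nodePoints.1 z.2
    refine Subtype.ext ?_
    change f (f z.1) = z.1
    exact (hf2 _ (hf1 _ hz)).unique (hf2 _ hz).symm
  have h := Equiv.Perm.card_fixedPoints_modEq (p := 2) hg
  have h0 : Fintype.card (Function.fixedPoints g) = 0 := by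
    rw [Fintype.card_eq_zero_iff]
    refine ⟨fun z => ?_⟩
    have h1 : f z.1.1 = z.1.1 := congrArg Subtype.val z.2
    exact (hf2 _ (mem_nodePoints.1 z.1.2)).1 h1.symm
  rw [h0, Fintype.card_coe] at h
  exact Nat.even_iff.2 h

/-! ### The Gauss-Bonnet count -/

-- Node points that are not vertices have angle `π` and do not affect the sum of angle excesses over
-- `π`, so the bound on the polygon's angle sum carries over.
variable (G) in
lemma le_sum_angleAt_nodePoints :
    ((G.nodePoints.card : ℝ) - 2) * Real.pi ≤ ∑ z ∈ G.nodePoints, P.angleAt z := by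
  classical
  have := P.neZero
  have h1 : ∑ z ∈ G.nodePoints, (P.angleAt z - Real.pi) =
      ∑ i, (P.interiorAngle i - Real.pi) := by
    rw [← Finset.sum_subset (s₁ := Finset.univ.image P.vertex), Finset.sum_image
      fun i _ j _ h => P.vertex_injective h]
    · simp only [P.angleAt_vertex]
    · intro z hz
      obtain ⟨i, -, rfl⟩ := Finset.mem_image.1 hz
      exact mem_nodePoints.2 (G.isNodePoint_vertex i)
    · intro z _ hz
      rw [P.angleAt_of_not_isVertex, sub_self]
      rintro ⟨i, rfl⟩
      exact hz (Finset.mem_image_of_mem _ (Finset.mem_univ i))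
  rw [Finset.sum_sub_distrib, Finset.sum_sub_distrib] at h1
  simp only [Finset.sum_const, nsmul_eq_mul, Finset.card_univ, ZMod.card] at h1
  have := P.le_sum_interiorAngle
  linarith

/-- The curvature at a node. -/
def Node.curv (a : G.Node) : ℝ := 2 * Real.pi - ∑ z ∈ a.pts, P.angleAt z

-- A one-sided Gauss-Bonnet formula: in the tree case, where there are two node points fewer than
-- twice the number of nodes, the bound is `4π`.
variable (G) in
lemma sum_curv_le [Fintype G.Node] : ∑ a : G.Node, a.curv ≤
    (2 * Fintype.card G.Node - G.nodePoints.card + 2 : ℝ) * Real.pi := by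
  have h := le_sum_angleAt_nodePoints G
  rw [sum_nodePoints] at h
  simp only [Node.curv, Finset.sum_sub_distrib, Finset.sum_const, nsmul_eq_mul, Finset.card_univ]
  linarith

-- A connected graph has at least `V - 1` edges, and by the handshake formula twice their number is
-- at most the number of node points. Equality forces equality in both estimates.
variable (G) in
lemma card_le [Fintype G.Node] : 2 * Fintype.card G.Node ≤ G.nodePoints.card + 2 ∧
    (2 * Fintype.card G.Node = G.nodePoints.card + 2 → G.tree.IsTree ∧
      ∀ a : G.Node, (G.tree.neighborSet a).ncard = a.pts.card) := by
  classical
  have h1 := (tree_connected G).card_vert_le_card_edgeSet_add_one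
  have h2 := G.tree.sum_degrees_eq_twice_card_edges
  have h3 : ∀ a, G.tree.degree a = (G.tree.neighborSet a).ncard := fun a => by
    rw [Set.ncard_eq_toFinset_card', ← SimpleGraph.card_neighborFinset_eq_degree,
      SimpleGraph.neighborFinset]
  have h4 : G.nodePoints.card = ∑ a : G.Node, a.pts.card := by
    simpa using sum_nodePoints (G := G) fun _ => (1 : ℕ)
  have h5 : ∑ a, G.tree.degree a ≤ ∑ a : G.Node, a.pts.card :=
    Finset.sum_le_sum fun a _ => h3 a ▸ ncard_neighborSet_le a
  rw [Nat.card_eq_fintype_card, Nat.card_eq_fintype_card, ← SimpleGraph.edgeFinset_card] at h1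
  refine ⟨by omega, fun h => ⟨?_, ?_⟩⟩
  · rw [SimpleGraph.isTree_iff_connected_and_card]
    refine ⟨tree_connected G, ?_⟩
    rw [Nat.card_eq_fintype_card, Nat.card_eq_fintype_card, ← SimpleGraph.edgeFinset_card]
    omega
  · intro a
    have h6 := (Finset.sum_eq_sum_iff_of_le fun a _ =>
      (h3 a ▸ ncard_neighborSet_le a : G.tree.degree a ≤ a.pts.card)).1 (by omega) a
        (Finset.mem_univ a)
    rw [← h3, h6]

end Gluing

namespace Gluing

variable {n : ℕ} {P : SimplePolygon n} {G : Gluing P}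

/-! ### Consequences of the angle condition -/

lemma IsAleksandrov.curv_nonneg (hG : G.IsAleksandrov) (a : G.Node) : 0 ≤ a.curv := by
  have := hG.1 a.pts (fun z hz => a.mem_boundary (Node.mem_pts.1 hz)) fun z hz w hw =>
    a.glued (Node.mem_pts.1 hz) (Node.mem_pts.1 hw)
  unfold Node.curv
  linarith

/-- Two nonvertices already use `2π`, and any third point has positive angle. So the class would be
a pair without vertices, which is not a node. -/
lemma IsAleksandrov.subsingleton_nonvertex (hG : G.IsAleksandrov) (a : G.Node) :
    {z ∈ a.1 | ¬ P.IsVertex z}.Subsingleton := by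
  classical
  rintro z ⟨hz, hzv⟩ w ⟨hw, hwv⟩
  by_contra hne
  have hpair : a.1 = {z, w} := by
    refine Subset.antisymm (fun x hx => ?_) ?_
    · by_contra hcon
      simp only [mem_insert_iff, mem_singleton_iff, not_or] at hcon
      have hsub : ({x, z, w} : Finset ℂ) ⊆ a.pts := by
        intro y hy
        simp only [Finset.mem_insert, Finset.mem_singleton] at hy
        rcases hy with rfl | rfl | rfl <;> exact Node.mem_pts.2 ‹_›
      have h1 := Finset.sum_le_sum_of_subset_of_nonneg hsub fun y _ _ => (P.angleAt_pos y).le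
      rw [Finset.sum_insert (by simp [hcon.1, hcon.2]), Finset.sum_pair hne,
        P.angleAt_of_not_isVertex hzv, P.angleAt_of_not_isVertex hwv] at h1
      have h2 := hG.curv_nonneg a
      unfold Node.curv at h2
      linarith [P.angleAt_pos x]
    · rintro y (rfl | rfl) <;> assumption
  have hn := (a.isNodePoint hz).2
  rw [← a.eq_cls hz, hpair, Set.encard_pair hne] at hn
  rcases hn with h | ⟨x, rfl | rfl, hv⟩
  · exact h rfl
  · exact hzv hv
  · exact hwv hv

lemma IsFoldLeaf.curv_eq {a : G.Node} (h : G.IsFoldLeaf a) : a.curv = Real.pi := by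
  obtain ⟨-, z, i, hz, ha⟩ := h
  have : a.pts = {z} := by ext w; rw [Node.mem_pts, ha]; simp
  rw [Node.curv, this, Finset.sum_singleton,
    P.angleAt_of_not_isVertex (P.not_isVertex_of_mem_edge hz)]
  ring

lemma deg_eq_ncard (a : G.Node) : deg G.tree a = ((G.tree.neighborSet a).ncard : ℕ∞) :=
  (Set.Finite.cast_ncard_eq (Set.toFinite _)).symm

variable (G) in
/-- The gluing tree is a tree and the degree of a node is the number of boundary points that are
glued there. -/
def TreeLike : Prop :=
  G.tree.IsTree ∧ ∀ a : G.Node, (G.tree.neighborSet a).ncard = a.pts.card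

lemma TreeLike.deg_eq (hT : G.TreeLike) (a : G.Node) : deg G.tree a = (a.pts.card : ℕ∞) := by
  rw [deg_eq_ncard, hT.2]

lemma ncard_setOf_isFoldLeaf [Fintype G.Node] [DecidablePred G.IsFoldLeaf] :
    {a | G.IsFoldLeaf a}.ncard = (Finset.univ.filter G.IsFoldLeaf).card := by
  rw [← Set.ncard_coe_finset]; simp

/-- The total curvature of the fold points. -/
lemma IsAleksandrov.foldLeaf_count [Fintype G.Node] (hG : G.IsAleksandrov) :
    {a | G.IsFoldLeaf a}.ncard + G.nodePoints.card ≤ 2 * Fintype.card G.Node + 2 := by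
  classical
  have h1 := sum_curv_le G
  have h2 := Finset.sum_le_sum_of_subset_of_nonneg (f := Node.curv)
    (Finset.subset_univ (Finset.univ.filter G.IsFoldLeaf)) fun a _ _ => hG.curv_nonneg a
  rw [Finset.sum_congr rfl fun a ha => ((Finset.mem_filter.1 ha).2 : G.IsFoldLeaf a).curv_eq,
    Finset.sum_const, nsmul_eq_mul, ← ncard_setOf_isFoldLeaf] at h2
  have h3 := le_of_mul_le_mul_right (h2.trans h1) Real.pi_pos
  have h4 : (({a | G.IsFoldLeaf a}.ncard + G.nodePoints.card : ℕ) : ℝ) ≤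
      ((2 * Fintype.card G.Node + 2 : ℕ) : ℝ) := by push_cast; linarith
  exact_mod_cast h4

lemma IsAleksandrov.ncard_foldLeaf_le (hG : G.IsAleksandrov) :
    {a | G.IsFoldLeaf a}.ncard ≤ 4 := by
  have := Fintype.ofFinite G.Node
  have h1 := hG.foldLeaf_count
  have h2 := (card_le G).1
  omega

/-- The curvature count gives `N + 1 ≤ 2V`, and connectedness gives `2V ≤ N + 2`. Since `N` is even,
the latter is an equality. -/
lemma IsAleksandrov.treeLike (hG : G.IsAleksandrov) (h : 3 ≤ {a | G.IsFoldLeaf a}.ncard) :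
    G.TreeLike := by
  have := Fintype.ofFinite G.Node
  have h1 := hG.foldLeaf_count
  have h2 := (card_le G).1
  obtain ⟨k, hk⟩ := even_card_nodePoints G
  exact (card_le G).2 (by omega)

/-- The four fold points already account for the whole of `4π`. -/
lemma IsAleksandrov.curv_eq_zero (hG : G.IsAleksandrov) (h : {a | G.IsFoldLeaf a}.ncard = 4)
    {a : G.Node} (ha : ¬ G.IsFoldLeaf a) : a.curv = 0 := by
  classical
  have := Fintype.ofFinite G.Node
  have h1 := sum_curv_le G
  have h2 := (card_le G).1
  have h3 : ((2 * Fintype.card G.Node : ℕ) : ℝ) ≤ ((G.nodePoints.card + 2 : ℕ) : ℝ) :=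
    Nat.cast_le.2 h2
  push_cast at h3
  rw [← Finset.sum_filter_add_sum_filter_not Finset.univ G.IsFoldLeaf,
    Finset.sum_congr rfl fun a ha => ((Finset.mem_filter.1 ha).2 : G.IsFoldLeaf a).curv_eq,
    Finset.sum_const, nsmul_eq_mul, ← ncard_setOf_isFoldLeaf, h] at h1
  have h4 := Finset.single_le_sum (f := Node.curv) (fun a _ => hG.curv_nonneg a)
    (Finset.mem_filter (p := fun a => ¬ G.IsFoldLeaf a).2 ⟨Finset.mem_univ a, ha⟩)
  have h5 := hG.curv_nonneg a
  push_cast at h1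
  nlinarith [Real.pi_pos]

lemma IsLeaf.ncard_eq {a : G.Node} (h : G.IsLeaf a) : (G.tree.neighborSet a).ncard = 1 := by
  have h' : deg G.tree a = 1 := h
  rw [deg_eq_ncard] at h'
  exact_mod_cast h'

/-- A leaf consists of one boundary point, whose angle is less than `2π`; so its curvature is not
zero. -/
lemma TreeLike.isFoldLeaf_of_isLeaf (hT : G.TreeLike)
    (h0 : ∀ a : G.Node, ¬ G.IsFoldLeaf a → a.curv = 0) {a : G.Node} (ha : G.IsLeaf a) :
    G.IsFoldLeaf a := by
  by_contra hcon
  have h1 : a.pts.card = 1 := by rw [← hT.2, ha.ncard_eq]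
  obtain ⟨z, hz⟩ := Finset.card_eq_one.1 h1
  have h2 := h0 a hcon
  rw [Node.curv, hz, Finset.sum_singleton] at h2
  linarith [P.angleAt_lt z]

lemma TreeLike.sum_card [Fintype G.Node] (hT : G.TreeLike) :
    ∑ a : G.Node, a.pts.card + 2 = 2 * Fintype.card G.Node := by
  classical
  have h1 := hT.1.card_edgeFinset
  have h2 := G.tree.sum_degrees_eq_twice_card_edges
  have h3 : ∀ a, G.tree.degree a = a.pts.card := fun a => by
    rw [← hT.2, Set.ncard_eq_toFinset_card', ← SimpleGraph.card_neighborFinset_eq_degree,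
      SimpleGraph.neighborFinset]
  simp only [h3] at h2
  omega

lemma TreeLike.isPlus_or_isI (hT : G.TreeLike) (h : {a | G.IsLeaf a}.ncard = 4) :
    IsPlus G.tree ∨ IsI G.tree := by
  classical
  have := Fintype.ofFinite G.Node
  set S : Finset G.Node := Finset.univ.filter fun a => 3 ≤ a.pts.card with hS
  set K : Finset G.Node := Finset.univ.filter fun a => a.pts.card = 1 with hK
  have hKc : K.card = 4 := by
    rw [← h, ← Set.ncard_coe_finset]
    congr 1
    ext a
    simp only [hK, Finset.coe_filter, Finset.mem_univ, true_and, mem_ofPred_eq]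
    change a.pts.card = 1 ↔ deg G.tree a = 1
    rw [hT.deg_eq]; norm_cast
  have hsum := hT.sum_card
  -- In a tree the degrees minus two add up to `-2`. Four leaves contribute `-4`, so the branching
  -- nodes contribute `2`: either one of degree `4` or two of degree `3`.
  have e : ∀ a : G.Node, a.pts.card + (if a.pts.card = 1 then 1 else 0) =
      2 + (if 3 ≤ a.pts.card then a.pts.card - 2 else 0) := by
    intro a
    have := a.pts_pos
    split_ifs <;> omega
  have h1 := Finset.sum_congr (rfl : (Finset.univ : Finset G.Node) = _) fun a _ => e a
  rw [Finset.sum_add_distrib, Finset.sum_add_distrib, ← Finset.sum_filter, ← Finset.sum_filter,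
    Finset.sum_const, Finset.sum_const, ← hS, ← hK, hKc, Finset.card_univ] at h1
  simp only [smul_eq_mul] at h1
  have h2 : ∑ a ∈ S, (a.pts.card - 2) = 2 := by omega
  have h3 : ∀ a ∈ S, 1 ≤ a.pts.card - 2 := fun a ha => by
    have : 3 ≤ a.pts.card := (Finset.mem_filter.1 ha).2
    omega
  have h4 := Finset.card_nsmul_le_sum S _ 1 h3
  rw [h2, smul_eq_mul, mul_one] at h4
  have hout : ∀ c, c ∉ S → deg G.tree c ≤ 2 := by
    intro c hc
    have : ¬ 3 ≤ c.pts.card := fun h => hc (Finset.mem_filter.2 ⟨Finset.mem_univ _, h⟩)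
    rw [hT.deg_eq]
    exact_mod_cast (by omega : c.pts.card ≤ 2)
  interval_cases hc : S.card
  · rw [Finset.card_eq_zero.1 hc] at h2; simp at h2
  · obtain ⟨a, ha⟩ := Finset.card_eq_one.1 hc
    rw [ha, Finset.sum_singleton] at h2
    refine Or.inl ⟨hT.1, a, ?_, fun b hb => hout b (by rw [ha]; simpa using hb)⟩
    rw [hT.deg_eq, show a.pts.card = 4 by omega]; rfl
  · obtain ⟨a, b, hab, hs⟩ := Finset.card_eq_two.1 hc
    have ha := h3 a (by rw [hs]; simp)
    have hb := h3 b (by rw [hs]; simp)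
    rw [hs, Finset.sum_pair hab] at h2
    refine Or.inr ⟨hT.1, a, b, hab, ?_, ?_, fun c hca hcb => hout c (by rw [hs]; simp [hca, hcb])⟩
    · rw [hT.deg_eq, show a.pts.card = 3 by omega]; rfl
    · rw [hT.deg_eq, show b.pts.card = 3 by omega]; rfl

end Gluing

/-- Otherwise the edge to `c` followed by a path that avoids `d`, and the edge to `c'`, would be two
different paths from `d` to `c'`. -/
lemma _root_.SimpleGraph.IsAcyclic.eq_of_walk_avoiding {V : Type*} {T : SimpleGraph V}
    (hT : T.IsAcyclic) {d c c' : V} (h : T.Adj d c) (h' : T.Adj d c') (p : T.Walk c c')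
    (hp : d ∉ p.support) : c = c' := by
  classical
  have h1 : (SimpleGraph.Walk.cons h p.bypass).IsPath :=
    (SimpleGraph.Walk.cons_isPath_iff _ _).2
      ⟨p.bypass_isPath, fun hd => hp (p.support_bypass_subset_support hd)⟩
  have h2 : (SimpleGraph.Walk.cons h' SimpleGraph.Walk.nil).IsPath :=
    (SimpleGraph.Walk.cons_isPath_iff _ _).2 ⟨SimpleGraph.Walk.IsPath.nil, by simpa using h'.ne⟩
  have h3 := congrArg (fun q : T.Path d c' => q.1.length) ((hT.subsingleton_path _ _).elim ⟨_, h1⟩ ⟨_, h2⟩)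
  simp only [SimpleGraph.Walk.length_cons, SimpleGraph.Walk.length_nil] at h3
  exact SimpleGraph.Walk.eq_of_length_eq_zero (by omega : p.bypass.length = 0)

namespace Gluing

variable {n : ℕ} {P : SimplePolygon n} {G : Gluing P}

/-! ### The boundary walks around a gluing tree -/

lemma TreeLike.adj (hT : G.TreeLike) {s t : ℝ} (h : G.IsArc s t) {a c : G.Node}
    (ha : P.bdry s ∈ a.1) (hc : P.bdry t ∈ c.1) : G.tree.Adj a c := by
  have := (fiber_of_ncard_eq a (hT.2 a)).1 (P.bdry s, true) ha
  rwa [h.nbrNode_true hc] at this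

lemma Node.exists_next (a : G.Node) {s : ℝ} (hs : P.bdry s ∈ a.1) :
    ∃ r ∈ Ioc s (s + P.perimeter), P.bdry r ∈ a.1 ∧ ∀ u ∈ Ioo s r, P.bdry u ∉ a.1 := by
  have hL := P.perimeter_pos
  obtain ⟨r, ⟨hr, hra⟩, hmin⟩ := Set.exists_min_image
    {v | v ∈ Ioc s (s + P.perimeter) ∧ P.bdry v ∈ a.1} id
    ((P.finite_bdry_preimage a.finite s (s + P.perimeter)).subset
      fun v hv => ⟨⟨hv.1.1.le, hv.1.2⟩, hv.2⟩)
    ⟨s + P.perimeter, ⟨by linarith, le_rfl⟩, by rwa [P.bdry_add_perimeter]⟩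
  refine ⟨r, hr, hra, fun u hu hua => ?_⟩
  have := hmin u ⟨⟨hu.1, hu.2.le.trans hr.2⟩, hua⟩
  exact absurd hu.2 (not_lt.2 this)

lemma IsArc.le_left_of_lt {q r t : ℝ} (h : G.IsArc q r) (ht : G.IsNodePoint (P.bdry t))
    (htr : t < r) : t ≤ q := by
  by_contra hcon
  exact h.2.2.2.2 t ⟨not_le.1 hcon, htr⟩ ht

lemma IsArc.right_le_of_lt {s t r : ℝ} (h : G.IsArc s t) (hr : G.IsNodePoint (P.bdry r))
    (hsr : s < r) : t ≤ r := by
  by_contra hcon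
  exact h.2.2.2.2 r ⟨hsr, not_le.1 hcon⟩ hr

/-- Between two consecutive visits of a node the boundary walks around one branch of the tree; the
first and the last arc of this walk are glued to each other. -/
theorem TreeLike.gap (hT : G.TreeLike) {s t r : ℝ} (h : G.IsArc s t) {d : G.Node}
    (hs : P.bdry s ∈ d.1) (hr : P.bdry r ∈ d.1) (hsr : s < r)
    (hd : ∀ u ∈ Ioo s r, P.bdry u ∉ d.1) :
    ∃ q, G.IsArc q r ∧ t ≤ q ∧ r - q = t - s ∧
      ∀ x ∈ Icc 0 (t - s), G.Glued (P.bdry (s + x)) (P.bdry (r - x)) := by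
  obtain ⟨q, hq⟩ := exists_arc_left (d.isNodePoint hr)
  set c := G.nodeAt _ h.2.2.2.1 with hc
  have hct : P.bdry t ∈ c.1 := G.mem_nodeAt _
  have hdc : G.tree.Adj d c := hT.adj h hs hct
  have htr : t < r := by
    refine lt_of_le_of_ne (h.right_le_of_lt (d.isNodePoint hr) hsr) ?_
    rintro rfl
    exact hdc.ne (Node.eq_of_mem hr hct)
  have htq : t ≤ q := hq.le_left_of_lt h.2.2.2.1 htr
  -- The boundary does not visit `d` in between, so it stays in one branch, and in a tree it leaves
  -- and re-enters `d` through the same neighbour.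
  have hqc : P.bdry q ∈ c.1 := by
    have hq' := G.mem_nodeAt hq.2.2.1
    obtain ⟨p, hp⟩ := arc_induction (G := G) (T := q)
      (fun u => ∀ e : G.Node, P.bdry u ∈ e.1 → ∃ p : G.tree.Walk c e, d ∉ p.support)
      h.2.2.2.1 (by
        intro e he
        obtain rfl := Node.eq_of_mem hct he
        exact ⟨SimpleGraph.Walk.nil, by simpa using hdc.ne⟩) (by
        intro u v htu hvq huv ih e he
        obtain ⟨p, hp⟩ := ih _ (G.mem_nodeAt huv.2.2.1)
        refine ⟨p.concat (hT.adj huv (G.mem_nodeAt huv.2.2.1) he), ?_⟩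
        rw [SimpleGraph.Walk.support_concat]
        simp only [List.mem_append, List.mem_singleton, not_or]
        refine ⟨hp, ?_⟩
        rintro rfl
        exact hd v ⟨by linarith [h.1, huv.1], by linarith [hq.1]⟩ he) htq le_rfl hq.2.2.1 _ hq'
    rw [hT.1.2.eq_of_walk_avoiding hdc (hT.adj hq hq' hr).symm p hp]
    exact hq'
  obtain ⟨s', t', hst', hlen, hne, hglue⟩ := h.exists_mate
  have h0 : (0 : ℝ) ∈ Icc 0 (t - s) := ⟨le_rfl, by linarith [h.1]⟩
  have h1 : t - s ∈ Icc 0 (t - s) := ⟨by linarith [h.1], le_rfl⟩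
  -- Only two boundary directions lead from `d` to `c`: the start of the first arc and the end of
  -- the last. So the arc glued to the first one must be the last one.
  have hfib := (fiber_of_ncard_eq d (hT.2 d)).2 c (P.bdry s, true) (P.bdry r, false)
  rcases hglue with hg | hg
  · have g0 := hg 0 h0
    have g1 := hg _ h1
    rw [add_zero, sub_zero] at g0
    rw [add_sub_cancel, ← hlen, sub_sub_cancel] at g1
    have := hfib (P.bdry t', false) hs hr (d.mem_of_glued hs g0) (h.nbrNode_true hct)
      (hq.nbrNode_false hqc) (hst'.nbrNode_false (c.mem_of_glued hct g1))
    simp only [Prod.mk.injEq, Bool.true_eq_false, and_false, and_true, false_or] at this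
    obtain ⟨k, hk⟩ := P.bdry_eq_bdry_iff.1 this
    have hsh := hst'.shift k
    rw [← hk] at hsh
    have hqs := hq.left_unique hsh
    refine ⟨q, hq, htq, by linarith, fun x hx => ?_⟩
    have e : P.bdry (r - x) = P.bdry (t' - x) := by
      rw [hk, P.bdry_eq_bdry_iff]; exact ⟨k, by ring⟩
    rw [e]; exact hg x hx
  · have g0 := hg 0 h0
    have g1 := hg _ h1
    rw [add_zero, add_zero] at g0
    rw [add_sub_cancel, ← hlen, add_sub_cancel] at g1
    have := hfib (P.bdry s', true) hs hr (d.mem_of_glued hs g0) (h.nbrNode_true hct)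
      (hq.nbrNode_false hqc) (hst'.nbrNode_true (c.mem_of_glued hct g1))
    simp only [Prod.mk.injEq, Bool.true_eq_false, Bool.false_eq_true, and_false, and_true,
      or_false, false_or] at this
    exact absurd this.symm hne

lemma TreeLike.exists_arc_of_adj (hT : G.TreeLike) {d c : G.Node} (h : G.tree.Adj d c) :
    ∃ s t, G.IsArc s t ∧ P.bdry s ∈ d.1 ∧ P.bdry t ∈ c.1 := by
  obtain ⟨-, s, t, hst, ⟨hs, ht⟩ | ⟨hs, ht⟩⟩ := h
  · exact ⟨s, t, hst, hs, ht⟩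
  -- The given arc leads from `c` to `d`; the walk around this branch of `c` ends with the arc in
  -- the other direction.
  · obtain ⟨r, hr, hrc, hn⟩ := c.exists_next hs
    obtain ⟨q, hq, -, hlen, hg⟩ := hT.gap hst hs hrc hr.1 hn
    have := hg (t - s) ⟨by linarith [hst.1], le_rfl⟩
    rw [add_sub_cancel, ← hlen, sub_sub_cancel] at this
    exact ⟨q, r, hq, d.mem_of_glued ht this, hrc⟩

/-- The boundary walk around the branch of a node that starts with a given neighbour. -/
lemma TreeLike.exists_gap (hT : G.TreeLike) {d c : G.Node} (h : G.tree.Adj d c) (u : ℝ) :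
    ∃ s t q r, s ∈ Ico u (u + P.perimeter) ∧ G.IsArc s t ∧ G.IsArc q r ∧ t ≤ q ∧
      P.bdry s ∈ d.1 ∧ P.bdry t ∈ c.1 ∧ P.bdry q ∈ c.1 ∧ P.bdry r ∈ d.1 ∧
      r ≤ s + P.perimeter ∧ ∀ v ∈ Ioo s r, P.bdry v ∉ d.1 := by
  obtain ⟨s₀, t₀, hst₀, hs₀, ht₀⟩ := hT.exists_arc_of_adj h
  have hL := P.perimeter_pos
  obtain ⟨k, hk⟩ : ∃ k : ℤ, s₀ + k * P.perimeter ∈ Ico u (u + P.perimeter) := by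
    refine ⟨-toIcoDiv hL u s₀, ?_⟩
    have h1 := toIcoMod_mem_Ico hL u s₀
    have h2 := toIcoMod_add_toIcoDiv_zsmul hL u s₀
    rw [zsmul_eq_mul] at h2
    have : s₀ + ((-toIcoDiv hL u s₀ : ℤ) : ℝ) * P.perimeter = toIcoMod hL u s₀ := by
      push_cast; linarith
    rwa [this]
  have hst := hst₀.shift k
  have hs : P.bdry (s₀ + k * P.perimeter) ∈ d.1 := by rwa [P.bdry_add_int_mul]
  have ht : P.bdry (t₀ + k * P.perimeter) ∈ c.1 := by rwa [P.bdry_add_int_mul]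
  obtain ⟨r, hr, hrd, hn⟩ := d.exists_next hs
  obtain ⟨q, hq, htq, hlen, hg⟩ := hT.gap hst hs hrd hr.1 hn
  have := hg _ ⟨(sub_pos.2 hst.1).le, le_rfl⟩
  rw [add_sub_cancel, ← hlen, sub_sub_cancel] at this
  exact ⟨_, _, q, r, hk, hst, hq, htq, hs, ht, c.mem_of_glued ht this, hrd, hr.2, hn⟩

end Gluing

open MeasureTheory

namespace SimplePolygon

variable {n : ℕ} (P : SimplePolygon n) (B : Set ℂ)

/-! ### The length of a part of the boundary -/

/-- The length of the part of `B` between two boundary parameters. -/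
def lengthIn (s t : ℝ) : ℝ := volume.real ({u | P.bdry u ∈ B} ∩ Ioc s t)

/-- The signed length of the part of `B` between `bdry 0` and `bdry u`. -/
def cumLengthIn (u : ℝ) : ℝ := P.lengthIn B 0 u - P.lengthIn B u 0

lemma inter_Ioc_ne_top (A : Set ℝ) (s t : ℝ) : volume (A ∩ Ioc s t) ≠ ⊤ :=
  ne_top_of_le_ne_top measure_Ioc_lt_top.ne (measure_mono inter_subset_right)

lemma lengthIn_nonneg (s t : ℝ) : 0 ≤ P.lengthIn B s t := measureReal_nonneg

lemma lengthIn_of_le {s t : ℝ} (h : t ≤ s) : P.lengthIn B s t = 0 := by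
  simp [lengthIn, Ioc_eq_empty (not_lt.2 h)]

lemma lengthIn_add {s t u : ℝ} (hst : s ≤ t) (htu : t ≤ u) :
    P.lengthIn B s t + P.lengthIn B t u = P.lengthIn B s u := by
  unfold lengthIn
  -- Only the interval used for cutting has to be measurable, so `B` may be arbitrary.
  have h := measure_inter_add_sdiff (μ := volume) ({u | P.bdry u ∈ B} ∩ Ioc s u)
    (measurableSet_Ioc (a := s) (b := t))
  have e1 : {u | P.bdry u ∈ B} ∩ Ioc s u ∩ Ioc s t = {u | P.bdry u ∈ B} ∩ Ioc s t := by
    rw [inter_assoc, inter_eq_right.2 (Ioc_subset_Ioc_right htu)]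
  have e2 : ({u | P.bdry u ∈ B} ∩ Ioc s u) \ Ioc s t = {u | P.bdry u ∈ B} ∩ Ioc t u := by
    rw [inter_sdiff_assoc]
    congr 1
    ext x
    simp only [mem_sdiff, mem_Ioc]
    constructor
    · rintro ⟨⟨h1, h2⟩, h3⟩
      exact ⟨not_le.1 fun h => h3 ⟨h1, h⟩, h2⟩
    · rintro ⟨h1, h2⟩
      exact ⟨⟨by linarith, h2⟩, fun h => absurd h1 (not_lt.2 h.2)⟩
  rw [e1, e2] at h
  rw [measureReal_def, measureReal_def, measureReal_def, ← h,
    ENNReal.toReal_add (inter_Ioc_ne_top _ _ _) (inter_Ioc_ne_top _ _ _)]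

lemma cumLengthIn_sub {s t : ℝ} (h : s ≤ t) :
    P.cumLengthIn B t - P.cumLengthIn B s = P.lengthIn B s t := by
  unfold cumLengthIn
  rcases le_total 0 s with hs | hs
  · rw [P.lengthIn_of_le B hs, P.lengthIn_of_le B (hs.trans h)]
    linarith [P.lengthIn_add B hs h]
  · rw [P.lengthIn_of_le B hs]
    rcases le_total 0 t with ht | ht
    · rw [P.lengthIn_of_le B ht]
      linarith [P.lengthIn_add B hs ht]
    · rw [P.lengthIn_of_le B ht]
      linarith [P.lengthIn_add B h ht]

lemma cumLengthIn_mono : Monotone (P.cumLengthIn B) := fun s t h => by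
  linarith [P.cumLengthIn_sub B h, P.lengthIn_nonneg B s t]

lemma lengthIn_eq_of_subset {s t : ℝ} (hst : s ≤ t) (h : ∀ u ∈ Ioo s t, P.bdry u ∈ B) :
    P.lengthIn B s t = t - s := by
  unfold lengthIn
  have h1 : volume.real (Ioo s t) ≤ volume.real ({u | P.bdry u ∈ B} ∩ Ioc s t) :=
    measureReal_mono (fun u hu => ⟨h u hu, hu.1, hu.2.le⟩) (inter_Ioc_ne_top _ _ _)
  have h2 : volume.real ({u | P.bdry u ∈ B} ∩ Ioc s t) ≤ volume.real (Ioc s t) :=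
    measureReal_mono inter_subset_right measure_Ioc_lt_top.ne
  rw [Real.volume_real_Ioo_of_le hst] at h1
  rw [Real.volume_real_Ioc_of_le hst] at h2
  exact le_antisymm h2 h1

lemma lengthIn_add_perimeter (s t : ℝ) :
    P.lengthIn B (s + P.perimeter) (t + P.perimeter) = P.lengthIn B s t := by
  unfold lengthIn
  rw [measureReal_def, measureReal_def,
    ← measure_preimage_add_right volume P.perimeter ({u | P.bdry u ∈ B} ∩ _)]
  congr 2
  ext u
  simp [P.bdry_add_perimeter]

/-- The total length of `B`. -/
def totalLengthIn : ℝ := P.lengthIn B 0 P.perimeter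

lemma cumLengthIn_add_perimeter (u : ℝ) :
    P.cumLengthIn B (u + P.perimeter) = P.cumLengthIn B u + P.totalLengthIn B := by
  have key : ∀ s t, s ≤ t → P.cumLengthIn B (t + P.perimeter) - P.cumLengthIn B t =
      P.cumLengthIn B (s + P.perimeter) - P.cumLengthIn B s := fun s t h => by
    have h1 := P.cumLengthIn_sub B h
    have h2 := P.cumLengthIn_sub B (show s + P.perimeter ≤ t + P.perimeter by linarith)
    rw [lengthIn_add_perimeter] at h2
    linarith
  have h0 : P.cumLengthIn B (0 + P.perimeter) - P.cumLengthIn B 0 = P.totalLengthIn B := by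
    rw [zero_add, P.cumLengthIn_sub B P.perimeter_pos.le, totalLengthIn]
  rcases le_total 0 u with h | h
  · linarith [key 0 u h]
  · linarith [key u 0 h]

lemma cumLengthIn_add_int_mul (u : ℝ) (k : ℤ) :
    P.cumLengthIn B (u + k * P.perimeter) = P.cumLengthIn B u + k * P.totalLengthIn B := by
  induction k with
  | zero => simp
  | succ k ih =>
    rw [show u + (((k : ℤ) + 1 : ℤ) : ℝ) * P.perimeter = u + ((k : ℤ) : ℝ) * P.perimeter + P.perimeter by
      push_cast; ring, cumLengthIn_add_perimeter, ih]
    push_cast; ring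
  | pred k ih =>
    have h := P.cumLengthIn_add_perimeter B (u + ((-(k : ℤ) - 1 : ℤ) : ℝ) * P.perimeter)
    rw [show u + ((-(k : ℤ) - 1 : ℤ) : ℝ) * P.perimeter + P.perimeter =
      u + ((-(k : ℤ) : ℤ) : ℝ) * P.perimeter by push_cast; ring, ih] at h
    push_cast at h ⊢
    linarith

lemma volume_setOf_add {r s : ℝ} :
    volume {u | u ∈ Icc 0 s ∧ P.bdry (r + u) ∈ B} =
      volume ({u | P.bdry u ∈ B} ∩ Ioc r (r + s)) := by
  rw [← measure_preimage_add volume r ({u | P.bdry u ∈ B} ∩ _)]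
  have : (fun u => r + u) ⁻¹' ({u | P.bdry u ∈ B} ∩ Ioc r (r + s)) =
      {u | P.bdry (r + u) ∈ B} ∩ Ioc 0 s := by
    ext u; simp
  rw [this]
  have : {u | u ∈ Icc 0 s ∧ P.bdry (r + u) ∈ B} = {u | P.bdry (r + u) ∈ B} ∩ Icc 0 s := by
    ext u; simp [and_comm]
  rw [this]
  exact measure_congr ((ae_eq_refl _).inter Ioc_ae_eq_Icc.symm)

lemma volume_setOf_sub {r t : ℝ} :
    volume {u | u ∈ Icc 0 t ∧ P.bdry (r - u) ∈ B} =
      volume ({u | P.bdry u ∈ B} ∩ Ioc (r - t) r) := by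
  rw [← measure_preimage_add volume r ({u | P.bdry u ∈ B} ∩ _), 
    ← Measure.measure_preimage_neg volume (_ ⁻¹' ({u | P.bdry u ∈ B} ∩ _))]
  have : Neg.neg ⁻¹' ((fun u => r + u) ⁻¹' ({u | P.bdry u ∈ B} ∩ Ioc (r - t) r)) =
      {u | P.bdry (r - u) ∈ B} ∩ Ico 0 t := by
    ext u
    simp only [mem_preimage, mem_inter_iff, mem_ofPred_eq, mem_Ioc, mem_Ico, ← sub_eq_add_neg]
    constructor
    · rintro ⟨h, h1, h2⟩; exact ⟨h, by linarith, by linarith⟩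
    · rintro ⟨h, h1, h2⟩; exact ⟨h, by linarith, by linarith⟩
  rw [this]
  have : {u | u ∈ Icc 0 t ∧ P.bdry (r - u) ∈ B} = {u | P.bdry (r - u) ∈ B} ∩ Icc 0 t := by
    ext u; simp [and_comm]
  rw [this]
  exact measure_congr ((ae_eq_refl _).inter Ico_ae_eq_Icc.symm)

end SimplePolygon

namespace Gluing

variable {n : ℕ} {P : SimplePolygon n} {G : Gluing P}

/-- In a folded belt, two points are glued only if they are at the same place of the belt or at
places that are symmetric with respect to the fold. -/
lemma IsBeltFoldedAt.glued {B : Set ℂ} {r : ℝ} {G' : Gluing P} (h : G.IsBeltFoldedAt B r G')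
    {u v : ℝ} (hu : P.bdry u ∈ B) (hg : G'.Glued (P.bdry u) (P.bdry v)) :
    ∃ k : ℤ, P.cumLengthIn B u - P.cumLengthIn B v = k * P.totalLengthIn B ∨
      P.cumLengthIn B u + P.cumLengthIn B v =
        2 * P.cumLengthIn B r + k * P.totalLengthIn B := by
  set F := P.cumLengthIn B
  set M := P.totalLengthIn B
  -- The values of `F` modulo `M` are places on the closed belt. Being at the same place or at
  -- mirror images about `r` is stable under composition, so the invariant survives the generated
  -- equivalence.
  let E : ℂ → ℂ → Prop := fun z w => z = w ∨ (z ∉ B ∧ w ∉ B) ∨ (z ∈ B ∧ w ∈ B ∧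
    ∃ u v, P.bdry u = z ∧ P.bdry v = w ∧
      ∃ k : ℤ, F u - F v = k * M ∨ F u + F v = 2 * F r + k * M)
  have hsh : ∀ u v, P.bdry u = P.bdry v → ∃ j : ℤ, F u = F v + j * M := by
    intro u v huv
    obtain ⟨j, rfl⟩ := P.bdry_eq_bdry_iff.1 huv
    exact ⟨j, P.cumLengthIn_add_int_mul B v j⟩
  have hE : ∀ z w, G'.Glued z w → E z w := by
    intro z w hzw
    have hzw' : G'.setoid z w := hzw
    rw [h] at hzw'
    change Relation.EqvGen _ z w at hzw'
    clear hzw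
    induction hzw' with
    | rel z w hzw =>
      rcases hzw with ⟨h1, h2, -⟩ | ⟨h1, h2, s, hs, t, ht, rfl, rfl, hvol⟩
      · exact Or.inr (Or.inl ⟨h1, h2⟩)
      · refine Or.inr (Or.inr ⟨h1, h2, _, _, rfl, rfl, 0, Or.inr ?_⟩)
        rw [P.volume_setOf_add, P.volume_setOf_sub] at hvol
        have e1 := P.cumLengthIn_sub B (show r ≤ r + s by linarith [hs.1])
        have e2 := P.cumLengthIn_sub B (show r - t ≤ r by linarith [ht.1])
        unfold SimplePolygon.lengthIn at e1 e2
        rw [measureReal_def] at e1 e2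
        rw [hvol] at e1
        simp only [Int.cast_zero, zero_mul, add_zero]
        linarith
    | refl z => exact Or.inl rfl
    | symm z w _ ih =>
      rcases ih with rfl | ⟨h1, h2⟩ | ⟨h1, h2, u, v, hu, hv, k, hk | hk⟩
      · exact Or.inl rfl
      · exact Or.inr (Or.inl ⟨h2, h1⟩)
      · exact Or.inr (Or.inr ⟨h2, h1, v, u, hv, hu, -k, Or.inl (by push_cast; linarith)⟩)
      · exact Or.inr (Or.inr ⟨h2, h1, v, u, hv, hu, k, Or.inr (by linarith)⟩)
    | trans x y z _ _ ih1 ih2 =>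
      rcases ih1 with rfl | ⟨h1, h2⟩ | ⟨h1, h2, u, v, hu, hv, k, hk⟩
      · exact ih2
      · rcases ih2 with rfl | ⟨h3, h4⟩ | ⟨h3, -⟩
        · exact Or.inr (Or.inl ⟨h1, h2⟩)
        · exact Or.inr (Or.inl ⟨h1, h4⟩)
        · exact absurd h3 h2
      · rcases ih2 with rfl | ⟨h3, h4⟩ | ⟨h3, h4, v', w, hv', hw, l, hl⟩
        · exact Or.inr (Or.inr ⟨h1, h2, u, v, hu, hv, k, hk⟩)
        · exact absurd h2 h3
        · obtain ⟨j, hj⟩ := hsh v' v (hv'.trans hv.symm)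
          refine Or.inr (Or.inr ⟨h1, h4, u, w, hu, hw, ?_⟩)
          rcases hk with hk | hk <;> rcases hl with hl | hl
          · exact ⟨k + l - j, Or.inl (by push_cast; linarith)⟩
          · exact ⟨k + l - j, Or.inr (by push_cast; linarith)⟩
          · exact ⟨k - l + j, Or.inr (by push_cast; linarith)⟩
          · exact ⟨k - l + j, Or.inl (by push_cast; linarith)⟩
  rcases hE _ _ hg with h1 | ⟨h1, -⟩ | ⟨-, -, u', v', hu', hv', k, hk⟩
  · obtain ⟨j, hj⟩ := hsh u v h1
    exact ⟨j, Or.inl (by linarith)⟩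
  · exact absurd hu h1
  · obtain ⟨i, hi⟩ := hsh u u' hu'.symm
    obtain ⟨j, hj⟩ := hsh v v' hv'.symm
    rcases hk with hk | hk
    · exact ⟨k + i - j, Or.inl (by push_cast; linarith)⟩
    · exact ⟨k + i + j, Or.inr (by push_cast; linarith)⟩

/-- A path of the gluing tree has *aligned vertices* if any two vertices glued together at a node of the
path are at the same place of the belt. -/
def AlignedVertices {a b : G.Node} (W : G.tree.Walk a b) : Prop :=
  ∀ d ∈ W.support, ∀ u v, P.bdry u ∈ d.1 → P.bdry v ∈ d.1 → P.IsVertex (P.bdry u) →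
    P.IsVertex (P.bdry v) → ∃ k : ℤ, P.cumLengthIn (G.pathPoints W) u -
      P.cumLengthIn (G.pathPoints W) v = k * P.totalLengthIn (G.pathPoints W)

/-- Rolling the belt to a generic position shows that its vertices are aligned. -/
lemma alignedVertices_of_rolling {a b : G.Node} (W : G.tree.Walk a b) {α β : ℝ} (hαβ : α < β)
    (h : ∀ r ∈ Ioo α β, P.bdry r ∈ G.pathPoints W ∧
      ∃ G' : Gluing P, G.IsBeltFoldedAt (G.pathPoints W) r G' ∧ SameTree G G') :
    AlignedVertices W := by
  set B := G.pathPoints W with hB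
  set F := P.cumLengthIn B with hF
  set M := P.totalLengthIn B with hM
  have hFinj : ∀ r ∈ Ioo α β, ∀ r' ∈ Ioo α β, F r = F r' → r = r' := by
    have : ∀ r ∈ Ioo α β, ∀ r' ∈ Ioo α β, r < r' → F r < F r' := by
      intro r hr r' hr' hlt
      have h1 := P.cumLengthIn_sub B hlt.le
      rw [P.lengthIn_eq_of_subset B hlt.le fun u hu =>
        (h u ⟨hr.1.trans hu.1, hu.2.trans hr'.2⟩).1] at h1
      linarith
    intro r hr r' hr' he
    rcases lt_trichotomy r r' with hlt | heq | hlt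
    · exact absurd he (this r hr r' hr' hlt).ne
    · exact heq
    · exact absurd he (this r' hr' r hr hlt).ne'
  intro d hd u v hu hv ⟨i, hi⟩ ⟨j, hj⟩
  -- Each period admits at most one fold point that makes `u` and `v` mirror images; a point off
  -- this countable set is generic.
  have hcount : (⋃ k : ℤ, {r | r ∈ Ioo α β ∧ F u + F v = 2 * F r + k * M}).Countable := by
    refine countable_iUnion fun k => Set.Subsingleton.countable ?_
    rintro r ⟨hr, he⟩ r' ⟨hr', he'⟩
    exact hFinj r hr r' hr' (by linarith)
  obtain ⟨r, hr, hrI⟩ := (hcount.dense_compl ℝ).exists_mem_open isOpen_Ioo (nonempty_Ioo.2 hαβ)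
  obtain ⟨-, G', hfold, φ, hφ⟩ := h r hrI
  -- Labels name the vertices at a node, so the isomorphism of labelled trees keeps these vertices
  -- glued together.
  have hui : P.bdry u ∈ (φ d).1 := by
    have : (Sum.inl i : ZMod n ⊕ ZMod n) ∈ G'.label (φ d) := by
      rw [hφ]; exact Or.inl ⟨i, rfl, hi ▸ hu⟩
    rcases this with ⟨i', he, h'⟩ | ⟨i', he, -⟩
    · rw [← hi, Sum.inl.inj he]; exact h'
    · exact absurd he (by simp)
  have hvi : P.bdry v ∈ (φ d).1 := by
    have : (Sum.inl j : ZMod n ⊕ ZMod n) ∈ G'.label (φ d) := by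
      rw [hφ]; exact Or.inl ⟨j, rfl, hj ▸ hv⟩
    rcases this with ⟨i', he, h'⟩ | ⟨i', he, -⟩
    · rw [← hj, Sum.inl.inj he]; exact h'
    · exact absurd he (by simp)
  obtain ⟨k, hk | hk⟩ := hfold.glued (Or.inl ⟨d, hd, hu⟩) ((φ d).glued hui hvi)
  · exact ⟨k, hk⟩
  · exact (hr (mem_iUnion.2 ⟨k, hrI, hk⟩)).elim

end Gluing

namespace Gluing

variable {n : ℕ} {P : SimplePolygon n} {G : Gluing P}

/-! ### The course of a rolling belt -/

/-- A path between two fold points whose vertices are aligned. -/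
structure IsBelt {a b : G.Node} (W : G.tree.Walk a b) : Prop where
  isPath : W.IsPath
  ne : a ≠ b
  left : G.IsFoldLeaf a
  right : G.IsFoldLeaf b
  aligned : AlignedVertices W

lemma IsRollingBelt.exists_isBelt {a b : G.Node} (h : G.IsRollingBelt a b) :
    ∃ W : G.tree.Walk a b, IsBelt W := by
  obtain ⟨hne, ha, hb, W, hW, i, -, α, β, hαβ, h⟩ := h
  refine ⟨W, hW, hne, ha, hb, alignedVertices_of_rolling W hαβ fun r hr => ?_⟩
  obtain ⟨-, h1, G', h2, -, h3⟩ := h r hr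
  exact ⟨h1, G', h2, h3⟩

lemma pathPoints_reverse {a b : G.Node} (W : G.tree.Walk a b) :
    G.pathPoints W.reverse = G.pathPoints W := by
  simp [pathPoints]

lemma IsBelt.reverse {a b : G.Node} {W : G.tree.Walk a b} (h : IsBelt W) : IsBelt W.reverse where
  isPath := h.isPath.reverse
  ne := h.ne.symm
  left := h.right
  right := h.left
  aligned := by
    intro d hd u v
    rw [pathPoints_reverse]
    exact h.aligned d (by simpa using hd) u v

variable (G) in
/-- At the node `d` there is a nonvertex whose two arcs lead to `c` and `e`. -/
def Turn (d c e : G.Node) : Prop := ∃ z ∈ d.1, ¬ P.IsVertex z ∧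
  ((G.nbrNode (z, true) = c ∧ G.nbrNode (z, false) = e) ∨
    (G.nbrNode (z, true) = e ∧ G.nbrNode (z, false) = c))

lemma arc_length_in_path {a b : G.Node} (W : G.tree.Walk a b) {c d : G.Node}
    (h : s(c, d) ∈ W.edges) {s t : ℝ} (hst : G.IsArc s t) (hs : P.bdry s ∈ c.1)
    (ht : P.bdry t ∈ d.1) :
    P.cumLengthIn (G.pathPoints W) s < P.cumLengthIn (G.pathPoints W) t := by
  have h1 := P.cumLengthIn_sub (G.pathPoints W) hst.1.le
  rw [P.lengthIn_eq_of_subset (G.pathPoints W) hst.1.le fun u hu =>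
    Or.inr ⟨s, t, u, hst, hu, rfl, c, d, h, hs, ht⟩] at h1
  linarith [hst.1]

/-- The boundary walks around the branch of `c` from `x` to `y` and around that of `e` from `x'` to
`y'`, in the cyclic order `x < y ≤ x' < y'`. The place on the belt strictly increases during both
walks, so alignment forbids a vertex at `y` or `x'` together with a vertex at `y'` or `x`. Hence `y`
and `x'`, or `y'` and `x`, are both nonvertices, and these coincide because a node has only one. -/
lemma turn_of_aligned (hG : G.IsAleksandrov) (hT : G.TreeLike) {a b : G.Node}
    {W : G.tree.Walk a b} (hW : AlignedVertices W) {c d e : G.Node} (hd : d ∈ W.support)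
    (hc : s(d, c) ∈ W.edges) (he : s(d, e) ∈ W.edges) (hce : c ≠ e) : G.Turn d c e := by
  set F := P.cumLengthIn (G.pathPoints W) with hF
  set M := P.totalLengthIn (G.pathPoints W) with hM
  have hmono : Monotone F := P.cumLengthIn_mono _
  have hdc : G.tree.Adj d c := W.adj_of_mem_edges hc
  have hde : G.tree.Adj d e := W.adj_of_mem_edges he
  obtain ⟨x, tx, qx, y, -, hx, hy, htq, hxd, htxc, hqxc, hyd, hyL, hxy⟩ := hT.exists_gap hdc 0
  obtain ⟨x', tx', qx', y', hx'm, hx', hy', htq', hxd', htxe', hqxe', hyd', hyL', hxy'⟩ :=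
    hT.exists_gap hde x
  have hxx' : x < x' := by
    refine lt_of_le_of_ne hx'm.1 ?_
    rintro rfl
    rw [← hx.right_unique hx'] at htxe'
    exact hce (Node.eq_of_mem htxc htxe')
  have hyx' : y ≤ x' := by
    by_contra hcon
    exact hxy x' ⟨hxx', not_le.1 hcon⟩ hxd'
  have hxLd : P.bdry (x + P.perimeter) ∈ d.1 := by rwa [P.bdry_add_perimeter]
  have hy'L : y' ≤ x + P.perimeter := by
    by_contra hcon
    exact hxy' (x + P.perimeter) ⟨hx'm.2, not_le.1 hcon⟩ hxLd
  have hF1 : F x < F y := (arc_length_in_path W hc hx hxd htxc).trans_le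
    (hmono (htq.trans hy.1.le))
  have hF2 : F y ≤ F x' := hmono hyx'
  have hF3 : F x' < F y' := (arc_length_in_path W he hx' hxd' htxe').trans_le
    (hmono (htq'.trans hy'.1.le))
  have hF4 : F y' ≤ F x + M := by
    rw [← P.cumLengthIn_add_perimeter]; exact hmono hy'L
  have hno : ∀ u v, P.bdry u ∈ d.1 → P.bdry v ∈ d.1 → 0 < F u - F v → F u - F v < M →
      P.IsVertex (P.bdry u) → ¬ P.IsVertex (P.bdry v) := by
    intro u v hu hv h0 h1 hvu hvv
    obtain ⟨k, hk⟩ := hW d hd u v hu hv hvu hvv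
    change F u - F v = k * M at hk
    rw [hk] at h0 h1
    have hM0 : 0 < M := by linarith
    have h2 : (0 : ℝ) < k := by
      by_contra hcon
      nlinarith
    have h3 : (k : ℝ) < 1 := by
      by_contra hcon
      nlinarith
    have h4 : 0 < k := by exact_mod_cast h2
    have h5 : k < 1 := by exact_mod_cast h3
    omega
  have hsub := hG.subsingleton_nonvertex d
  have caseB : ¬ P.IsVertex (P.bdry y') → ¬ P.IsVertex (P.bdry x) → G.Turn d c e := by
    intro h1 h2
    have e1 : P.bdry y' = P.bdry x := hsub ⟨hyd', h1⟩ ⟨hxd, h2⟩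
    refine ⟨P.bdry x, hxd, h2, Or.inl ⟨hx.nbrNode_true htxc, ?_⟩⟩
    rw [← e1]; exact hy'.nbrNode_false hqxe'
  by_cases hv1 : P.IsVertex (P.bdry y)
  · refine caseB (fun h => ?_) fun h => ?_
    · exact hno y' y hyd' hyd (by linarith) (by linarith) h hv1
    · exact hno y x hyd hxd (by linarith) (by linarith) hv1 h
  · by_cases hv2 : P.IsVertex (P.bdry x')
    · refine caseB (fun h => ?_) fun h => ?_
      · exact hno y' x' hyd' hxd' (by linarith) (by linarith) h hv2
      · exact hno x' x hxd' hxd (by linarith) (by linarith) hv2 h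
    · have e1 : P.bdry y = P.bdry x' := hsub ⟨hyd, hv1⟩ ⟨hxd', hv2⟩
      refine ⟨P.bdry y, hyd, hv1, Or.inr ⟨?_, hy.nbrNode_false hqxc⟩⟩
      rw [e1]; exact hx'.nbrNode_true htxe'

lemma Turn.eq_or (hG : G.IsAleksandrov) {d c e c' e' : G.Node} (h : G.Turn d c e)
    (h' : G.Turn d c' e') : (c = c' ∧ e = e') ∨ (c = e' ∧ e = c') := by
  obtain ⟨z, h1, h2, h3⟩ := h
  obtain ⟨w, h1', h2', h3'⟩ := h'
  obtain rfl := hG.subsingleton_nonvertex d ⟨h1, h2⟩ ⟨h1', h2'⟩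
  rcases h3 with ⟨rfl, rfl⟩ | ⟨rfl, rfl⟩ <;> rcases h3' with ⟨h4, h5⟩ | ⟨h4, h5⟩ <;> simp [h4, h5]

lemma Turn.unique (hG : G.IsAleksandrov) {d c e e' : G.Node} (h : G.Turn d c e)
    (h' : G.Turn d c e') : e = e' := by
  rcases h.eq_or hG h' with ⟨-, h⟩ | ⟨h1, h2⟩
  · exact h
  · exact h2.trans h1

lemma IsLeaf.eq_of_adj {d c e : G.Node} (h : G.IsLeaf d) (hc : G.tree.Adj d c)
    (he : G.tree.Adj d e) : c = e := by
  obtain ⟨x, hx⟩ := Set.ncard_eq_one.1 h.ncard_eq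
  have h1 : c ∈ G.tree.neighborSet d := hc
  have h2 : e ∈ G.tree.neighborSet d := he
  rw [hx] at h1 h2
  exact h1.trans h2.symm

section

variable {a b : G.Node} {W : G.tree.Walk a b}

lemma IsBelt.length_pos (h : IsBelt W) : 0 < W.length :=
  Nat.pos_of_ne_zero fun h0 => h.ne (SimpleGraph.Walk.eq_of_length_eq_zero h0)

lemma IsBelt.getVert_ne (h : IsBelt W) {i : ℕ} (hi : i + 2 ≤ W.length) :
    W.getVert i ≠ W.getVert (i + 2) := by
  intro he
  have := h.isPath.getVert_injOn (by simp; omega) (by simp; omega) he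
  omega

lemma IsBelt.turn (hG : G.IsAleksandrov) (hT : G.TreeLike) (h : IsBelt W) {i : ℕ}
    (hi : i + 2 ≤ W.length) :
    G.Turn (W.getVert (i + 1)) (W.getVert i) (W.getVert (i + 2)) := by
  refine turn_of_aligned hG hT h.aligned (W.getVert_mem_support _) ?_ ?_ (h.getVert_ne hi)
  · rw [SimpleGraph.Walk.mk_mem_edges_iff_exists]
    exact ⟨i, by omega, Sym2.eq_swap⟩
  · rw [SimpleGraph.Walk.mk_mem_edges_iff_exists]
    exact ⟨i + 1, by omega, rfl⟩

lemma IsBelt.not_isLeaf (h : IsBelt W) {i : ℕ} (hi : i + 2 ≤ W.length) :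
    ¬ G.IsLeaf (W.getVert (i + 1)) := fun hl =>
  h.getVert_ne hi (hl.eq_of_adj (W.adj_getVert_succ (by omega)).symm
    (W.adj_getVert_succ (by omega)))

/-- Two belts with a common directed edge have the same end. -/
lemma IsBelt.end_eq (hG : G.IsAleksandrov) (hT : G.TreeLike) (h : IsBelt W) {a' b' : G.Node}
    {W' : G.tree.Walk a' b'} (h' : IsBelt W') {i j : ℕ} (hi : i + 1 ≤ W.length)
    (hj : j + 1 ≤ W'.length) (h0 : W.getVert i = W'.getVert j)
    (h1 : W.getVert (i + 1) = W'.getVert (j + 1)) : b = b' := by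
  have key : ∀ k, i + 1 + k ≤ W.length → j + 1 + k ≤ W'.length ∧
      W.getVert (i + k) = W'.getVert (j + k) ∧
      W.getVert (i + 1 + k) = W'.getVert (j + 1 + k) := by
    intro k
    induction k with
    | zero => exact fun _ => ⟨hj, h0, h1⟩
    | succ k ih =>
      intro hk
      obtain ⟨k1, k2, k3⟩ := ih (by omega)
      have e1 : i + 1 + k = i + k + 1 := by ring
      have e2 : j + 1 + k = j + k + 1 := by ring
      have e3 : i + 1 + (k + 1) = i + k + 2 := by ring
      have e4 : j + 1 + (k + 1) = j + k + 2 := by ring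
      rw [e1, e2] at k3
      rw [e2] at k1
      rw [e3] at hk
      have hlen : j + k + 2 ≤ W'.length := by
        by_contra hcon
        have hl : j + k + 1 = W'.length := by omega
        rw [hl, SimpleGraph.Walk.getVert_length] at k3
        apply h.not_isLeaf hk
        rw [k3]; exact h'.right.1
      refine ⟨by omega, by rw [← add_assoc, ← add_assoc, k3], ?_⟩
      rw [e3, e4]
      have t1 := h.turn hG hT hk
      have t2 := h'.turn hG hT hlen
      rw [← k3, ← k2] at t2
      exact t1.unique hG t2
  obtain ⟨k1, k2, k3⟩ := key (W.length - (i + 1)) (by omega)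
  have e1 : i + 1 + (W.length - (i + 1)) = W.length := by omega
  rw [e1, SimpleGraph.Walk.getVert_length] at k3
  rcases k1.lt_or_eq with hlt | heq
  · exfalso
    obtain ⟨m, hm⟩ : ∃ m, j + 1 + (W.length - (i + 1)) = m + 1 := ⟨j + (W.length - (i + 1)), by ring⟩
    rw [hm] at hlt k3
    apply h'.not_isLeaf (i := m) (by omega)
    rw [← k3]; exact h.right.1
  · rw [heq, SimpleGraph.Walk.getVert_length] at k3
    exact k3

lemma IsBelt.end_eq_of_start_eq (hG : G.IsAleksandrov) (hT : G.TreeLike) (h : IsBelt W)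
    {b' : G.Node} {W' : G.tree.Walk a b'} (h' : IsBelt W') : b = b' := by
  refine h.end_eq hG hT h' (i := 0) (j := 0) h.length_pos h'.length_pos (by simp) ?_
  have h1 := W.adj_getVert_succ h.length_pos
  have h2 := W'.adj_getVert_succ h'.length_pos
  rw [SimpleGraph.Walk.getVert_zero] at h1 h2
  exact h.left.1.eq_of_adj h1 h2

lemma IsBelt.eq_of_end_mem (hG : G.IsAleksandrov) (hT : G.TreeLike) (h : IsBelt W)
    {a' b' : G.Node} {W' : G.tree.Walk a' b'} (h' : IsBelt W') (he : b = a' ∨ b = b') :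
    s(a, b) = s(a', b') := by
  rcases he with rfl | rfl
  · rw [h.reverse.end_eq_of_start_eq hG hT h', Sym2.eq_swap]
  · rw [h.reverse.end_eq_of_start_eq hG hT h'.reverse]

lemma IsBelt.interior_or_end {d : G.Node} (hd : d ∈ W.support) :
    d = a ∨ d = b ∨ ∃ i, i + 2 ≤ W.length ∧ d = W.getVert (i + 1) := by
  obtain ⟨i, rfl, hi⟩ := SimpleGraph.Walk.mem_support_iff_exists_getVert.1 hd
  rcases Nat.eq_zero_or_pos i with rfl | h0
  · left; simp
  · rcases hi.lt_or_eq with h1 | rfl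
    · right; right
      exact ⟨i - 1, by omega, by congr 1; omega⟩
    · right; left; simp

/-- Distinct belts are disjoint. -/
lemma IsBelt.eq_of_mem_support (hG : G.IsAleksandrov) (hT : G.TreeLike) (h : IsBelt W)
    {a' b' : G.Node} {W' : G.tree.Walk a' b'} (h' : IsBelt W') {d : G.Node}
    (hd : d ∈ W.support) (hd' : d ∈ W'.support) : s(a, b) = s(a', b') := by
  have leaf : ∀ {a b : G.Node} {W : G.tree.Walk a b}, IsBelt W → d ∈ W.support → G.IsLeaf d →
      d = a ∨ d = b := by
    intro a b W h hd hl
    rcases IsBelt.interior_or_end hd with h1 | h1 | ⟨i, hi, rfl⟩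
    · exact Or.inl h1
    · exact Or.inr h1
    · exact absurd hl (h.not_isLeaf hi)
  rcases IsBelt.interior_or_end hd with rfl | rfl | ⟨i, hi, hdi⟩
  · rw [Sym2.eq_swap]
    exact h.reverse.eq_of_end_mem hG hT h' (leaf h' hd' h.left.1)
  · exact h.eq_of_end_mem hG hT h' (leaf h' hd' h.right.1)
  · rcases IsBelt.interior_or_end hd' with h1 | h1 | ⟨j, hj, hdj⟩
    · exact absurd (h1 ▸ h'.left.1 : G.IsLeaf d) (hdi ▸ h.not_isLeaf hi)
    · exact absurd (h1 ▸ h'.right.1 : G.IsLeaf d) (hdi ▸ h.not_isLeaf hi)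
    -- Both belts pass the node through its only nonvertex, hence through the same two neighbours;
    -- they continue together, in equal or in opposite orientation.
    · have t1 := h.turn hG hT hi
      have t2 := h'.turn hG hT hj
      rw [← hdi] at t1
      rw [← hdj] at t2
      rcases t1.eq_or hG t2 with ⟨h1, h2⟩ | ⟨h1, h2⟩
      · exact h.eq_of_end_mem hG hT h' (Or.inr (h.end_eq hG hT h' (i := i) (j := j) (by omega)
          (by omega) h1 (hdi.symm.trans hdj)))
      · refine h.eq_of_end_mem hG hT h' (Or.inl (h.end_eq hG hT h'.reverse
          (i := i) (j := W'.length - (j + 2)) (by omega) (by simp; omega) ?_ ?_))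
        · rw [SimpleGraph.Walk.getVert_reverse, h1]; congr 1; omega
        · rw [SimpleGraph.Walk.getVert_reverse, ← hdi, hdj]; congr 1; omega

end

/-! ### The number of rolling belts -/

/-- Two different pairs of ends contain at least three fold points, which is enough for the tree
property, and with it for disjointness of the belts. -/
lemma exists_belts_of_ne (hG : G.IsAleksandrov) {p q : Sym2 G.Node} (hp : p ∈ G.rollingBelts)
    (hq : q ∈ G.rollingBelts) (hpq : p ≠ q) : G.TreeLike ∧ ∃ (a b c d : G.Node)
      (W : G.tree.Walk a b) (W' : G.tree.Walk c d), p = s(a, b) ∧ q = s(c, d) ∧ IsBelt W ∧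
        IsBelt W' ∧ ∀ x ∈ W.support, x ∉ W'.support := by
  obtain ⟨a, b, rfl, h⟩ := hp
  obtain ⟨c, d, rfl, h'⟩ := hq
  obtain ⟨W, hW⟩ := h.exists_isBelt
  obtain ⟨W', hW'⟩ := h'.exists_isBelt
  have hT : G.TreeLike := by
    apply hG.treeLike
    have hfin : {a | G.IsFoldLeaf a}.Finite := Set.toFinite _
    obtain ⟨x, hx, hxa, hxb⟩ : ∃ x, G.IsFoldLeaf x ∧ x ≠ a ∧ x ≠ b := by
      by_cases hc : c = a ∨ c = b
      · refine ⟨d, hW'.right, ?_, ?_⟩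
        · rintro rfl
          rcases hc with rfl | rfl
          · exact hW'.ne rfl
          · exact hpq Sym2.eq_swap
        · rintro rfl
          rcases hc with rfl | rfl
          · exact hpq rfl
          · exact hW'.ne rfl
      · push Not at hc
        exact ⟨c, hW'.left, hc.1, hc.2⟩
    refine (Set.two_lt_ncard_iff hfin).2 ⟨a, b, x, hW.left, hW.right, hx, hW.ne, hxa.symm, hxb.symm⟩
  exact ⟨hT, a, b, c, d, W, W', rfl, rfl, hW, hW', fun x hx hx' =>
    hpq (hW.eq_of_mem_support hG hT hW' hx hx')⟩

/-- Three pairwise disjoint belts would have more than four fold points; five of their ends already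
give the contradiction. -/
theorem encard_rollingBelts_le (hG : G.IsAleksandrov) : G.rollingBelts.encard ≤ 2 := by
  by_contra hcon
  push Not at hcon
  have hrfin : G.rollingBelts.Finite := Set.toFinite _
  rw [← hrfin.cast_ncard_eq] at hcon
  obtain ⟨p, q, r, hp, hq, hr, hpq, hpr, hqr⟩ :=
    (Set.two_lt_ncard_iff hrfin).1 (by exact_mod_cast hcon)
  obtain ⟨hT, a, b, c, d, W, W', rfl, rfl, hW, hW', hdis⟩ := exists_belts_of_ne hG hp hq hpq
  obtain ⟨e, f, rfl, h⟩ := hr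
  obtain ⟨V, hV⟩ := h.exists_isBelt
  have d1 : ∀ x ∈ W.support, x ∉ V.support := fun x hx hx' =>
    hpr (hW.eq_of_mem_support hG hT hV hx hx')
  have d2 : ∀ x ∈ W'.support, x ∉ V.support := fun x hx hx' =>
    hqr (hW'.eq_of_mem_support hG hT hV hx hx')
  have hfin : {a | G.IsFoldLeaf a}.Finite := Set.toFinite _
  have hsub : ({a, b, c, d, e} : Set G.Node) ⊆ {a | G.IsFoldLeaf a} := by
    rintro x (rfl | rfl | rfl | rfl | rfl)
    exacts [hW.left, hW.right, hW'.left, hW'.right, hV.left]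
  have h1 := Set.ncard_le_ncard hsub hfin
  have h2 := hG.ncard_foldLeaf_le
  have sa := W.start_mem_support
  have sb := W.end_mem_support
  have sc := W'.start_mem_support
  have sd := W'.end_mem_support
  have se := V.start_mem_support
  have hcard : ({a, b, c, d, e} : Set G.Node).ncard = 5 := by
    have n1 : a ≠ c := fun h => hdis a sa (h ▸ sc)
    have n2 : a ≠ d := fun h => hdis a sa (h ▸ sd)
    have n3 : a ≠ e := fun h => d1 a sa (h ▸ se)
    have n4 : b ≠ c := fun h => hdis b sb (h ▸ sc)
    have n5 : b ≠ d := fun h => hdis b sb (h ▸ sd)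
    have n6 : b ≠ e := fun h => d1 b sb (h ▸ se)
    have n7 : c ≠ e := fun h => d2 c sc (h ▸ se)
    have n8 : d ≠ e := fun h => d2 d sd (h ▸ se)
    rw [Set.ncard_insert_of_notMem (by simp [hW.ne, n1, n2, n3]),
      Set.ncard_insert_of_notMem (by simp [n4, n5, n6]),
      Set.ncard_insert_of_notMem (by simp [hW'.ne, n7]), Set.ncard_pair n8]
  omega

end Gluing

/-! ### Straight parts of the boundary -/

namespace SimplePolygon

variable {n : ℕ} {P : SimplePolygon n}

lemma hasInDir_of_straight {s t : ℝ} {τ : ℂ} (hst : s < t)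
    (h : ∀ x ∈ Icc 0 (t - s), P.bdry (s + x) = P.bdry s + x * τ) : P.HasInDir t τ := by
  refine ⟨t - s, by linarith, fun x hx => ?_⟩
  have h1 := h (t - s - x) ⟨by linarith [hx.2], by linarith [hx.1]⟩
  have h2 := h (t - s) ⟨by linarith, le_rfl⟩
  rw [show s + (t - s - x) = t - x by ring] at h1
  rw [show s + (t - s) = t by ring] at h2
  rw [h1, h2]; push_cast; ring

lemma image_bdry_eq_segment {s t : ℝ} (hst : s < t)
    (hπ : ∀ u ∈ Ioo s t, P.angleAt (P.bdry u) = Real.pi) :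
    P.bdry '' Icc s t = segment ℝ (P.bdry s) (P.bdry t) := by
  obtain ⟨τ, hτ⟩ := P.exists_outDir s
  have h := P.bdry_add_eq_of_angle_eq_pi hπ hτ
  have ht := h (t - s) ⟨by linarith, le_rfl⟩
  rw [add_sub_cancel] at ht
  have h0 : t - s ≠ 0 := (sub_pos.2 hst).ne'
  have h0' : ((t - s : ℝ) : ℂ) ≠ 0 := Complex.ofReal_ne_zero.2 h0
  rw [segment_eq_image']
  ext z
  constructor
  · rintro ⟨u, hu, rfl⟩
    refine ⟨(u - s) / (t - s), ⟨div_nonneg (by linarith [hu.1]) (by linarith),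
      (div_le_one (by linarith)).2 (by linarith [hu.2])⟩, ?_⟩
    have := h (u - s) ⟨by linarith [hu.1], by linarith [hu.2]⟩
    rw [add_sub_cancel] at this
    simp only [this, ht, add_sub_cancel_left, Complex.real_smul, Complex.ofReal_div]
    field_simp
  · rintro ⟨θ, hθ, rfl⟩
    refine ⟨s + θ * (t - s), ⟨by nlinarith [hθ.1], by nlinarith [hθ.2]⟩, ?_⟩
    rw [h _ ⟨by nlinarith [hθ.1], by nlinarith [hθ.2]⟩, ht]
    simp only [add_sub_cancel_left, Complex.real_smul]
    push_cast; ring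

end SimplePolygon

namespace Gluing

variable {n : ℕ} {P : SimplePolygon n} {G : Gluing P}

/-! ### The sides of the polygon that are folded by rolling belts -/

lemma angleAt_of_not_isNodePoint {u : ℝ} (h : ¬ G.IsNodePoint (P.bdry u)) :
    P.angleAt (P.bdry u) = Real.pi := by
  refine P.angleAt_of_not_isVertex ?_
  rintro ⟨i, hi⟩
  exact h (hi ▸ G.isNodePoint_vertex i)

lemma IsArc.straight {s t : ℝ} (h : G.IsArc s t) {τ : ℂ} (hτ : P.HasOutDir s τ) :
    ∀ x ∈ Icc 0 (t - s), P.bdry (s + x) = P.bdry s + x * τ :=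
  P.bdry_add_eq_of_angle_eq_pi (fun u hu => angleAt_of_not_isNodePoint (h.2.2.2.2 u hu)) hτ

section

variable {a b : G.Node} {W : G.tree.Walk a b}

lemma IsFoldLeaf.card_eq (hT : G.TreeLike) (h : G.IsFoldLeaf a) : a.pts.card = 1 := by
  rw [← hT.2, h.1.ncard_eq]

lemma IsBelt.neighborSet_eq (hT : G.TreeLike) (h : IsBelt W) {i : ℕ} (hi : i + 2 ≤ W.length)
    (hc : (W.getVert (i + 1)).pts.card ≤ 2) :
    (W.getVert (i + 1)).pts.card = 2 ∧
      G.tree.neighborSet (W.getVert (i + 1)) = {W.getVert i, W.getVert (i + 2)} := by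
  have hsub : ({W.getVert i, W.getVert (i + 2)} : Set G.Node) ⊆
      G.tree.neighborSet (W.getVert (i + 1)) := by
    rintro x (rfl | rfl)
    · exact (W.adj_getVert_succ (by omega)).symm
    · exact W.adj_getVert_succ (by omega)
  have h2 : ({W.getVert i, W.getVert (i + 2)} : Set G.Node).ncard = 2 :=
    Set.ncard_pair (h.getVert_ne hi)
  have h3 := Set.ncard_le_ncard hsub
  rw [h2, hT.2] at h3
  refine ⟨by omega, (Set.eq_of_subset_of_ncard_le hsub ?_).symm⟩
  rw [h2, hT.2]; exact hc

/-- The belt itself provides all neighbours of an end and of a two-point interior node, so it can be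
left only at a branching node. -/
lemma IsBelt.mem_support_of_adj (hT : G.TreeLike) (h : IsBelt W) {e f : G.Node}
    (he : e ∈ W.support) (hc : e.pts.card ≤ 2) (hef : G.tree.Adj e f) : f ∈ W.support := by
  rcases IsBelt.interior_or_end he with rfl | rfl | ⟨i, hi, rfl⟩
  · have h1 := W.adj_getVert_succ h.length_pos
    rw [SimpleGraph.Walk.getVert_zero] at h1
    rw [h.left.1.eq_of_adj hef h1]
    exact W.getVert_mem_support _
  · have h1 := W.reverse.adj_getVert_succ (i := 0) (by simpa using h.length_pos)
    rw [SimpleGraph.Walk.getVert_zero] at h1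
    rw [h.right.1.eq_of_adj hef h1]
    simp
  · have h1 : f ∈ G.tree.neighborSet (W.getVert (i + 1)) := hef
    rw [(h.neighborSet_eq hT hi hc).2] at h1
    rcases h1 with rfl | rfl <;> exact W.getVert_mem_support _

/-- At a flat two-point node of the belt the nonvertex takes `π`, which leaves `π` for the other
point. -/
lemma IsBelt.angleAt_eq (hG : G.IsAleksandrov) (hT : G.TreeLike)
    (h0 : ∀ a : G.Node, ¬ G.IsFoldLeaf a → a.curv = 0) (h : IsBelt W) {e : G.Node}
    (he : e ∈ W.support) (hc : e.pts.card ≤ 2) {w : ℂ} (hw : w ∈ e.1) :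
    P.angleAt w = Real.pi := by
  have fold : ∀ {a : G.Node}, G.IsFoldLeaf a → w ∈ a.1 → P.angleAt w = Real.pi := by
    rintro a ⟨-, z, i, hz, ha⟩ hw
    rw [ha, mem_singleton_iff] at hw
    rw [hw]
    exact P.angleAt_of_not_isVertex (P.not_isVertex_of_mem_edge hz)
  by_cases hv : P.IsVertex w
  · rcases IsBelt.interior_or_end he with rfl | rfl | ⟨i, hi, rfl⟩
    · exact fold h.left hw
    · exact fold h.right hw
    · obtain ⟨h2, -⟩ := h.neighborSet_eq hT hi hc
      obtain ⟨z, hz, hzv, -⟩ := h.turn hG hT hi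
      have hne : z ≠ w := by rintro rfl; exact hzv hv
      have hpts : ({z, w} : Finset ℂ) = (W.getVert (i + 1)).pts := by
        refine Finset.eq_of_subset_of_card_le ?_ (by rw [Finset.card_pair hne, h2])
        intro x hx
        simp only [Finset.mem_insert, Finset.mem_singleton] at hx
        rcases hx with rfl | rfl <;> exact Node.mem_pts.2 ‹_›
      have := h0 (W.getVert (i + 1)) fun hf => h.not_isLeaf hi hf.1
      rw [Node.curv, ← hpts, Finset.sum_pair hne, P.angleAt_of_not_isVertex hzv] at this
      linarith
  · exact P.angleAt_of_not_isVertex hv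

/-- A belt that does not meet a node off the belt contains a branching node. -/
lemma IsBelt.exists_branch (hT : G.TreeLike) (h : IsBelt W) {c : G.Node} (hc : c ∉ W.support) :
    ∃ e ∈ W.support, 3 ≤ e.pts.card := by
  by_contra hcon
  push Not at hcon
  have key : ∀ x y : G.Node, ∀ p : G.tree.Walk x y, x ∈ W.support → y ∈ W.support := by
    intro x y p
    induction p with
    | nil => exact id
    | cons hadj p ih =>
      exact fun hx => ih (h.mem_support_of_adj hT hx (by have := hcon _ hx; omega) hadj)
  obtain ⟨p⟩ := hT.1.1.preconnected a c
  exact hc (key _ _ p W.start_mem_support)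

end

/-- Each belt has to branch in order to be connected to the other. By disjointness the branching
nodes differ, which excludes `+`. -/
lemma exists_branch_nodes (hT : G.TreeLike) (hs : IsPlus G.tree ∨ IsI G.tree) {a b c d : G.Node}
    {W : G.tree.Walk a b} {W' : G.tree.Walk c d} (h : IsBelt W) (h' : IsBelt W')
    (hd : ∀ x ∈ W.support, x ∉ W'.support) :
    IsI G.tree ∧ ∃ e ∈ W.support, ∃ e' ∈ W'.support, e.pts.card = 3 ∧ e'.pts.card = 3 ∧
      ∀ f, f ≠ e → f ≠ e' → f.pts.card ≤ 2 := by
  obtain ⟨e, he, hec⟩ := h.exists_branch hT fun hc => hd c hc W'.start_mem_support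
  obtain ⟨e', he', hec'⟩ := h'.exists_branch hT fun hc => hd a W.start_mem_support hc
  have hne : e ≠ e' := by rintro rfl; exact hd e he he'
  rcases hs with ⟨-, x, -, hx⟩ | hI
  · have key : ∀ e : G.Node, 3 ≤ e.pts.card → e = x := fun e he => by
      by_contra hcon
      have := hx e hcon
      rw [hT.deg_eq] at this
      have : e.pts.card ≤ 2 := by exact_mod_cast this
      omega
    exact absurd ((key e hec).trans (key e' hec').symm) hne
  · refine ⟨hI, e, he, e', he', ?_⟩
    obtain ⟨-, x, y, hxy, hx, hy, hxy'⟩ := hI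
    rw [hT.deg_eq] at hx hy
    have hx : x.pts.card = 3 := by exact_mod_cast hx
    have hy : y.pts.card = 3 := by exact_mod_cast hy
    have hz : ∀ z : G.Node, z ≠ x → z ≠ y → z.pts.card ≤ 2 := fun z h1 h2 => by
      have := hxy' z h1 h2
      rw [hT.deg_eq] at this
      exact_mod_cast this
    have key : ∀ e : G.Node, 3 ≤ e.pts.card → e = x ∨ e = y := fun e he => by
      by_contra hcon
      push Not at hcon
      have := hz e hcon.1 hcon.2
      omega
    rcases key e hec with rfl | rfl <;> rcases key e' hec' with rfl | rfl
    · exact absurd rfl hne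
    · exact ⟨hx, hy, hz⟩
    · exact ⟨hy, hx, fun f h1 h2 => hz f h2 h1⟩
    · exact absurd rfl hne

/-- The boundary between the parameters `s` and `t` is a straight side, folded by the belt `W`,
with corners at the branching node `d` of the belt. -/
structure IsFoldedSide {a b : G.Node} (W : G.tree.Walk a b) (d : G.Node) (s t : ℝ) : Prop where
  lt : s < t
  lt_add : t < s + P.perimeter
  left_mem : P.bdry s ∈ d.1
  right_mem : P.bdry t ∈ d.1
  left_vertex : P.IsVertex (P.bdry s)
  right_vertex : P.IsVertex (P.bdry t)
  angle_add : P.angleAt (P.bdry s) + P.angleAt (P.bdry t) = Real.pi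
  angle_eq : ∀ u ∈ Ioo s t, P.angleAt (P.bdry u) = Real.pi
  mem_support : ∀ u ∈ Icc s t, ∀ e : G.Node, P.bdry u ∈ e.1 → e ∈ W.support
  not_mem : ∀ u ∈ Ioo t (s + P.perimeter), P.bdry u ∉ d.1

/-- A boundary walk around a branch stays in a set of nodes from which there are no edges to
the outside. -/
lemma TreeLike.mem_of_gap (hT : G.TreeLike) {S : Set G.Node} {d : G.Node}
    (hS : ∀ e ∈ S, e ≠ d → ∀ f, G.tree.Adj e f → f ∈ S) {s t r : ℝ} (h : G.IsArc s t)
    (hd : ∀ u ∈ Ioo s r, P.bdry u ∉ d.1) {c : G.Node} (hc : P.bdry t ∈ c.1) (hcS : c ∈ S) {u : ℝ}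
    (hu : u ∈ Ioo s r) {e : G.Node} (he : P.bdry u ∈ e.1) : e ∈ S := by
  refine arc_induction (G := G) (s := t) (T := u) (fun v => ∀ e : G.Node, P.bdry v ∈ e.1 → e ∈ S)
    h.2.2.2.1 (fun e he => Node.eq_of_mem hc he ▸ hcS) ?_
    (h.right_le_of_lt (e.isNodePoint he) hu.1) le_rfl (e.isNodePoint he) e he
  intro x y htx hyu hxy ih f hf
  have hx := G.mem_nodeAt hxy.2.2.1
  refine hS _ (ih _ hx) ?_ f (hT.adj hxy hx hf)
  intro heq
  rw [heq] at hx
  exact hd x ⟨by linarith [h.1], by linarith [hxy.1, hu.2]⟩ hx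

/-- The three visits of the boundary to `d` are the nonvertex `ζ`, through which the belt passes,
and then `η` and `ξ`. The walks just before and just after `ζ` stay on the belt, so the side runs
from `ξ`, one period back, through `ζ` to `η`. At `ζ` the angle is `π`, so flatness leaves `π` for
the two corners. -/
theorem IsBelt.exists_isFoldedSide (hG : G.IsAleksandrov) (hT : G.TreeLike)
    (h0 : ∀ a : G.Node, ¬ G.IsFoldLeaf a → a.curv = 0) {a b : G.Node} {W : G.tree.Walk a b}
    (h : IsBelt W) {d : G.Node} (hd : d ∈ W.support) (hd3 : d.pts.card = 3)
    (hW : ∀ e ∈ W.support, e ≠ d → e.pts.card ≤ 2) : ∃ s t, IsFoldedSide W d s t := by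
  have hL := P.perimeter_pos
  have hdf : ¬ G.IsFoldLeaf d := fun hf => by rw [hf.card_eq hT] at hd3; omega
  obtain ⟨z, c, e, hcW, heW, hz, hzv, hc, he⟩ : ∃ z c e, c ∈ W.support ∧ e ∈ W.support ∧ z ∈ d.1 ∧
      ¬ P.IsVertex z ∧ G.nbrNode (z, true) = c ∧ G.nbrNode (z, false) = e := by
    rcases IsBelt.interior_or_end hd with rfl | rfl | ⟨i, hi, rfl⟩
    · exact absurd h.left hdf
    · exact absurd h.right hdf
    · obtain ⟨z, hz, hzv, ⟨h1, h2⟩ | ⟨h1, h2⟩⟩ := h.turn hG hT hi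
      · exact ⟨z, _, _, W.getVert_mem_support _, W.getVert_mem_support _, hz, hzv, h1, h2⟩
      · exact ⟨z, _, _, W.getVert_mem_support _, W.getVert_mem_support _, hz, hzv, h1, h2⟩
  obtain ⟨ζ, rfl⟩ := P.exists_bdry_eq (d.mem_boundary hz)
  obtain ⟨η, hη, hηd, hn1⟩ := d.exists_next hz
  obtain ⟨ξ, hξ, hξd, hn2⟩ := d.exists_next hηd
  have hzL : P.bdry (ζ + P.perimeter) ∈ d.1 := by rwa [P.bdry_add_perimeter]
  have hrep : ∀ w ∈ d.1, ∃ u ∈ Ico ζ (ζ + P.perimeter), P.bdry u = w := by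
    intro w hw
    obtain ⟨u, rfl⟩ := P.exists_bdry_eq (d.mem_boundary hw)
    refine ⟨toIcoMod hL ζ u, toIcoMod_mem_Ico hL ζ u, ?_⟩
    rw [P.bdry_eq_bdry_iff]
    refine ⟨-toIcoDiv hL ζ u, ?_⟩
    have := toIcoMod_add_toIcoDiv_zsmul hL ζ u
    rw [zsmul_eq_mul] at this
    push_cast; linarith
  have hξ1 : ξ < ζ + P.perimeter := by
    by_contra hcon
    have hsub : d.pts ⊆ {P.bdry ζ, P.bdry η} := by
      intro w hw
      rw [Node.mem_pts] at hw
      obtain ⟨u, hu, rfl⟩ := hrep w hw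
      simp only [Finset.mem_insert, Finset.mem_singleton]
      rcases hu.1.lt_or_eq with h1 | rfl
      · rcases lt_trichotomy u η with h2 | rfl | h2
        · exact absurd hw (hn1 u ⟨h1, h2⟩)
        · right; rfl
        · exact absurd hw (hn2 u ⟨h2, by linarith [hu.2, not_lt.1 hcon]⟩)
      · left; rfl
    have := (Finset.card_le_card hsub).trans Finset.card_le_two
    omega
  have n1 : P.bdry ζ ≠ P.bdry η := P.bdry_ne_of_lt hη.1 (by linarith [hξ.1])
  have n2 : P.bdry η ≠ P.bdry ξ := P.bdry_ne_of_lt hξ.1 (by linarith [hη.1])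
  have n3 : P.bdry ζ ≠ P.bdry ξ := P.bdry_ne_of_lt (hη.1.trans hξ.1) hξ1
  have hpts : ({P.bdry ζ, P.bdry η, P.bdry ξ} : Finset ℂ) = d.pts := by
    refine Finset.eq_of_subset_of_card_le ?_ ?_
    · intro x hx
      simp only [Finset.mem_insert, Finset.mem_singleton] at hx
      rcases hx with rfl | rfl | rfl <;> exact Node.mem_pts.2 ‹_›
    · rw [Finset.card_insert_of_notMem (by simp [n1, n3]), Finset.card_pair n2, hd3]
  have hn3 : ∀ u ∈ Ioo ξ (ζ + P.perimeter), P.bdry u ∉ d.1 := by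
    intro u hu hud
    rw [← Node.mem_pts, ← hpts] at hud
    simp only [Finset.mem_insert, Finset.mem_singleton] at hud
    rcases hud with h1 | h1 | h1
    · exact P.bdry_ne_of_lt (hη.1.trans (hξ.1.trans hu.1)) hu.2 h1.symm
    · exact P.bdry_ne_of_lt (hξ.1.trans hu.1) (by linarith [hu.2, hη.1]) h1.symm
    · exact P.bdry_ne_of_lt hu.1 (by linarith [hu.2, hη.1, hξ.1]) h1.symm
  have hcurv := h0 d hdf
  rw [Node.curv, ← hpts, Finset.sum_insert (by simp [n1, n3]), Finset.sum_pair n2,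
    P.angleAt_of_not_isVertex hzv] at hcurv
  have hS : ∀ e ∈ {e | e ∈ W.support}, e ≠ d → ∀ f, G.tree.Adj e f → f ∈ {e | e ∈ W.support} :=
    fun e he hne f hef => h.mem_support_of_adj hT he (hW e he hne) hef
  have hm1 : ∀ u ∈ Ioo ζ η, ∀ e : G.Node, P.bdry u ∈ e.1 → e ∈ W.support := by
    obtain ⟨t, ht⟩ := exists_arc_right (d.isNodePoint hz)
    have htc : P.bdry t ∈ c.1 := by
      rw [← hc, ht.nbrNode_true (G.mem_nodeAt ht.2.2.2.1)]; exact G.mem_nodeAt _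
    exact fun u hu e he => hT.mem_of_gap hS ht hn1 htc hcW hu he
  -- The arc that arrives at `ζ` comes from `e`, and it is glued to the arc that leaves `ξ`; so this
  -- walk starts on the belt as well.
  have hm2 : ∀ u ∈ Ioo ξ (ζ + P.perimeter), ∀ e : G.Node, P.bdry u ∈ e.1 → e ∈ W.support := by
    obtain ⟨t, ht⟩ := exists_arc_right (d.isNodePoint hξd)
    obtain ⟨q, hq, -, hlen, hg⟩ := hT.gap ht hξd hzL hξ1 hn3
    have hqe : P.bdry q ∈ e.1 := by
      rw [← P.bdry_add_perimeter ζ, hq.nbrNode_false (G.mem_nodeAt hq.2.2.1)] at he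
      rw [← he]; exact G.mem_nodeAt _
    have := hg (t - ξ) ⟨by linarith [ht.1], le_rfl⟩
    rw [add_sub_cancel, ← hlen, sub_sub_cancel] at this
    exact fun u hu f hf => hT.mem_of_gap hS ht hn3 (e.mem_of_glued hqe this.symm) heW hu hf
  have hξb : P.bdry (ξ - P.perimeter) = P.bdry ξ := by
    rw [← P.bdry_add_perimeter (ξ - P.perimeter), sub_add_cancel]
  have hm : ∀ u ∈ Ioo (ξ - P.perimeter) η, ∀ e : G.Node, P.bdry u ∈ e.1 → e ∈ W.support := by
    intro u hu f hf
    rcases lt_trichotomy u ζ with h1 | rfl | h1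
    · refine hm2 (u + P.perimeter) ⟨by linarith [hu.1], by linarith⟩ f ?_
      rwa [P.bdry_add_perimeter]
    · rwa [← Node.eq_of_mem hz hf]
    · exact hm1 u ⟨h1, hu.2⟩ f hf
  have vertex : ∀ w ∈ d.1, P.bdry ζ ≠ w → P.IsVertex w := by
    intro w hw hne
    by_contra hcon
    exact hne (hG.subsingleton_nonvertex d ⟨hz, hzv⟩ ⟨hw, hcon⟩)
  refine ⟨ξ - P.perimeter, η, by linarith [hη.1], by linarith [hξ.1], by rwa [hξb], hηd,
    hξb ▸ vertex _ hξd n3, vertex _ hηd n1, by rw [hξb]; linarith, ?_, ?_, ?_⟩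
  · intro u hu
    by_cases hn : G.IsNodePoint (P.bdry u)
    · by_cases hud : P.bdry u ∈ d.1
      · rcases lt_trichotomy u ζ with h1 | rfl | h1
        · refine absurd ?_ (hn3 (u + P.perimeter) ⟨by linarith [hu.1], by linarith⟩)
          rwa [P.bdry_add_perimeter]
        · exact P.angleAt_of_not_isVertex hzv
        · exact absurd hud (hn1 u ⟨h1, hu.2⟩)
      · have hmem := G.mem_nodeAt hn
        have hW' := hm u hu _ hmem
        refine h.angleAt_eq hG hT h0 hW' (hW _ hW' ?_) hmem
        intro heq
        rw [heq] at hmem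
        exact hud hmem
    · exact angleAt_of_not_isNodePoint hn
  · intro u hu f hf
    rcases hu.1.lt_or_eq with h1 | rfl
    · rcases hu.2.lt_or_eq with h2 | rfl
      · exact hm u ⟨h1, h2⟩ f hf
      · rwa [← Node.eq_of_mem hηd hf]
    · rw [hξb] at hf
      rwa [← Node.eq_of_mem hξd hf]
  · rw [sub_add_cancel]; exact hn2

lemma IsFoldedSide.shift {a b : G.Node} {W : G.tree.Walk a b} {d : G.Node} {s t : ℝ}
    (h : IsFoldedSide W d s t) (k : ℤ) :
    IsFoldedSide W d (s + k * P.perimeter) (t + k * P.perimeter) where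
  lt := by linarith [h.lt]
  lt_add := by linarith [h.lt_add]
  left_mem := by rw [P.bdry_add_int_mul]; exact h.left_mem
  right_mem := by rw [P.bdry_add_int_mul]; exact h.right_mem
  left_vertex := by rw [P.bdry_add_int_mul]; exact h.left_vertex
  right_vertex := by rw [P.bdry_add_int_mul]; exact h.right_vertex
  angle_add := by rw [P.bdry_add_int_mul, P.bdry_add_int_mul]; exact h.angle_add
  angle_eq u hu := by
    have := h.angle_eq (u - k * P.perimeter) ⟨by linarith [hu.1], by linarith [hu.2]⟩
    rwa [← P.bdry_add_int_mul _ k, sub_add_cancel] at this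
  mem_support u hu := by
    have := h.mem_support (u - k * P.perimeter) ⟨by linarith [hu.1], by linarith [hu.2]⟩
    rwa [← P.bdry_add_int_mul _ k, sub_add_cancel] at this
  not_mem u hu := by
    have := h.not_mem (u - k * P.perimeter) ⟨by linarith [hu.1], by linarith [hu.2]⟩
    rwa [← P.bdry_add_int_mul _ k, sub_add_cancel] at this

end Gluing

namespace Gluing

variable {n : ℕ} {P : SimplePolygon n} {G : Gluing P}

/-! ### Two rolling belts -/

lemma exp_mul_exp_of_add_eq {α β : ℝ} (h : α + β = 2 * Real.pi) :
    Complex.exp ((Real.pi - β : ℝ) * Complex.I) * Complex.exp ((Real.pi - α : ℝ) * Complex.I) =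
      1 := by
  rw [← Complex.exp_add, ← add_mul, ← Complex.ofReal_add,
    show Real.pi - β + (Real.pi - α) = 0 by linarith]
  simp

lemma exp_mul_exp_of_add_eq_pi {α β : ℝ} (h : α + β = Real.pi) :
    Complex.exp ((Real.pi - β : ℝ) * Complex.I) * Complex.exp ((Real.pi - α : ℝ) * Complex.I) =
      -1 := by
  rw [← Complex.exp_add, ← add_mul, ← Complex.ofReal_add,
    show Real.pi - β + (Real.pi - α) = Real.pi by linarith, Complex.exp_pi_mul_I]

/-- The boundary directions at the ends of a straight side with angles that add up to `π`. -/
lemma IsFoldedSide.outDir_eq {a b : G.Node} {W : G.tree.Walk a b} {d : G.Node} {s t : ℝ}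
    (h : IsFoldedSide W d s t) {σ τ : ℂ} (hσ : P.HasInDir (s + P.perimeter) σ)
    (hτ : P.HasOutDir t τ) : τ = -σ := by
  obtain ⟨ρ, hρ⟩ := P.exists_outDir s
  have hst := P.bdry_add_eq_of_angle_eq_pi h.angle_eq hρ
  have hin := SimplePolygon.hasInDir_of_straight h.lt hst
  have hρ' : P.HasOutDir (s + P.perimeter) ρ := by
    obtain ⟨ε, hε, hx⟩ := hρ
    refine ⟨ε, hε, fun x hxm => ?_⟩
    rw [P.bdry_add_perimeter, ← hx x hxm]
    exact P.bdry_add_congr (P.bdry_add_perimeter s) x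
  have e1 := hin.outDir_eq hτ
  have e2 := hσ.outDir_eq hρ'
  rw [P.bdry_add_perimeter] at e2
  rw [e1, e2, mul_assoc, exp_mul_exp_of_add_eq_pi (by linarith [h.angle_add])]
  ring

/-- The two arcs that follow a pair of glued points run in opposite directions if they start in
opposite directions, and so do their continuations if the angles add up to `2π`. -/
lemma step_parallel {u v q u' : ℝ} (huv : G.IsArc u v) (hqu : G.IsArc q u') (hlen : u' - q = v - u)
    (hdir : ∀ σ τ, P.HasInDir u' σ → P.HasOutDir u τ → τ = -σ) :
    (∀ x ∈ Icc 0 (v - u), P.bdry (u + x) - P.bdry u = P.bdry (u' - x) - P.bdry u') ∧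
    (P.angleAt (P.bdry v) + P.angleAt (P.bdry q) = 2 * Real.pi →
      ∀ σ τ, P.HasInDir q σ → P.HasOutDir v τ → τ = -σ) := by
  obtain ⟨τ, hτ⟩ := P.exists_outDir u
  obtain ⟨σ, hσ⟩ := P.exists_outDir q
  have h1 := huv.straight hτ
  have h2 := hqu.straight hσ
  have hin := SimplePolygon.hasInDir_of_straight hqu.1 h2
  have e := hdir σ τ hin hτ
  constructor
  · intro x hx
    rw [h1 x hx, e]
    have h3 := h2 (u' - q - x) ⟨by linarith [hx.2], by linarith [hx.1]⟩
    have h4 := h2 (u' - q) ⟨by linarith [hqu.1], le_rfl⟩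
    rw [show q + (u' - q - x) = u' - x by ring] at h3
    rw [show q + (u' - q) = u' by ring] at h4
    rw [h3, h4]; push_cast; ring
  · intro hang σ' τ' hσ' hτ'
    have e1 := (SimplePolygon.hasInDir_of_straight huv.1 h1).outDir_eq hτ'
    have e2 := hσ'.outDir_eq hσ
    rw [e1, e, e2, neg_mul, mul_assoc, exp_mul_exp_of_add_eq hang, mul_one]

/-- Walk from the first side to the second one along both connecting paths at equal speed. The nodes
strictly in between are flat pairs of points, so the two paths turn by opposite angles and remain
antiparallel. -/
theorem isFromComplementaryQuadrilateral_of_sides (hT : G.TreeLike)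
    (h0 : ∀ a : G.Node, ¬ G.IsFoldLeaf a → a.curv = 0) {a b a' b' : G.Node}
    {W : G.tree.Walk a b} {W' : G.tree.Walk a' b'} (hWW' : ∀ x ∈ W.support, x ∉ W'.support)
    {d d' : G.Node} (hd : d ∈ W.support) (hd' : d' ∈ W'.support)
    (hcard : ∀ f, f ≠ d → f ≠ d' → f.pts.card ≤ 2) {ξ η ξ' η' : ℝ}
    (h : IsFoldedSide W d ξ η) (h' : IsFoldedSide W' d' ξ' η') :
    G.IsFromComplementaryQuadrilateral := by
  have hL := P.perimeter_pos
  wlog hξ' : ξ' ∈ Ico η (η + P.perimeter) generalizing ξ' η'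
  · refine this (h'.shift (-toIcoDiv hL η ξ')) ?_
    have h2 := toIcoMod_add_toIcoDiv_zsmul hL η ξ'
    rw [zsmul_eq_mul] at h2
    have e : ξ' + ((-toIcoDiv hL η ξ' : ℤ) : ℝ) * P.perimeter = toIcoMod hL η ξ' := by
      push_cast; linarith
    rw [e]
    exact toIcoMod_mem_Ico hL η ξ'
  have hsL := h.shift 1
  rw [Int.cast_one, one_mul] at hsL
  -- Disjointness of the belts keeps the corners of one side off the other side and yields the
  -- cyclic order of the four corners.
  have k1 : η < ξ' := by
    refine lt_of_le_of_ne hξ'.1 ?_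
    rintro rfl
    exact hWW' d hd (h'.mem_support η ⟨le_rfl, h'.lt.le⟩ d h.right_mem)
  have k2 : ξ' < ξ + P.perimeter := by
    by_contra hcon
    exact hWW' d' (hsL.mem_support ξ' ⟨not_lt.1 hcon, hξ'.2.le⟩ d' h'.left_mem) hd'
  have k3 : η' < ξ + P.perimeter := by
    by_contra hcon
    exact hWW' d hd (h'.mem_support (ξ + P.perimeter) ⟨k2.le, not_lt.1 hcon⟩ d hsL.left_mem)
  have hdd' : d ≠ d' := by rintro rfl; exact hWW' d hd hd'
  have hlt := h.lt
  have hlt' := h'.lt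
  have hn1 : ∀ u ∈ Ioo η ξ', P.bdry u ∉ d'.1 := by
    intro u hu hud
    refine h'.not_mem (u + P.perimeter) ⟨by linarith [hu.1], by linarith [hu.2]⟩ ?_
    rwa [P.bdry_add_perimeter]
  have hn2 : ∀ u ∈ Ioo η' (ξ' + P.perimeter), P.bdry u ∉ d'.1 := h'.not_mem
  have hb : ∀ x, P.bdry (ξ + P.perimeter - x) = P.bdry (ξ - x) := fun x => by
    rw [← P.bdry_add_perimeter (ξ - x)]; congr 1; ring
  have hsL' := hsL.left_mem
  -- simultaneous walk from the first side to the second one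
  have main : ∃ u', ξ' - η = ξ + P.perimeter - u' ∧ η' ≤ u' ∧
      (∃ e : G.Node, P.bdry ξ' ∈ e.1 ∧ P.bdry u' ∈ e.1) ∧
      (∀ x ∈ Icc 0 (ξ' - η), G.Glued (P.bdry (η + x)) (P.bdry (ξ - x)) ∧
        P.bdry (η + x) - P.bdry η = P.bdry (ξ - x) - P.bdry ξ) := by
    -- The invariant: `u` forwards and `u'` backwards have covered equal lengths and lie at a common
    -- node. Until the second side is reached, this node is not visited in between, so that
    -- `TreeLike.gap` applies, and the directions are opposite.
    have := arc_induction (G := G) (s := η) (T := ξ') (fun u => ∃ u', u - η = ξ + P.perimeter - u' ∧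
      η' ≤ u' ∧ (∃ e : G.Node, P.bdry u ∈ e.1 ∧ P.bdry u' ∈ e.1 ∧
        (u < ξ' → ∀ v ∈ Ioo u u', P.bdry v ∉ e.1)) ∧
      (u < ξ' → ∀ σ τ, P.HasInDir u' σ → P.HasOutDir u τ → τ = -σ) ∧
      (∀ x ∈ Icc 0 (u - η), G.Glued (P.bdry (η + x)) (P.bdry (ξ - x)) ∧
        P.bdry (η + x) - P.bdry η = P.bdry (ξ - x) - P.bdry ξ)) (d.isNodePoint h.right_mem) ?_ ?_
      k1.le le_rfl (d'.isNodePoint h'.left_mem)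
    · obtain ⟨u', h1, h2, ⟨e, h3, h4, -⟩, -, h5⟩ := this
      exact ⟨u', h1, h2, ⟨e, h3, h4⟩, h5⟩
    · refine ⟨ξ + P.perimeter, by ring, k3.le, ⟨d, h.right_mem, hsL', fun _ => h.not_mem⟩,
        fun _ σ τ hσ hτ => h.outDir_eq hσ hτ, ?_⟩
      intro x hx
      have hx0 : x = 0 := le_antisymm (by linarith [hx.2]) hx.1
      subst hx0
      rw [add_zero, sub_zero]
      exact ⟨d.glued h.right_mem h.left_mem, by ring⟩
    · rintro u v hηu hvξ huv ⟨u', hlen, hu', ⟨e, heu, heu', hne⟩, hdir, hall⟩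
      have huξ : u < ξ' := huv.1.trans_le hvξ
      obtain ⟨q, hq, hvq, hqlen, hg⟩ := hT.gap huv heu heu' (by linarith) (hne huξ)
      have hηq : η' ≤ q := by
        refine hq.le_left_of_lt (d'.isNodePoint h'.right_mem) (lt_of_le_of_ne hu' ?_)
        rintro rfl
        rw [Node.eq_of_mem heu' h'.right_mem] at heu
        rcases hηu.lt_or_eq with h1 | rfl
        · exact hn1 u ⟨h1, huξ⟩ heu
        · exact hdd' (Node.eq_of_mem h.right_mem heu)
      obtain ⟨hpar, hcont⟩ := step_parallel huv hq hqlen (hdir huξ)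
      set c := G.nodeAt _ huv.2.2.2.1 with hc
      have hcv : P.bdry v ∈ c.1 := G.mem_nodeAt _
      have hcq : P.bdry q ∈ c.1 := by
        have := hg (v - u) ⟨by linarith [huv.1], le_rfl⟩
        rw [add_sub_cancel, ← hqlen, sub_sub_cancel] at this
        exact c.mem_of_glued hcv this
      have hvq' : v < q := by linarith
      have hne' : P.bdry v ≠ P.bdry q := P.bdry_ne_of_lt hvq' (by linarith [huv.1, hq.1])
      have hsub : ({P.bdry v, P.bdry q} : Finset ℂ) ⊆ c.pts := by
        intro x hx
        simp only [Finset.mem_insert, Finset.mem_singleton] at hx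
        rcases hx with rfl | rfl <;> exact Node.mem_pts.2 ‹_›
      -- Before the second side is reached, the node is neither `d` nor `d'`, hence has only two
      -- points; zero curvature then makes their angles add up to `2π`.
      have hpts : v < ξ' → ({P.bdry v, P.bdry q} : Finset ℂ) = c.pts := by
        intro hvlt
        refine Finset.eq_of_subset_of_card_le hsub ?_
        rw [Finset.card_pair hne']
        refine hcard c ?_ ?_
        · intro hcd
          rw [hcd] at hcv
          exact h.not_mem v ⟨by linarith [huv.1], by linarith⟩ hcv
        · intro hcd
          rw [hcd] at hcv
          exact hn1 v ⟨by linarith [huv.1], hvlt⟩ hcv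
      refine ⟨q, by linarith, hηq, ⟨c, hcv, hcq, ?_⟩, ?_, ?_⟩
      · intro hvlt x hx hxc
        rw [← Node.mem_pts, ← hpts hvlt] at hxc
        simp only [Finset.mem_insert, Finset.mem_singleton] at hxc
        rcases hxc with h1 | h1
        · exact P.bdry_ne_of_lt hx.1 (by linarith [hx.2, huv.1, hq.1]) h1.symm
        · exact P.bdry_ne_of_lt hx.2 (by linarith [hx.1, huv.1, hq.1]) h1
      · intro hvlt
        refine hcont ?_
        have hcf : ¬ G.IsFoldLeaf c := fun hf => by
          have := Finset.card_le_card hsub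
          rw [Finset.card_pair hne', hf.card_eq hT] at this
          omega
        have := h0 c hcf
        rw [Node.curv, ← hpts hvlt, Finset.sum_pair hne'] at this
        linarith
      · intro x hx
        rcases le_total x (u - η) with hxu | hxu
        · exact hall x ⟨hx.1, hxu⟩
        · have hy : x - (u - η) ∈ Icc 0 (v - u) := ⟨by linarith, by linarith [hx.2]⟩
          obtain ⟨-, h2⟩ := hall (u - η) ⟨by linarith, le_rfl⟩
          have h1 := hg _ hy
          have h3 := hpar _ hy
          rw [show u + (x - (u - η)) = η + x by ring,
            show u' - (x - (u - η)) = ξ + P.perimeter - x by linarith, hb] at h1 h3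
          rw [show u' = ξ + P.perimeter - (u - η) by linarith, hb] at h3
          rw [add_sub_cancel] at h2
          exact ⟨h1, by linear_combination h2 + h3⟩
  obtain ⟨u', hlen, hu', ⟨e, he, heu'⟩, hall⟩ := main
  have hed := Node.eq_of_mem he h'.left_mem
  -- Both walks arrive at `d'` at the same time, and the boundary does not visit `d'` between `η'`
  -- and the start of the second side one period later.
  have hu'η : u' = η' := by
    refine le_antisymm (not_lt.1 fun hcon => ?_) hu'
    rw [hed] at heu'
    exact hn2 u' ⟨hcon, by linarith⟩ heu'
  subst hu'η
  -- The rigid motion is a translation, so the rotation factor is `1`. Each corner angle is less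
  -- than `π`, since it is one of two positive angles with sum `π`.
  refine ⟨ξ, η, ξ', u', hlt, k1, hlt', k3, ?_, SimplePolygon.image_bdry_eq_segment hlt h.angle_eq,
    SimplePolygon.image_bdry_eq_segment hlt' h'.angle_eq, hlen, 1, P.bdry η - P.bdry ξ, by simp,
    fun t ht => ⟨?_, (hall t ht).1⟩⟩
  · have p1 := P.angleAt_pos (P.bdry ξ)
    have p2 := P.angleAt_pos (P.bdry η)
    have p3 := P.angleAt_pos (P.bdry ξ')
    have p4 := P.angleAt_pos (P.bdry u')
    have s1 := h.angle_add
    have s2 := h'.angle_add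
    rintro s (rfl | rfl | rfl | rfl)
    · exact ⟨h.left_vertex, by linarith⟩
    · exact ⟨h.right_vertex, by linarith⟩
    · exact ⟨h'.left_vertex, by linarith⟩
    · exact ⟨h'.right_vertex, by linarith⟩
  · linear_combination (hall t ht).2

theorem isI_and_quadrilateral_of_rollingBelts (hG : G.IsAleksandrov)
    (h : G.rollingBelts.encard = 2) : IsI G.tree ∧ G.IsFromComplementaryQuadrilateral := by
  obtain ⟨p, q, hpq, hpq'⟩ := Set.encard_eq_two.1 h
  obtain ⟨hT, a, b, c, d, W, W', rfl, rfl, hW, hW', hdis⟩ :=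
    exists_belts_of_ne hG (hpq' ▸ Or.inl rfl) (hpq' ▸ Or.inr rfl) hpq
  -- The ends of two disjoint belts are four different fold points, the maximum; so all other nodes
  -- are flat.
  have h4 : {a | G.IsFoldLeaf a}.ncard = 4 := by
    refine le_antisymm hG.ncard_foldLeaf_le ?_
    have hsub : ({a, b, c, d} : Set G.Node) ⊆ {a | G.IsFoldLeaf a} := by
      rintro x (rfl | rfl | rfl | rfl)
      exacts [hW.left, hW.right, hW'.left, hW'.right]
    refine le_trans (le_of_eq ?_) (Set.ncard_le_ncard hsub)
    have sa := W.start_mem_support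
    have sb := W.end_mem_support
    have sc := W'.start_mem_support
    have sd := W'.end_mem_support
    have n1 : a ≠ c := fun h => hdis a sa (h ▸ sc)
    have n2 : a ≠ d := fun h => hdis a sa (h ▸ sd)
    have n3 : b ≠ c := fun h => hdis b sb (h ▸ sc)
    have n4 : b ≠ d := fun h => hdis b sb (h ▸ sd)
    rw [Set.ncard_insert_of_notMem (by simp [hW.ne, n1, n2]),
      Set.ncard_insert_of_notMem (by simp [n3, n4]), Set.ncard_pair hW'.ne]
  have h0 : ∀ a : G.Node, ¬ G.IsFoldLeaf a → a.curv = 0 := fun a ha => hG.curv_eq_zero h4 ha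
  have hleaf : {a | G.IsLeaf a}.ncard = 4 := by
    rw [← h4]
    congr 1
    ext x
    exact ⟨hT.isFoldLeaf_of_isLeaf h0, fun hx => hx.1⟩
  obtain ⟨hI, e, he, e', he', hc, hc', hcard⟩ :=
    exists_branch_nodes hT (hT.isPlus_or_isI hleaf) hW hW' hdis
  refine ⟨hI, ?_⟩
  obtain ⟨ξ, η, hs⟩ := hW.exists_isFoldedSide hG hT h0 he hc fun f hf hfe => hcard f hfe (by
    rintro rfl; exact hdis f hf he')
  obtain ⟨ξ', η', hs'⟩ := hW'.exists_isFoldedSide hG hT h0 he' hc' fun f hf hfe => hcard f (by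
    rintro rfl; exact hdis f he hf) hfe
  exact isFromComplementaryQuadrilateral_of_sides hT h0 hdis he he' hcard hs hs'

theorem IsAleksandrov.leaves_of_four_foldLeaves (hG : G.IsAleksandrov)
    (h : {a | G.IsFoldLeaf a}.encard = 4) :
    {a | G.IsLeaf a}.encard = 4 ∧ (IsPlus G.tree ∨ IsI G.tree) := by
  have h4 : {a | G.IsFoldLeaf a}.ncard = 4 := by rw [Set.ncard, h]; rfl
  have hT := hG.treeLike (by omega)
  have e : {a | G.IsLeaf a} = {a | G.IsFoldLeaf a} := by
    ext x
    exact ⟨hT.isFoldLeaf_of_isLeaf fun a ha => hG.curv_eq_zero h4 ha, fun hx => hx.1⟩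
  exact ⟨e ▸ h, hT.isPlus_or_isI (e ▸ h4)⟩

end Gluing

end PolygonFolding

end

theorem mainTheorem4 {n : ℕ} (P : PolygonFolding.SimplePolygon n) (G : PolygonFolding.Gluing P)
    (hG : G.IsAleksandrov) :
    (∀ a : G.Node, PolygonFolding.deg G.tree a ≠ 2 → {z ∈ a.1 | ¬ P.IsVertex z}.Subsingleton) ∧
    {a | G.IsFoldLeaf a}.encard ≤ 4 ∧
    ({a | G.IsFoldLeaf a}.encard = 4 →
      {a | G.IsLeaf a}.encard = 4 ∧
        (PolygonFolding.IsPlus G.tree ∨ PolygonFolding.IsI G.tree)) ∧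
    G.rollingBelts.encard ≤ 2 ∧
    (G.rollingBelts.encard = 2 →
      PolygonFolding.IsI G.tree ∧ G.IsFromComplementaryQuadrilateral) := by
  refine ⟨fun a _ => hG.subsingleton_nonvertex a, ?_, hG.leaves_of_four_foldLeaves,
    PolygonFolding.Gluing.encard_rollingBelts_le hG,
    PolygonFolding.Gluing.isI_and_quadrilateral_of_rollingBelts hG⟩
  rw [← (Set.toFinite _).cast_ncard_eq]
  exact_mod_cast hG.ncard_foldLeaf_le
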